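/- **Theorem.** Let $N\ge 2$. Let $q,t,\kappa\in\mathbb C^\times$ with $|q|,|\kappa|<1$, fix an $N$-th root $\kappa^{1/N}$, and let $s_1,\dots,s_N\in\mathbb C^\times$. Assume the parameters are generic: $q,\kappa^{1/N},t$ are multiplicatively independent, and $s_i/s_j$ ($i\neq j$) is not in the group generated by $q,\kappa^{1/N},t$. Put $(u;q)_n=\prod_{i=0}^{n-1}(1-q^iu)$, $(u;q)_\infty=\prod_{i\ge0}(1-q^iu)$, $(u;q,p)_\infty=\prod_{i,j\ge 0}(1-q^ip^ju)$. Let $x_1,\dots,x_N,p$ be indeterminates with $x_{i+N}=x_i$. Let $\mathsf P$ be the set of partitions and $\ell(\lambda)$ the length of $\lambda$. *The series $f$.* For $k\in\mathbb Z/N\mathbb Z$ and $\lambda,\mu\in\mathsf P$ let $$\mathsf N^{(k)}_{\lambda,\mu}(u|q,\kappa)=\prod_{j\ge i\ge1,\ j-i\equiv k\,(N)}(uq^{-\mu_i+\lambda_{j+1}}\kappa^{j-i};q)_{\lambda_j-\lambda_{j+1}}\prod_{b\ge a\ge1,\ b-a\equiv -k-1\,(N)}(uq^{\lambda_a-\mu_b}\kappa^{a-b-1};q)_{\mu_b-\mu_{b+1}},$$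 $$f^{\widehat{\mathfrak{gl}}_N}(x,p|s,\kappa|q,t)=\sum_{\lambda^{(1)},\dots,\lambda^{(N)}\in\mathsf P}\ \prod_{i,j=1}^N\frac{\mathsf N^{(j-i)}_{\lambda^{(i)},\lambda^{(j)}}(ts_j/s_i|q,\kappa)}{\mathsf N^{(j-i)}_{\lambda^{(i)},\lambda^{(j)}}(s_j/s_i|q,\kappa)}\ \prod_{b=1}^N\prod_{a\ge1}\Bigl(\frac{p\,x_{a+b}}{t\,x_{a+b-1}}\Bigr)^{\lambda^{(b)}_a},$$ a formal power series in $px_2/x_1,\dots,px_N/x_{N-1},px_1/x_N$. *The operators.* Let $\mathfrak h_N$ be the Heisenberg algebra generated by $\beta^i_n$ ($0\le i\le N-1$, $n\in\mathbb Z\setminus\{0\}$) with $[\beta^i_n,\beta^j_m]=n\frac{1-t^n}{1-q^n}\,c_{ij}(n)\,\delta_{n+m,0}$, where $c_{ii}(n)=\frac{1-\kappa^nq^nt^{-n}}{1-\kappa^n}$, $c_{ij}(n)=\frac{1-q^nt^{-n}}{1-\kappa^n}\kappa^{n(j-i)/N}$ for $i<j$ and $c_{ij}(n)=\frac{1-q^nt^{-n}}{1-\kappa^n}\kappa^{n(N-i+j)/N}$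 for $i>j$. Let $|0\rangle$ be the vacuum of its Fock space ($\beta^i_n|0\rangle=0$ for $n>0$) and $\langle0|$ the dual vacuum ($\langle0|\beta^i_n=0$ for $n<0$, $\langle0|0\rangle=1$). With upper indices read modulo $N$, put $\alpha^i_n=\kappa^{-n/N}\beta^{i-1}_n-\beta^i_n$ and $$\phi_i(z)=\ :\exp\Bigl(\sum_{n\ne0}\tfrac1n\beta^i_nz^{-n}\Bigr):,\qquad S_i(z)=\ :\exp\Bigl(-\sum_{n\ne0}\tfrac1n\alpha^i_nz^{-n}\Bigr):.$$ For $\lambda\in\mathsf P$ with $\ell=\ell(\lambda)$ put $$\Phi^i_\lambda(z)=\Bigl(\tfrac{(q/t;q)_\infty}{(q;q)_\infty}\Bigr)^{\ell}\phi_{i-\ell}(\kappa^{(\ell+1)/N}z)\,S_{i-\ell+1}(\kappa^{\ell/N}q^{\lambda_\ell}z)\cdots S_{i-1}(\kappa^{2/N}q^{\lambda_2}z)\,S_i(\kappa^{1/N}q^{\lambda_1}z),$$ $$\Phi^i(z|x,p)=\sum_{\lambda\in\mathsf P}\Phi^i_\lambda(z)\prod_{k\ge1}(p^{1/N}x_{N-i+k}/x_{N-i+k-1})^{\lambda_k}.$$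 The vacuum matrix element of a product of operators $\phi_i(z)$, $S_i(z)$ is the meromorphic continuation of its expansion in the region where each argument is much larger in modulus than the ones to its right. Finally let $t^{\omega^i}x=(x_1,\dots,x_i,tx_{i+1},\dots,tx_N)$. *Claim.* The vacuum matrix elements of all products $\Phi^0_{\lambda_0}(s_1)\Phi^1_{\lambda_1}(s_2)\cdots\Phi^{N-1}_{\lambda_{N-1}}(s_N)$ with $\lambda_0,\dots,\lambda_{N-1}\in\mathsf P$ are well defined, and, as formal power series in the $p^{1/N}x_{j+1}/x_j$ ($1\le j\le N$), $$\langle0|\Phi^0(s_1|t^{\omega^N}x,p)\,\Phi^1(s_2|t^{\omega^{N-1}}x,p)\cdots\Phi^{N-1}(s_N|t^{\omega^1}x,p)|0\rangle$$ $$=\prod_{1\le i<j\le N}\frac{(\kappa^{(j-i)/N}s_j/s_i;q,\kappa)_\infty}{(\kappa^{(j-i)/N}ts_j/s_i;q,\kappa)_\infty}\frac{(\kappa^{(j-i)/N}qs_j/s_i;q,\kappa)_\infty}{(\kappa^{(j-i)/N}qs_j/(ts_i);q,\kappa)_\infty}\cdot f^{\widehat{\mathfrak{gl}}_N}\bigl(x,p^{1/N}\big|s_N^{-1},s_{N-1}^{-1},\dots,s_1^{-1},\kappa^{1/N}\big|q,t\bigr).$$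 -/

import Mathlib

namespace AffineScreening

noncomputable section

/-! ## Partitions and shifted products -/

/-- Partitions: non-increasing sequences of non-negative integers with finitely many positive
parts. The part `λ_{a+1}` of the usual numbering is `l.1 a`. -/
abbrev Part : Type := {l : ℕ →₀ ℕ // Antitone l}

/-- The length `ℓ(λ)`, the number of positive parts. -/
def Part.length (l : Part) : ℕ := l.1.support.card

/-- `(u;q)_n = (1 - u)(1 - q u) ⋯ (1 - q^{n-1} u)`. -/
def qPoch (u q : ℂ) (n : ℕ) : ℂ := ∏ i ∈ Finset.range n, (1 - q ^ i * u)

/-- `(u;q)_∞ = ∏_{i ≥ 0} (1 - q^i u)`. -/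
def qPochInf (u q : ℂ) : ℂ := ∏' i : ℕ, (1 - q ^ i * u)

/-- `(u;q,p)_∞ = ∏_{i,j ≥ 0} (1 - q^i p^j u)`. -/
def qPochInf₂ (u q p : ℂ) : ℂ := ∏' ij : ℕ × ℕ, (1 - q ^ ij.1 * p ^ ij.2 * u)

/-! ## The non-stationary Ruijsenaars function -/

/-- The factor `N^{(k|N)}_{λ,μ}(u|q,κ)`, for `k` modulo `N`:
`∏_{j ≥ i, j - i ≡ k} (u q^{-μ_i + λ_{j+1}} κ^{j-i}; q)_{λ_j - λ_{j+1}}` times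
`∏_{b ≥ a, b - a ≡ -k-1} (u q^{λ_a - μ_b} κ^{a-b-1}; q)_{μ_b - μ_{b+1}}`.
The factors with `j > ℓ(λ)`, respectively `b > ℓ(μ)`, are equal to `1` and left out. -/
def nekrasov (N : ℕ) (k : ZMod N) (l m : Part) (u q κ : ℂ) : ℂ :=
  (∏ j ∈ Finset.range l.length,
    ∏ i ∈ (Finset.range (j + 1)).filter (fun i : ℕ => (j : ZMod N) - (i : ZMod N) = k),
      qPoch (u * q ^ (-(m.1 i : ℤ) + (l.1 (j + 1) : ℤ)) * κ ^ (-(i : ℤ) + (j : ℤ))) q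
        (l.1 j - l.1 (j + 1))) *
  (∏ b ∈ Finset.range m.length,
    ∏ a ∈ (Finset.range (b + 1)).filter (fun a : ℕ => (b : ZMod N) - (a : ZMod N) = -k - 1),
      qPoch (u * q ^ ((l.1 a : ℤ) - (m.1 b : ℤ)) * κ ^ ((a : ℤ) - (b : ℤ) - 1)) q
        (m.1 b - m.1 (b + 1)))

/-- The exponent vector of `∏_{b} ∏_{a ≥ 1} y_{c b + a - 1}^{λ^{(b)}_a}`, a monomial in the
variables `y_j`, `j` modulo `N`. -/
def exponent {N : ℕ} [NeZero N] (c : ZMod N → ZMod N) (L : ZMod N → Part) : ZMod N →₀ ℕ :=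
  ∑ b : ZMod N, (L b).1.sum fun a r => Finsupp.single (c b + (a : ZMod N)) r

/-- The series `f(x,p|s,κ|q,t)`, as a formal power series in the `N` variables
`y_j = p x_{j+1} / x_j` (`j` modulo `N`, where `x_{N+1} = x_1`). The summand of
`(λ^{(1)},…,λ^{(N)})` carries the monomial
`∏_b ∏_{a ≥ 1} (p x_{a+b} / (t x_{a+b-1}))^{λ^{(b)}_a} = ∏_b ∏_{a ≥ 1} (y_{a+b-1} / t)^{λ^{(b)}_a}`.
Only finitely many tuples contribute to each coefficient. -/
def ruijsenaars (N : ℕ) [NeZero N] (s : ZMod N → ℂ) (κ q t : ℂ) : MvPowerSeries (ZMod N) ℂ :=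
  fun d => ∑ᶠ (L : ZMod N → Part) (_ : exponent (fun b => b) L = d),
    (∏ i : ZMod N, ∏ j : ZMod N,
      nekrasov N (j - i) (L i) (L j) (t * (s j / s i)) q κ /
        nekrasov N (j - i) (L i) (L j) (s j / s i) q κ) *
    ∏ b : ZMod N, (L b).1.prod fun _ r => (1 / t) ^ r

/-! ## The Heisenberg algebra and its Fock space

Throughout, `k` is the chosen root `κ^{1/N}`, so that `κ = k ^ N`, and the upper index of
`β^i_n` is read modulo `N`, with representative `i.val ∈ {0,…,N-1}`. -/

/-- The Fock space: polynomials in the creation operators; `X (i, m)` is `β^i_{-(m+1)}|0⟩`. -/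
abbrev Fock (N : ℕ) : Type := MvPolynomial (ZMod N × ℕ) ℂ

/-- The number `h` in `[β^i_n, β^j_m] = h δ_{n+m,0}`. -/
def heis (N : ℕ) (q t k : ℂ) (i j : ZMod N) (n : ℤ) : ℂ :=
  (n : ℂ) * ((1 - t ^ n) / (1 - q ^ n)) *
    (if i = j then (1 - (k ^ N) ^ n * q ^ n * t ^ (-n)) / (1 - (k ^ N) ^ n)
     else if i.val < j.val then
       (1 - q ^ n * t ^ (-n)) / (1 - (k ^ N) ^ n) * k ^ (n * (-(i.val : ℤ) + (j.val : ℤ)))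
     else
       (1 - q ^ n * t ^ (-n)) / (1 - (k ^ N) ^ n) *
         k ^ (n * ((N : ℤ) - (i.val : ℤ) + (j.val : ℤ))))

/-- The action of `β^i_n` on the Fock space (`β^i_0`, which does not exist, is set to `0`).
For `n > 0` it is the derivation with `β^i_n β^j_{-n}|0⟩ = [β^i_n, β^j_{-n}]|0⟩`. -/
def beta (N : ℕ) [NeZero N] (q t k : ℂ) (i : ZMod N) : ℤ → Module.End ℂ (Fock N)
  | Int.ofNat 0 => 0
  | Int.ofNat (m + 1) =>
      ∑ j : ZMod N, heis N q t k i j ((m : ℤ) + 1) •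
        ((MvPolynomial.pderiv (j, m) : Derivation ℂ (Fock N) (Fock N)) : Fock N →ₗ[ℂ] Fock N)
  | Int.negSucc m => LinearMap.mulLeft ℂ (MvPolynomial.X (i, m) : Fock N)

/-- `α^i_n = κ^{-n/N} β^{i-1}_n - β^i_n`, with `β^{-1} = β^{N-1}`. -/
def alpha (N : ℕ) [NeZero N] (q t k : ℂ) (i : ZMod N) (n : ℤ) : Module.End ℂ (Fock N) :=
  k ^ (-n) • beta N q t k (i - 1) n - beta N q t k i n

/-! ## Vertex operators -/

/-- The coefficient of `w^m` in `exp g`, for a power series `g` with vanishing constant term. -/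
def expCoeff {A : Type*} [Ring A] [Algebra ℂ A] (g : PowerSeries A) (m : ℕ) : A :=
  ∑ r ∈ Finset.range (m + 1), ((r.factorial : ℂ)⁻¹) • PowerSeries.coeff m (g ^ r)

/-- Names of the elementary vertex operators `φ_i(z)` and `S_i(z)`. -/
inductive VLabel (N : ℕ) : Type
  | phi (i : ZMod N) : VLabel N
  | scr (i : ZMod N) : VLabel N

/-- The operators `γ_n` with which the vertex operator is `:exp(∑_{n ≠ 0} (1/n) γ_n z^{-n}):`,
namely `β^i_n` for `φ_i(z)` and `-α^i_n` for `S_i(z)`. -/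
def VLabel.current {N : ℕ} [NeZero N] (q t k : ℂ) : VLabel N → ℤ → Module.End ℂ (Fock N)
  | .phi i, n => beta N q t k i n
  | .scr i, n => -alpha N q t k i n

/-- The coefficient of `z^a` in the creation part `exp(-∑_{n > 0} (1/n) γ_{-n} z^n)`. -/
def VLabel.creation {N : ℕ} [NeZero N] (q t k : ℂ) (V : VLabel N) (a : ℕ) :
    Module.End ℂ (Fock N) :=
  expCoeff (PowerSeries.mk fun n => (-((n : ℂ)⁻¹)) • V.current q t k (-(n : ℤ))) a

/-- The coefficient of `z^{-b}` in the annihilation part `exp(∑_{n > 0} (1/n) γ_n z^{-n})`. -/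
def VLabel.annihilation {N : ℕ} [NeZero N] (q t k : ℂ) (V : VLabel N) (b : ℕ) :
    Module.End ℂ (Fock N) :=
  expCoeff (PowerSeries.mk fun n => ((n : ℂ)⁻¹) • V.current q t k (n : ℤ)) b

/-- The dual vacuum `⟨0|`: the linear form with `⟨0|0⟩ = 1` that kills `β^i_n u` for `n < 0`. -/
def dualVacuum (N : ℕ) : Fock N →ₗ[ℂ] ℂ := MvPolynomial.lcoeff ℂ 0

/-- Writing `V_i(w_i) = ∑_{a,b ≥ 0} C_{i,a} A_{i,b} w_i^{a-b}` with the creation and annihilation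
parts of each vertex operator, this is the term of `⟨0| V_1(w_1) ⋯ V_M(w_M) |0⟩` that belongs to
`(a_1,b_1),…,(a_M,b_M)`. -/
def corrTerm {N M : ℕ} [NeZero N] (q t k : ℂ) (V : Fin M → VLabel N) (w : Fin M → ℂ)
    (ab : Fin M → ℕ × ℕ) : ℂ :=
  dualVacuum N
    ((List.ofFn fun i =>
      (V i).creation q t k (ab i).1 * (V i).annihilation q t k (ab i).2).prod 1) *
    ∏ i, w i ^ (((ab i).1 : ℤ) - ((ab i).2 : ℤ))

/-- `c` is the value at `z` of the matrix element `⟨0| V_1(z_1) ⋯ V_M(z_M) |0⟩`: in a region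
`|z_1| ≫ |z_2| ≫ ⋯ ≫ |z_M| > 0` its expansion converges (absolutely) to a function that extends to
a quotient `A / B` of analytic functions on `(ℂ \ {0})^M`, and `c = A(z) / B(z)` with
`B(z) ≠ 0`. -/
def IsMatrixElement {N M : ℕ} [NeZero N] (q t k : ℂ) (V : Fin M → VLabel N) (z : Fin M → ℂ)
    (c : ℂ) : Prop :=
  (∀ i, z i ≠ 0) ∧
  ∃ r : ℝ, 0 < r ∧ ∃ A B : (Fin M → ℂ) → ℂ,
    AnalyticOnNhd ℂ A {w | ∀ i, w i ≠ 0} ∧ AnalyticOnNhd ℂ B {w | ∀ i, w i ≠ 0} ∧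
    (∀ w : Fin M → ℂ, (∀ i, w i ≠ 0) → (∀ i j, i < j → ‖w j‖ < r * ‖w i‖) →
      ∃ S, HasSum (corrTerm q t k V w) S ∧ A w = B w * S) ∧
    B z ≠ 0 ∧ c = A z / B z

/-- A product of elementary vertex operators taken at given points, from left to right. -/
abbrev VWord (N : ℕ) : Type := List (VLabel N × ℂ)

/-- `c` is the vacuum matrix element of a product of elementary vertex operators at given
points. -/
def VWord.IsVev {N : ℕ} [NeZero N] (q t k : ℂ) (W : VWord N) (c : ℂ) : Prop :=
  IsMatrixElement q t k (fun i : Fin W.length => (W.get i).1) (fun i => (W.get i).2) c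

open Classical in
/-- The vacuum matrix element of a product of elementary vertex operators at given points
(`0` if it does not exist). -/
def VWord.vev {N : ℕ} [NeZero N] (q t k : ℂ) (W : VWord N) : ℂ :=
  if h : ∃ c, W.IsVev q t k c then h.choose else 0

/-! ## Screened vertex operators -/

/-- `φ^i_λ(z) = φ_{i-ℓ}(κ^{(ℓ+1)/N} z) S_{i-ℓ+1}(κ^{ℓ/N} q^{λ_ℓ} z) ⋯ S_i(κ^{1/N} q^{λ_1} z)`
with `ℓ = ℓ(λ)`. -/
def phiWord {N : ℕ} (q k : ℂ) (i : ZMod N) (l : Part) (z : ℂ) : VWord N :=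
  (VLabel.phi (i - (l.length : ZMod N)), k ^ (l.length + 1) * z) ::
    (List.range l.length).reverse.map fun j : ℕ =>
      (VLabel.scr (i - (j : ZMod N)), k ^ (j + 1) * q ^ (l.1 j) * z)

/-- `ω^m_j` for `j` modulo `N` and `m ∈ {1,…,N}`: it is `0` if the representative of `j` in
`{1,…,N}` is at most `m`, and `1` otherwise. -/
def omegaVec (N m : ℕ) (j : ZMod N) : ℤ :=
  if (if j.val = 0 then N else j.val) ≤ m then 0 else 1

/-- The factor by which `x_{j+1} / x_j` is multiplied when `x` is replaced by `t^{ω^m} x`. -/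
def shiftFactor (N : ℕ) (t : ℂ) (m : ℕ) (j : ZMod N) : ℂ :=
  t ^ omegaVec N m (j + 1) / t ^ omegaVec N m j

/-- The product of operators
`φ^0_{λ_0}(s_1) φ^1_{λ_1}(s_2) ⋯ φ^{N-1}_{λ_{N-1}}(s_N)` for a tuple `L` of partitions; here
`s_j` is `s j`, with `j` modulo `N`. -/
def screenedWord (N : ℕ) (q k : ℂ) (s : ZMod N → ℂ) (L : ZMod N → Part) : VWord N :=
  (List.range N).flatMap fun i : ℕ => phiWord q k (i : ZMod N) (L i) (s ((i : ZMod N) + 1))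

/-- The matrix element
`⟨0| Φ^0(s_1|t^{ω^N} x,p) Φ^1(s_2|t^{ω^{N-1}} x,p) ⋯ Φ^{N-1}(s_N|t^{ω^1} x,p) |0⟩`, where
`Φ^i(z|x,p) = ∑_λ Φ^i_λ(z) ∏_{a ≥ 1} (p^{1/N} x_{N-i+a} / x_{N-i+a-1})^{λ_a}` and
`Φ^i_λ(z) = ((q/t;q)_∞ / (q;q)_∞)^{ℓ(λ)} φ^i_λ(z)`, as a formal power series in the `N` variables
`y_j = p^{1/N} x_{j+1} / x_j` (`j` modulo `N`). Only finitely many tuples of partitions contribute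
to each coefficient. -/
def screenedMatrixElement (N : ℕ) [NeZero N] (q t k : ℂ) (s : ZMod N → ℂ) :
    MvPowerSeries (ZMod N) ℂ :=
  fun d => ∑ᶠ (L : ZMod N → Part) (_ : exponent (fun i => -i) L = d),
    (∏ i : ZMod N, (qPochInf (q / t) q / qPochInf q q) ^ (L i).length) *
    (screenedWord N q k s L).vev q t k *
    ∏ i : ZMod N, (L i).1.prod fun a r => shiftFactor N t (N - i.val) (-i + (a : ZMod N)) ^ r

end

end AffineScreening

/-! The operators `φ_i` and `S_i` are normally ordered exponentials of Heisenberg generators, so a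
vacuum matrix element of a product of them is the product of its pairwise contractions (Wick's
theorem). The contraction of `V(z)` with `V'(w)` is `exp(-∑ n⁻² [γ_n, γ'_{-n}] (w/z)^n)`. On the
level of coefficients this is `expCoeff_mul_expCoeff` and `annihilation_fockVec`; `hasSum_corrTerm`
sums the expansion.

The commutators of the `β^i_n` are geometric in `κ^{n/N}` as functions of `j - i` modulo `N`, and
the combination `α^i_n` telescopes them. Hence every contraction with a screening current is built
from two ratios of single infinite products, `R(x) = (t x;q)_∞/(x;q)_∞` and `T(x) = (q x/t;q)_∞/(q
x;q)_∞`, at a few residues of `j - i`, while two operators `φ` contract to double infinite products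
(`expands_contr`). All these are quotients of entire functions of `w/z`. This gives the
continuation, the identity theorem on `(ℂ ∖ 0)^M` makes it unique (`IsMatrixElement.unique`), and
genericity keeps the relevant points off the zeros of the denominators.

The tuples of partitions have varying lengths. Fusion removes this nuisance: `φ_{p-1}(κ^{1/N} ζ)
S_p(ζ)` contracts with everything else exactly as `φ_p(ζ)` does, because `(x;q,κ)_∞ = (x;q)_∞ (κ
x;q,κ)_∞` (`phiFactor_mul_rightFactor`). The contraction of the two fused letters with each other is
`T(1)⁻¹`, which the normalisation `(q/t;q)_∞/(q;q)_∞ = T(1)` cancels (`wordCorr_fuse`). So every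
block may be padded with zero parts to a common number `K` of screening currents.

For padded blocks the letters `a` and `b` contract at `(w/z) q^{m_b - l_a} κ^{(b-a)/N}`. Regrouping
the rectangle of pairs above and below its diagonal (`halfOne_mul_halfTwo`) puts next to each other
values of `R`, or of `T`, whose arguments differ by `q^{λ_b - λ_{b+1}}`. Their quotients are finite
products `(t x;q)_n/(x;q)_n` (`ratioR_mul_inv`, `ratioT_inv_mul`), and these assemble into quotients
of Nekrasov factors. What is left over consists of one contraction of operators `φ` for each pair of
blocks, which is the prefactor, and of powers `t^{-n}` from `T`. Together with the shifts `t^{ω}` of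
the variables these powers give one factor `1/t` for each box (`prod_weights_mul_shiftFactor`).
Reversing the indices modulo `N` identifies the sum with the series `f` (`ruijsenaars_apply`). -/

namespace AffineScreening

noncomputable section

open Finset hiding mem_antidiagonal
open Finset.HasAntidiagonal (mem_antidiagonal)
open PowerSeries

set_option linter.unusedSectionVars false

/-! ## Exponentials of power series over a non-commutative algebra -/

section Euler

variable {A : Type*} [Ring A] [Algebra ℂ A]

/-- The Euler operator `w d/dw` on power series. -/
def euler (f : PowerSeries A) : PowerSeries A := PowerSeries.mk fun n => n • coeff n f

@[simp] lemma coeff_euler (f : PowerSeries A) (n : ℕ) : coeff n (euler f) = n • coeff n f := by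
  simp [euler]

lemma euler_sub (f g : PowerSeries A) : euler (f - g) = euler f - euler g := by
  ext n; simp [smul_sub]

lemma euler_sum {ι : Type*} (s : Finset ι) (f : ι → PowerSeries A) :
    euler (∑ i ∈ s, f i) = ∑ i ∈ s, euler (f i) := by
  ext n; simp [Finset.smul_sum]

lemma euler_mul (f g : PowerSeries A) : euler (f * g) = euler f * g + f * euler g := by
  ext n
  simp only [coeff_euler, coeff_mul, map_add, Finset.smul_sum, ← Finset.sum_add_distrib]
  refine Finset.sum_congr rfl fun p hp => ?_
  rw [← mem_antidiagonal.1 hp, add_smul, smul_mul_assoc, mul_smul_comm]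

@[simp] lemma euler_C (a : A) : euler (C a) = 0 := by
  ext n
  rcases n with _ | n <;> simp [coeff_C]

lemma euler_X_pow (n : ℕ) : euler (X ^ n : PowerSeries A) = n • X ^ n := by
  ext m
  rw [coeff_euler, map_nsmul, coeff_X_pow]
  split_ifs with h <;> simp [h]

lemma commute_of_coeff {f g : PowerSeries A} (h : ∀ m n, Commute (coeff m f) (coeff n g)) :
    Commute f g := by
  ext n
  rw [coeff_mul, coeff_mul, ← Finset.Nat.sum_antidiagonal_swap]
  exact Finset.sum_congr rfl fun p _ => h _ _

lemma euler_pow {g : PowerSeries A} (h : Commute (euler g) g) (r : ℕ) :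
    euler (g ^ (r + 1)) = (r + 1) • (euler g * g ^ r) := by
  induction r with
  | zero => simp
  | succ r ih =>
    rw [pow_succ' g (r + 1), euler_mul, ih, mul_smul_comm, ← mul_assoc, ← h.eq, mul_assoc,
      ← pow_succ', add_comm, add_smul (r + 1) 1 (euler g * g ^ (r + 1)), one_smul]

lemma coeff_pow_eq_zero {g : PowerSeries A} (h0 : coeff 0 g = 0) {r m : ℕ} (h : m < r) :
    coeff m (g ^ r) = 0 := by
  induction r generalizing m with
  | zero => omega
  | succ r ih =>
    rw [pow_succ', coeff_mul]
    refine Finset.sum_eq_zero fun p hp => ?_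
    rcases Nat.eq_zero_or_pos p.1 with h1 | h1
    · rw [h1, h0, zero_mul]
    · rw [ih (by have := mem_antidiagonal.1 hp; omega), mul_zero]

/-- Powers beyond the degree do not contribute, so the cut-off of the exponential sum may be raised
at will; this lets sums for different degrees share one range. -/
lemma expCoeff_eq_sum {g : PowerSeries A} (h0 : coeff 0 g = 0) {m M : ℕ} (h : m < M) :
    expCoeff g m = ∑ r ∈ range M, ((r.factorial : ℂ)⁻¹) • coeff m (g ^ r) := by
  refine Finset.sum_subset (fun x hx => ?_) fun r _ hr => ?_
  · simp only [mem_range] at hx ⊢; omega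
  · rw [coeff_pow_eq_zero h0, smul_zero]
    simp only [mem_range] at hr; omega

@[simp] lemma expCoeff_zero (g : PowerSeries A) : expCoeff g 0 = 1 := by
  simp [expCoeff]

/-- The exponential of a power series without constant term. -/
def expSeries (g : PowerSeries A) : PowerSeries A := PowerSeries.mk (expCoeff g)

@[simp] lemma coeff_expSeries (g : PowerSeries A) (n : ℕ) :
    coeff n (expSeries g) = expCoeff g n := by simp [expSeries]

/-- The first-order equation characterising the exponential. Commutativity of the coefficients of
`g` is what allows `euler g` to be collected on the left of `g ^ r`. All later identities for
exponentials are derived from this equation or from its coefficient form. -/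
lemma euler_expSeries {g : PowerSeries A} (h0 : coeff 0 g = 0)
    (hc : ∀ m n, Commute (coeff m g) (coeff n g)) :
    euler (expSeries g) = euler g * expSeries g := by
  have hcomm : Commute (euler g) g := commute_of_coeff fun m n => by
    rw [coeff_euler]; exact (hc m n).smul_left m
  ext m
  -- The range has one surplus term, so that after the term `r = 0` is split off the shifted range
  -- is again `r < m + 1`, as for the second factor on the right.
  rw [coeff_euler, coeff_expSeries, coeff_mul, expCoeff_eq_sum h0 (Nat.lt_succ_of_lt m.lt_succ_self),
    Finset.smul_sum, Finset.sum_range_succ']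
  have h1 : ∀ r : ℕ, m • (((r + 1).factorial : ℂ)⁻¹ • coeff m (g ^ (r + 1))) =
      ((r.factorial : ℂ)⁻¹) • ∑ p ∈ antidiagonal m, coeff p.1 (euler g) * coeff p.2 (g ^ r) := by
    intro r
    rw [smul_comm, ← coeff_euler, euler_pow hcomm, map_nsmul, ← coeff_mul,
      ← Nat.cast_smul_eq_nsmul ℂ, smul_smul]
    congr 1
    rw [Nat.factorial_succ]
    have : (r.factorial : ℂ) ≠ 0 := by exact_mod_cast r.factorial_ne_zero
    have : ((r + 1 : ℕ) : ℂ) ≠ 0 := by exact_mod_cast r.succ_ne_zero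
    push_cast at *
    field_simp
  have h2 : m • (((Nat.factorial 0 : ℕ) : ℂ)⁻¹ • coeff m (g ^ 0)) = 0 := by
    rcases m with _ | m <;> simp [coeff_one]
  rw [h2, add_zero, Finset.sum_congr rfl fun r _ => h1 r]
  simp only [Finset.smul_sum]
  rw [Finset.sum_comm]
  refine Finset.sum_congr rfl fun p hp => ?_
  rw [coeff_expSeries, expCoeff_eq_sum (M := m + 1) h0 (by
    have := mem_antidiagonal.1 hp; omega), Finset.mul_sum]
  exact Finset.sum_congr rfl fun r _ => by rw [mul_smul_comm]

lemma nsmul_expCoeff {g : PowerSeries A} (h0 : coeff 0 g = 0)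
    (hc : ∀ m n, Commute (coeff m g) (coeff n g)) (m : ℕ) :
    m • expCoeff g m = ∑ p ∈ antidiagonal m, (p.1 • coeff p.1 g) * expCoeff g p.2 := by
  have := congrArg (coeff m) (euler_expSeries h0 hc)
  simpa [coeff_mul] using this

lemma commute_expCoeff {T : A} {g : PowerSeries A} (h : ∀ n, Commute T (coeff n g)) (m : ℕ) :
    Commute T (expCoeff g m) := by
  have h1 : Commute (C T) g := commute_of_coeff fun i j => by
    rcases i with _ | i
    · simpa using h j
    · simp
  refine Commute.sum_right _ _ _ fun r _ => Commute.smul_right ?_ _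
  have h2 := congrArg (coeff m) (h1.pow_right r).eq
  rwa [coeff_C_mul, coeff_mul_C] at h2

/-- Uniqueness of solutions of `w dY/dw = G Y`. -/
lemma eq_zero_of_euler_eq {G Y : PowerSeries A} (hG : coeff 0 G = 0) (h : euler Y = G * Y)
    (h0 : coeff 0 Y = 0) : Y = 0 := by
  ext n
  induction n using Nat.strong_induction_on with
  | _ n ih =>
    rcases Nat.eq_zero_or_pos n with rfl | hn
    · simpa using h0
    · have h1 := congrArg (coeff n) h
      rw [coeff_euler, coeff_mul, Finset.sum_eq_zero, ← Nat.cast_smul_eq_nsmul ℂ] at h1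
      · exact (smul_eq_zero.1 h1).resolve_left (by exact_mod_cast hn.ne')
      · intro p hp
        have := mem_antidiagonal.1 hp
        rcases Nat.eq_zero_or_pos p.1 with h2 | h2
        · rw [h2, hG, zero_mul]
        · rw [ih p.2 (by omega), map_zero, mul_zero]

end Euler

/-! ### Normal ordering of exponentials in a Heisenberg algebra. -/

section Commutation

variable {A : Type*} [Ring A] [Algebra ℂ A]

/-- If `[D_m, M_n] = δ_{mn} c_n` then `A_b M_n = M_n A_b + c_n A_{b-n}` for the coefficients `A_b`
of `exp(∑ D_m w^m)`. -/
lemma expCoeff_mul_of_heisenberg {D M : PowerSeries A} {c : ℕ → ℂ} (hD0 : coeff 0 D = 0)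
    (hD : ∀ m n, Commute (coeff m D) (coeff n D))
    (hDM : ∀ m n, coeff m D * coeff n M = coeff n M * coeff m D +
      if m = n then algebraMap ℂ A (c n) else 0) (n : ℕ) (hn : n ≠ 0) (b : ℕ) :
    expCoeff D b * coeff n M = coeff n M * expCoeff D b +
      if n ≤ b then c n • expCoeff D (b - n) else 0 := by
  induction b using Nat.strong_induction_on with
  | _ b ih =>
    rcases Nat.eq_zero_or_pos b with rfl | hb
    · simp [hn]
    have hb' : (b : ℂ) ≠ 0 := by exact_mod_cast hb.ne'
    -- After multiplication by `b` the recursion `b A_b = ∑ p D_p A_{b-p}` applies, and strong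
    -- induction handles each `A_{b-p}` with `p > 0`.
    suffices h : b • (expCoeff D b * coeff n M) = b • (coeff n M * expCoeff D b +
        if n ≤ b then c n • expCoeff D (b - n) else 0) by
      rw [← Nat.cast_smul_eq_nsmul ℂ, ← Nat.cast_smul_eq_nsmul ℂ] at h
      exact smul_right_injective _ hb' h
    have hz : ∀ p ∈ antidiagonal b, (p.1 • coeff p.1 D) * expCoeff D p.2 * coeff n M =
        coeff n M * ((p.1 • coeff p.1 D) * expCoeff D p.2) +
        ((if p.1 = n then (n * c n) • expCoeff D p.2 else 0) +
        if n ≤ p.2 then c n • ((p.1 • coeff p.1 D) * expCoeff D (p.2 - n)) else 0) := by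
      intro p hp
      have hp' := mem_antidiagonal.1 hp
      rcases Nat.eq_zero_or_pos p.1 with h1 | h1
      · simp [h1, hn.symm]
      rw [mul_assoc, ih p.2 (by omega), mul_add, ← mul_assoc, smul_mul_assoc, hDM]
      have e1 : (if n ≤ p.2 then c n • ((p.1 • coeff p.1 D) * expCoeff D (p.2 - n)) else 0) =
          (p.1 • coeff p.1 D) * (if n ≤ p.2 then c n • expCoeff D (p.2 - n) else 0) := by
        split_ifs <;> simp
      rw [e1]
      have e2 : (if p.1 = n then ((n : ℂ) * c n) • expCoeff D p.2 else 0) =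
          (p.1 • (if p.1 = n then algebraMap ℂ A (c n) else 0)) * expCoeff D p.2 := by
        split_ifs with h
        · rw [h, smul_mul_assoc, ← Algebra.smul_def, ← Nat.cast_smul_eq_nsmul ℂ, smul_smul]
        · simp
      rw [e2, smul_add, add_mul, ← mul_smul_comm, mul_assoc, add_assoc]
    rw [← smul_mul_assoc, nsmul_expCoeff hD0 hD, Finset.sum_mul, Finset.sum_congr rfl hz,
      Finset.sum_add_distrib, ← Finset.mul_sum, ← nsmul_expCoeff hD0 hD, smul_add, mul_smul_comm]
    congr 1
    rw [Finset.sum_add_distrib]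
    -- The commutator with the explicit `D_n` yields `n c_n A_{b-n}`, and the commutators inside the
    -- smaller coefficients sum to `(b - n) c_n A_{b-n}`; together this is `b` times the claimed
    -- term.
    by_cases hnb : n ≤ b
    · have s1 : ∑ p ∈ antidiagonal b, (if p.1 = n then ((n : ℂ) * c n) • expCoeff D p.2 else 0) =
          ((n : ℂ) * c n) • expCoeff D (b - n) := by
        rw [Finset.sum_eq_single (n, b - n)]
        · simp
        · rintro ⟨i, j⟩ hp hne
          have := mem_antidiagonal.1 hp
          rw [if_neg]
          rintro rfl
          apply hne
          simp at this ⊢; omega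
        · intro h; exact absurd (mem_antidiagonal.2 (by simp; omega)) h
      have s2 : ∑ p ∈ antidiagonal b,
          (if n ≤ p.2 then c n • ((p.1 • coeff p.1 D) * expCoeff D (p.2 - n)) else 0) =
          c n • ((b - n) • expCoeff D (b - n)) := by
        rw [nsmul_expCoeff hD0 hD, Finset.smul_sum, ← Finset.sum_filter]
        refine Finset.sum_bij' (fun p _ => (p.1, p.2 - n)) (fun p _ => (p.1, p.2 + n)) ?_ ?_ ?_ ?_ ?_
        · intro p hp
          simp only [mem_filter, mem_antidiagonal] at hp ⊢
          omega
        · intro p hp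
          simp only [mem_filter, mem_antidiagonal] at hp ⊢
          omega
        · intro p hp
          simp only [mem_filter, mem_antidiagonal] at hp
          ext <;> simp; omega
        · intro p hp
          ext <;> simp
        · intro p hp; rfl
      rw [s1, s2, if_pos hnb, ← Nat.cast_smul_eq_nsmul ℂ, ← Nat.cast_smul_eq_nsmul ℂ, smul_smul,
        smul_smul, ← add_smul]
      congr 1
      rw [Nat.cast_sub hnb]; ring
    · rw [if_neg hnb, Finset.sum_eq_zero, Finset.sum_eq_zero]
      · simp
      · intro p hp
        have := mem_antidiagonal.1 hp
        rw [if_neg (by omega)]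
      · intro p hp
        have := mem_antidiagonal.1 hp
        rw [if_neg (by omega)]

/-- Normal ordering: moving the annihilation part `exp(∑ D_m y^m)` through the creation part
`exp(∑ M_n x^n)` gives the scalar factor `exp(∑ c_n (x y)^n)`. -/
lemma expCoeff_mul_expCoeff {D M : PowerSeries A} {c : ℕ → ℂ} (hD0 : coeff 0 D = 0)
    (hM0 : coeff 0 M = 0) (hc0 : c 0 = 0)
    (hD : ∀ m n, Commute (coeff m D) (coeff n D)) (hM : ∀ m n, Commute (coeff m M) (coeff n M))
    (hDM : ∀ m n, coeff m D * coeff n M = coeff n M * coeff m D +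
      if m = n then algebraMap ℂ A (c n) else 0) (b a : ℕ) :
    expCoeff D b * expCoeff M a = ∑ p ∈ antidiagonal b, if p.1 ≤ a then
      expCoeff (PowerSeries.mk c) p.1 • (expCoeff M (a - p.1) * expCoeff D p.2) else 0 := by
  set G := expCoeff (PowerSeries.mk c) with hG
  set E := expSeries M
  have hE : euler E = euler M * E := euler_expSeries hM0 hM
  have hGrec : ∀ m, m • G m = ∑ p ∈ antidiagonal m, ((p.1 : ℂ) * c p.1) * G p.2 := by
    intro m
    rw [hG, nsmul_expCoeff (by simpa using hc0) fun _ _ => Commute.all _ _]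
    simp
  -- For fixed `b`, both sides are read as power series in the creation variable. Both satisfy
  -- `euler W_b = euler M * W_b + F W b`, where the term of `F` with `p.1 = 0` has coefficient zero.
  -- Thus `F W b` involves only smaller indices, and induction on `b` reduces equality to a
  -- homogeneous equation with zero initial value.
  let Y : ℕ → PowerSeries A := fun b => C (expCoeff D b) * E
  let Z : ℕ → PowerSeries A := fun b => ∑ p ∈ antidiagonal b,
    G p.1 • (X ^ p.1 * (E * C (expCoeff D p.2)))
  let F : (ℕ → PowerSeries A) → ℕ → PowerSeries A := fun W b =>
    ∑ p ∈ antidiagonal b, ((p.1 : ℂ) * c p.1) • (X ^ p.1 * W p.2)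
  have hY : ∀ b, euler (Y b) = euler M * Y b + F Y b := by
    intro b
    have key : C (expCoeff D b) * euler M = euler M * C (expCoeff D b) +
        ∑ p ∈ antidiagonal b, ((p.1 : ℂ) * c p.1) • (X ^ p.1 * C (expCoeff D p.2)) := by
      ext n
      rw [coeff_C_mul, map_add, coeff_mul_C, coeff_euler, map_sum]
      rcases Nat.eq_zero_or_pos n with rfl | hn
      · rw [zero_smul, mul_zero, zero_mul, zero_add, eq_comm]
        refine Finset.sum_eq_zero fun p _ => ?_
        rcases Nat.eq_zero_or_pos p.1 with h | h
        · simp [h]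
        · rw [PowerSeries.coeff_smul, coeff_X_pow_mul', if_neg (by omega), smul_zero]
      · rw [mul_smul_comm, expCoeff_mul_of_heisenberg hD0 hD hDM n hn.ne', smul_add,
          smul_mul_assoc]
        congr 1
        have : ∀ p ∈ antidiagonal b, coeff n (((p.1 : ℂ) * c p.1) •
            (X ^ p.1 * C (expCoeff D p.2))) =
            if p.1 = n then ((n : ℂ) * c n) • expCoeff D p.2 else 0 := by
          intro p _
          rw [PowerSeries.coeff_smul, coeff_X_pow_mul']
          by_cases h : p.1 = n
          · simp [h]
          · rw [if_neg h]
            split_ifs with h2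
            · rw [coeff_C, if_neg (by omega), smul_zero]
            · simp
        rw [Finset.sum_congr rfl this]
        split_ifs with hnb
        · rw [Finset.sum_eq_single (n, b - n)]
          · simp [← Nat.cast_smul_eq_nsmul ℂ, smul_smul]
          · rintro ⟨i, j⟩ hp hne
            have := mem_antidiagonal.1 hp
            rw [if_neg]
            rintro rfl
            apply hne
            simp at this ⊢; omega
          · intro h; exact absurd (mem_antidiagonal.2 (by simp; omega)) h
        · rw [smul_zero, eq_comm]
          refine Finset.sum_eq_zero fun p hp => ?_
          have := mem_antidiagonal.1 hp
          rw [if_neg (by omega)]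
    simp only [Y, F]
    rw [euler_mul, euler_C, zero_mul, zero_add, hE, ← mul_assoc, key, add_mul, mul_assoc,
      Finset.sum_mul]
    congr 1
    exact Finset.sum_congr rfl fun p _ => by rw [smul_mul_assoc, mul_assoc]
  have hcm : ∀ (n : ℕ) (f : PowerSeries A), f * X ^ n = X ^ n * f := fun n f =>
    (PowerSeries.commute_X_pow f n).eq
  have hsm : ∀ (r : ℂ) (f : PowerSeries A), euler (r • f) = r • euler f := by
    intro r f; ext n; simp [smul_comm]
  have hZ : ∀ b, euler (Z b) = euler M * Z b + F Z b := by
    intro b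
    have step : ∀ p : ℕ × ℕ, euler (G p.1 • (X ^ p.1 * (E * C (expCoeff D p.2)))) =
        euler M * (G p.1 • (X ^ p.1 * (E * C (expCoeff D p.2)))) +
        ∑ r ∈ antidiagonal p.1, ((r.1 : ℂ) * c r.1) • (X ^ r.1 *
          (G r.2 • (X ^ r.2 * (E * C (expCoeff D p.2))))) := by
      intro p
      have e : ∀ r ∈ antidiagonal p.1, ((r.1 : ℂ) * c r.1) • (X ^ r.1 *
          (G r.2 • (X ^ r.2 * (E * C (expCoeff D p.2))))) =
          (((r.1 : ℂ) * c r.1) * G r.2) • (X ^ p.1 * (E * C (expCoeff D p.2))) := by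
        intro r hr
        rw [← mem_antidiagonal.1 hr, pow_add, mul_smul_comm, smul_smul, mul_assoc (X ^ r.1)]
      rw [Finset.sum_congr rfl e, ← Finset.sum_smul, ← hGrec, hsm, euler_mul, euler_mul, euler_C,
        mul_zero, add_zero, hE, euler_X_pow, smul_add, add_comm, smul_mul_assoc, smul_comm,
        smul_assoc, mul_smul_comm]
      congr 2
      rw [← mul_assoc (euler M), hcm, mul_assoc, mul_assoc]
    simp only [Z, F]
    rw [euler_sum, Finset.sum_congr rfl fun p _ => step p, Finset.sum_add_distrib, ← Finset.mul_sum]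
    congr 1
    simp only [Finset.mul_sum, Finset.smul_sum]
    rw [Finset.sum_sigma', Finset.sum_sigma']
    refine Finset.sum_nbij' (fun x => ⟨(x.2.1, x.2.2 + x.1.2), (x.2.2, x.1.2)⟩)
      (fun x => ⟨(x.1.1 + x.2.1, x.2.2), (x.1.1, x.2.1)⟩) ?_ ?_ ?_ ?_ ?_ <;>
    · rintro ⟨⟨i, j⟩, ⟨i', j'⟩⟩ h
      simp only [mem_sigma, mem_antidiagonal] at h
      obtain ⟨rfl, rfl⟩ := h
      simp [add_assoc]
  have hYZ : ∀ b, Y b = Z b := by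
    intro b
    induction b using Nat.strong_induction_on with
    | _ b ih =>
      have hF : F Y b = F Z b := by
        refine Finset.sum_congr rfl fun p hp => ?_
        rcases Nat.eq_zero_or_pos p.1 with h | h
        · simp [h]
        · rw [ih p.2 (by have := mem_antidiagonal.1 hp; omega)]
      refine sub_eq_zero.1 (eq_zero_of_euler_eq (G := euler M) (by simp) ?_ ?_)
      · rw [euler_sub, hY, hZ, hF, mul_sub]; abel
      · have h1 : coeff 0 (Y b) = expCoeff D b := by
          simp only [Y]; rw [coeff_C_mul]; simp [E]
        have h2 : coeff 0 (Z b) = expCoeff D b := by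
          simp only [Z]
          rw [map_sum, Finset.sum_eq_single (0, b)]
          · rw [PowerSeries.coeff_smul, pow_zero, one_mul, coeff_mul_C]; simp [E, G]
          · rintro ⟨i, j⟩ hp hne
            have := mem_antidiagonal.1 hp
            rw [PowerSeries.coeff_smul, coeff_X_pow_mul', if_neg, smul_zero]
            intro h
            apply hne
            simp at this h ⊢; omega
          · simp
        rw [map_sub, h1, h2, sub_self]
  have := congrArg (coeff a) (hYZ b)
  simp only [Y, Z] at this
  rw [coeff_C_mul, coeff_expSeries, map_sum] at this
  rw [this]
  refine Finset.sum_congr rfl fun p _ => ?_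
  rw [PowerSeries.coeff_smul, coeff_X_pow_mul']
  split_ifs
  · rw [coeff_mul_C, coeff_expSeries]
  · simp

end Commutation

end

end AffineScreening

namespace AffineScreening

noncomputable section

open Finset hiding mem_antidiagonal
open Finset.HasAntidiagonal (mem_antidiagonal)

set_option linter.unusedSectionVars false
set_option linter.unusedSimpArgs false

/-! ## Commutation relations on the Fock space -/

/-- The commutator in an associative ring. -/
def bracket {A : Type*} [Ring A] (x y : A) : A := x * y - y * x

section Bracket

variable {A : Type*} [Ring A]

lemma bracket_eq_zero_iff {x y : A} : bracket x y = 0 ↔ Commute x y := sub_eq_zero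

@[simp] lemma bracket_zero_left (x : A) : bracket 0 x = 0 := by simp [bracket]

@[simp] lemma bracket_zero_right (x : A) : bracket x 0 = 0 := by simp [bracket]

lemma bracket_sub_left (x y z : A) : bracket (x - y) z = bracket x z - bracket y z := by
  simp only [bracket]; noncomm_ring

lemma bracket_sub_right (x y z : A) : bracket x (y - z) = bracket x y - bracket x z := by
  simp only [bracket]; noncomm_ring

lemma bracket_neg_left (x y : A) : bracket (-x) y = -bracket x y := by
  simp only [bracket]; noncomm_ring

lemma bracket_neg_right (x y : A) : bracket x (-y) = -bracket x y := by
  simp only [bracket]; noncomm_ring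

lemma bracket_smul_left [Algebra ℂ A] (r : ℂ) (x y : A) :
    bracket (r • x) y = r • bracket x y := by
  simp [bracket, smul_sub]

lemma bracket_smul_right [Algebra ℂ A] (r : ℂ) (x y : A) :
    bracket x (r • y) = r • bracket x y := by
  simp [bracket, smul_sub]

lemma bracket_sum_left {ι : Type*} (s : Finset ι) (f : ι → A) (y : A) :
    bracket (∑ i ∈ s, f i) y = ∑ i ∈ s, bracket (f i) y := by
  simp [bracket, Finset.sum_mul, Finset.mul_sum]

end Bracket

section Fock

variable {N : ℕ} [NeZero N] (q t k : ℂ)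

@[simp] lemma beta_zero (i : ZMod N) : beta N q t k i 0 = 0 := rfl

lemma beta_natCast_succ (i : ZMod N) (m : ℕ) : beta N q t k i ((m + 1 : ℕ) : ℤ) =
    ∑ j : ZMod N, heis N q t k i j ((m : ℤ) + 1) •
      ((MvPolynomial.pderiv (j, m) : Derivation ℂ (Fock N) (Fock N)) : Fock N →ₗ[ℂ] Fock N) := rfl

lemma beta_neg_succ (i : ZMod N) (m : ℕ) : beta N q t k i (-((m + 1 : ℕ) : ℤ)) =
    LinearMap.mulLeft ℂ (MvPolynomial.X (i, m) : Fock N) := rfl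

lemma pderiv_bracket_mulLeft {σ : Type*} (i j : σ) [DecidableEq σ] :
    bracket (((MvPolynomial.pderiv i : Derivation ℂ (MvPolynomial σ ℂ) (MvPolynomial σ ℂ)) :
      Module.End ℂ (MvPolynomial σ ℂ)))
      ((LinearMap.mulLeft ℂ (MvPolynomial.X j) : Module.End ℂ (MvPolynomial σ ℂ))) =
    if i = j then (1 : Module.End ℂ (MvPolynomial σ ℂ)) else 0 := by
  refine LinearMap.ext fun f => ?_
  rw [bracket]
  simp only [LinearMap.sub_apply, Module.End.mul_apply, LinearMap.mulLeft_apply,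
    Derivation.coeFn_coe, Derivation.leibniz, smul_eq_mul, MvPolynomial.pderiv_X]
  by_cases h : i = j
  · subst h; simp
  · simp [h, Ne.symm h]

/-- The commutator of two derivations is a derivation, so it vanishes once it kills the variables.
-/
lemma pderiv_bracket_pderiv {σ : Type*} (i j : σ) :
    bracket ((MvPolynomial.pderiv i : Derivation ℂ (MvPolynomial σ ℂ) (MvPolynomial σ ℂ)) :
      Module.End ℂ (MvPolynomial σ ℂ))
      ((MvPolynomial.pderiv j : Derivation ℂ (MvPolynomial σ ℂ) (MvPolynomial σ ℂ)) :
      Module.End ℂ (MvPolynomial σ ℂ)) = 0 := by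
  classical
  have h : ⁅(MvPolynomial.pderiv i : Derivation ℂ (MvPolynomial σ ℂ) (MvPolynomial σ ℂ)),
      (MvPolynomial.pderiv j : Derivation ℂ (MvPolynomial σ ℂ) (MvPolynomial σ ℂ))⁆ = 0 := by
    refine MvPolynomial.derivation_ext fun l => ?_
    rw [Derivation.commutator_apply]
    simp only [MvPolynomial.pderiv_X, Pi.single_apply]
    split_ifs <;> simp
  refine LinearMap.ext fun f => ?_
  have h2 := congrArg (fun D : Derivation ℂ (MvPolynomial σ ℂ) (MvPolynomial σ ℂ) => D f) h
  simpa [Derivation.commutator_apply, bracket] using h2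

lemma beta_bracket_beta_nat (i j : ZMod N) (m n : ℕ) :
    bracket (beta N q t k i (m : ℤ))
      (beta N q t k j (n : ℤ)) = 0 := by
  rcases m with _ | m
  · simp
  rcases n with _ | n
  · simp
  rw [beta_natCast_succ, beta_natCast_succ, bracket_eq_zero_iff]
  exact Commute.sum_left _ _ _ fun a _ => Commute.sum_right _ _ _ fun b _ =>
    Commute.smul_left (Commute.smul_right
      (bracket_eq_zero_iff.1 (pderiv_bracket_pderiv (a, m) (b, n))) _) _

lemma beta_bracket_beta_neg (i j : ZMod N) (m n : ℕ) :
    bracket (beta N q t k i (-(m : ℤ)))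
      (beta N q t k j (-(n : ℤ))) = 0 := by
  rcases m with _ | m
  · simp
  rcases n with _ | n
  · simp
  rw [beta_neg_succ, beta_neg_succ, bracket, sub_eq_zero]
  refine LinearMap.ext fun f => ?_
  simp only [Module.End.mul_apply, LinearMap.mulLeft_apply]
  ring

lemma heis_zero (i j : ZMod N) : heis N q t k i j 0 = 0 := by simp [heis]

lemma beta_bracket_beta (i j : ZMod N) (m n : ℕ) :
    bracket (beta N q t k i (m : ℤ))
      (beta N q t k j (-(n : ℤ))) =
      if m = n then algebraMap ℂ (Module.End ℂ (Fock N)) (heis N q t k i j n) else 0 := by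
  rcases m with _ | m
  · rcases n with _ | n
    · simp [heis_zero]
    · simp
  rcases n with _ | n
  · simp
  rw [beta_natCast_succ, beta_neg_succ, bracket_sum_left]
  simp only [bracket_smul_left, pderiv_bracket_mulLeft]
  by_cases hmn : m = n
  · subst hmn
    simp [Algebra.algebraMap_eq_smul_one]
  · simp [hmn]

/-- The commutator `[γ_n, γ'_{-n}]` of the currents of two elementary vertex operators. -/
def VLabel.comm (q t k : ℂ) : VLabel N → VLabel N → ℤ → ℂ
  | .phi i, .phi j, n => heis N q t k i j n
  | .phi i, .scr j, n => heis N q t k i j n - k ^ n * heis N q t k i (j - 1) n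
  | .scr i, .phi j, n => heis N q t k i j n - k ^ (-n) * heis N q t k (i - 1) j n
  | .scr i, .scr j, n =>
      (heis N q t k i j n - k ^ (-n) * heis N q t k (i - 1) j n) -
        k ^ n * (heis N q t k i (j - 1) n - k ^ (-n) * heis N q t k (i - 1) (j - 1) n)

lemma current_bracket_nat (V V' : VLabel N) (m n : ℕ) :
    bracket (V.current q t k (m : ℤ))
      (V'.current q t k (n : ℤ)) = 0 := by
  rcases V with i | i <;> rcases V' with j | j <;>
    simp [VLabel.current, alpha, beta_bracket_beta_nat, bracket_sub_left, bracket_sub_right, bracket_neg_left,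
      bracket_neg_right, bracket_smul_left, bracket_smul_right]

lemma current_bracket_neg (V V' : VLabel N) (m n : ℕ) :
    bracket (V.current q t k (-(m : ℤ)))
      (V'.current q t k (-(n : ℤ))) = 0 := by
  rcases V with i | i <;> rcases V' with j | j <;>
    simp [VLabel.current, alpha, beta_bracket_beta_neg, bracket_sub_left, bracket_sub_right, bracket_neg_left,
      bracket_neg_right, bracket_smul_left, bracket_smul_right]

lemma current_bracket_current (V V' : VLabel N) (m n : ℕ) :
    bracket (V.current q t k (m : ℤ)) (V'.current q t k (-(n : ℤ))) =
      if m = n then algebraMap ℂ (Module.End ℂ (Fock N)) (V.comm q t k V' n) else 0 := by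
  rcases V with i | i <;> rcases V' with j | j <;> by_cases h : m = n <;>
    simp only [VLabel.current, alpha, VLabel.comm, beta_bracket_beta, bracket_sub_left,
      bracket_sub_right, bracket_neg_left, bracket_neg_right, bracket_smul_left,
      bracket_smul_right, h, Algebra.algebraMap_eq_smul_one, if_true, if_false, neg_neg] <;> module

lemma dualVacuum_mulLeft_X (x : ZMod N × ℕ) (u : Fock N) :
    dualVacuum N (LinearMap.mulLeft ℂ (MvPolynomial.X x) u) = 0 := by
  simp [dualVacuum, MvPolynomial.coeff_X_mul']

lemma dualVacuum_current_neg (V : VLabel N) (n : ℕ) (u : Fock N) :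
    dualVacuum N (V.current q t k (-(n : ℤ)) u) = 0 := by
  have h : ∀ i, dualVacuum N (beta N q t k i (-(n : ℤ)) u) = 0 := by
    intro i
    rcases n with _ | n
    · simp
    · rw [beta_neg_succ, dualVacuum_mulLeft_X]
  rcases V with i | i <;> simp [VLabel.current, alpha, h]

lemma current_one (V : VLabel N) (n : ℕ) : V.current q t k (n : ℤ) 1 = 0 := by
  have h : ∀ i, beta N q t k i (n : ℤ) 1 = 0 := by
    intro i
    rcases n with _ | n
    · simp
    · rw [beta_natCast_succ]; simp
  rcases V with i | i <;> simp [VLabel.current, alpha, h]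

/-- The coefficient of `u^n` in the logarithm of the contraction of two vertex operators. -/
def VLabel.logCoeff (q t k : ℂ) (V V' : VLabel N) (n : ℕ) : ℂ :=
  -(((n : ℂ)⁻¹) ^ 2 * V.comm q t k V' n)

/-- The coefficient of `u^n` in the contraction of two vertex operators. -/
def VLabel.contrCoeff (q t k : ℂ) (V V' : VLabel N) (n : ℕ) : ℂ :=
  expCoeff (PowerSeries.mk (V.logCoeff q t k V')) n

/-- All exponents have vanishing constant term because `(0 : ℂ)⁻¹ = 0`. The scalar exponent is
`(1/n)(-1/n)[γ_n, γ'_{-n}]`, which explains the sign and the square in `VLabel.logCoeff`. -/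
lemma annihilation_mul_creation (V V' : VLabel N) (b a : ℕ) :
    V.annihilation q t k b * V'.creation q t k a =
      ∑ p ∈ antidiagonal b, if p.1 ≤ a then V.contrCoeff q t k V' p.1 •
        (V'.creation q t k (a - p.1) * V.annihilation q t k p.2) else 0 := by
  refine expCoeff_mul_expCoeff ?_ ?_ ?_ ?_ ?_ ?_ b a
  · simp
  · simp
  · simp [VLabel.logCoeff]
  · intro m n
    have := current_bracket_nat q t k V V m n
    rw [bracket, sub_eq_zero] at this
    simp only [PowerSeries.coeff_mk]
    exact Commute.smul_left (Commute.smul_right this _) _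
  · intro m n
    have := current_bracket_neg q t k V' V' m n
    rw [bracket, sub_eq_zero] at this
    simp only [PowerSeries.coeff_mk]
    exact Commute.smul_left (Commute.smul_right this _) _
  · intro m n
    have := current_bracket_current q t k V V' m n
    rw [bracket, sub_eq_iff_eq_add] at this
    simp only [PowerSeries.coeff_mk]
    rw [smul_mul_smul_comm, this, smul_mul_smul_comm, smul_add, add_comm, mul_comm]
    congr 1
    split_ifs with h
    · subst h
      rw [VLabel.logCoeff, Algebra.algebraMap_eq_smul_one,
        Algebra.algebraMap_eq_smul_one, smul_smul]
      congr 1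
      ring
    · simp

lemma commute_annihilation (V V' : VLabel N) (b b' : ℕ) :
    Commute (V.annihilation q t k b) (V'.annihilation q t k b') := by
  refine (commute_expCoeff (fun n => Commute.symm (commute_expCoeff (fun m => ?_) _)) _)
  have := current_bracket_nat q t k V' V n m
  rw [bracket, sub_eq_zero] at this
  simp only [PowerSeries.coeff_mk]
  exact Commute.smul_left (Commute.smul_right this _) _

/-- For `a > 0` the recursion for the coefficients of an exponential puts a creation operator
leftmost in every term, and the dual vacuum kills it. -/
lemma dualVacuum_creation (V : VLabel N) (a : ℕ) (u : Fock N) :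
    dualVacuum N (V.creation q t k a u) = if a = 0 then dualVacuum N u else 0 := by
  rcases Nat.eq_zero_or_pos a with rfl | ha
  · simp [VLabel.creation]
  have h := nsmul_expCoeff (g := PowerSeries.mk fun n : ℕ =>
    (-((n : ℂ)⁻¹)) • V.current q t k (-(n : ℤ))) (by simp) (fun m n => by
      have := current_bracket_neg q t k V V m n
      rw [bracket, sub_eq_zero] at this
      simp only [PowerSeries.coeff_mk]
      exact Commute.smul_left (Commute.smul_right this _) _) a
  have h2 := congrArg (fun T : Module.End ℂ (Fock N) => dualVacuum N (T u)) h
  simp only [PowerSeries.coeff_mk, LinearMap.sum_apply, map_sum, Module.End.mul_apply,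
    LinearMap.smul_apply, map_nsmul, map_smul, dualVacuum_current_neg, smul_zero,
    Finset.sum_const_zero] at h2
  rw [if_neg ha.ne']
  exact (smul_eq_zero.1 h2).resolve_left ha.ne'

/-- Mirror image of `dualVacuum_creation`: the annihilation operator produced by the recursion is
first commuted to the right, where it meets the vacuum. -/
lemma annihilation_one (V : VLabel N) (b : ℕ) :
    V.annihilation q t k b 1 = if b = 0 then 1 else 0 := by
  rcases Nat.eq_zero_or_pos b with rfl | hb
  · simp [VLabel.annihilation]
  have hc : ∀ m n : ℕ, Commute (PowerSeries.coeff m (PowerSeries.mk fun n : ℕ =>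
    (((n : ℂ)⁻¹)) • V.current q t k (n : ℤ))) (PowerSeries.coeff n (PowerSeries.mk fun n : ℕ =>
    (((n : ℂ)⁻¹)) • V.current q t k (n : ℤ))) := fun m n => by
      have := current_bracket_nat q t k V V m n
      rw [bracket, sub_eq_zero] at this
      simp only [PowerSeries.coeff_mk]
      exact Commute.smul_left (Commute.smul_right this _) _
  have h := nsmul_expCoeff (by simp) hc b
  have h2 := congrArg (fun T : Module.End ℂ (Fock N) => T 1) h
  have h3 : ∀ p ∈ antidiagonal b, ((p.1 • PowerSeries.coeff p.1 (PowerSeries.mk fun n : ℕ =>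
      (((n : ℂ)⁻¹)) • V.current q t k (n : ℤ))) * expCoeff (PowerSeries.mk fun n : ℕ =>
      (((n : ℂ)⁻¹)) • V.current q t k (n : ℤ)) p.2) (1 : Fock N) = 0 := by
    intro p _
    rw [((commute_expCoeff (fun n => hc p.1 n) p.2).smul_left p.1).eq]
    simp [current_one]
  simp only [LinearMap.sum_apply] at h2
  rw [Finset.sum_eq_zero h3, LinearMap.smul_apply] at h2
  rw [if_neg hb.ne']
  exact (smul_eq_zero.1 h2).resolve_left hb.ne'

/-- The vector `C_1 A_1 ⋯ C_M A_M |0⟩` for given coefficients of the creation and annihilation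
parts. -/
def fockVec {M : ℕ} (V : Fin M → VLabel N) (ab : Fin M → ℕ × ℕ) : Fock N :=
  (List.ofFn fun i =>
    (V i).creation q t k (ab i).1 * (V i).annihilation q t k (ab i).2).prod 1

lemma fockVec_succ {M : ℕ} (V : Fin (M + 1) → VLabel N) (ab : Fin (M + 1) → ℕ × ℕ) :
    fockVec q t k V ab = (V 0).creation q t k (ab 0).1 ((V 0).annihilation q t k (ab 0).2
      (fockVec q t k (fun i => V i.succ) fun i => ab i.succ)) := by
  simp [fockVec, List.ofFn_succ]

/-- Wick's theorem for coefficients. Moving right, the annihilation part passes freely through the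
other annihilation parts; at the creation part number `j` it gives up `n j` units of degree, at the
price of a contraction coefficient and of lowering the creation degree. On the vacuum nothing may
remain, so the `n j` add up to `b`. -/
lemma annihilation_fockVec {M : ℕ} (U : VLabel N) (V : Fin M → VLabel N) (ab : Fin M → ℕ × ℕ)
    (b : ℕ) : U.annihilation q t k b (fockVec q t k V ab) =
      ∑ n ∈ (Finset.Nat.antidiagonalTuple M b).filter (fun n => ∀ j, n j ≤ (ab j).1),
        (∏ j, U.contrCoeff q t k (V j) (n j)) •
          fockVec q t k V fun j => ((ab j).1 - n j, (ab j).2) := by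
  induction M generalizing b with
  | zero =>
    rcases b with _ | b <;> simp [fockVec, annihilation_one]
  | succ M ih =>
    have h1 : ∀ b', U.annihilation q t k b' ((V 0).annihilation q t k (ab 0).2
        (fockVec q t k (fun i => V i.succ) fun i => ab i.succ)) =
        ∑ n ∈ (Finset.Nat.antidiagonalTuple M b').filter (fun n => ∀ j, n j ≤ (ab j.succ).1),
        (∏ j, U.contrCoeff q t k (V j.succ) (n j)) • (V 0).annihilation q t k (ab 0).2
          (fockVec q t k (fun i => V i.succ) fun j => ((ab j.succ).1 - n j, (ab j.succ).2)) := by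
      intro b'
      rw [← Module.End.mul_apply, (commute_annihilation q t k U (V 0) b' _).eq,
        Module.End.mul_apply, ih, map_sum]
      simp
    set T : (Fin (M + 1) → ℕ) → Fock N := fun n => (∏ j, U.contrCoeff q t k (V j) (n j)) •
      fockVec q t k V fun j => ((ab j).1 - n j, (ab j).2) with hT
    have h2 : ∀ p : ℕ × ℕ, (if p.1 ≤ (ab 0).1 then U.contrCoeff q t k (V 0) p.1 •
        ((V 0).creation q t k ((ab 0).1 - p.1) * U.annihilation q t k p.2) else 0)
        ((V 0).annihilation q t k (ab 0).2
          (fockVec q t k (fun i => V i.succ) fun i => ab i.succ)) =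
        ∑ n ∈ Finset.Nat.antidiagonalTuple M p.2,
          if ∀ j, (Fin.cons p.1 n : Fin (M + 1) → ℕ) j ≤ (ab j).1 then T (Fin.cons p.1 n)
          else 0 := by
      intro p
      simp only [Fin.forall_fin_succ, Fin.cons_zero, Fin.cons_succ]
      split_ifs with h
      · simp only [true_and, h]
        rw [LinearMap.smul_apply, Module.End.mul_apply, h1, map_sum, Finset.smul_sum,
          Finset.sum_filter]
        refine Finset.sum_congr rfl fun n _ => ?_
        split_ifs
        · rw [hT, map_smul, smul_smul]
          simp only [Fin.prod_univ_succ, fockVec_succ, Fin.cons_zero, Fin.cons_succ]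
        · rfl
      · simp [h]
    rw [fockVec_succ, ← Module.End.mul_apply, annihilation_mul_creation, LinearMap.sum_apply,
      Finset.sum_congr rfl fun p _ => h2 p, Finset.sum_filter, Finset.sum_sigma']
    refine Finset.sum_bij' (fun x _ => Fin.cons x.1.1 x.2)
      (fun n _ => ⟨(n 0, b - n 0), fun j => n j.succ⟩) ?_ ?_ ?_ ?_ ?_
    · rintro ⟨⟨i, j⟩, n⟩ h
      simp only [mem_sigma, mem_antidiagonal, Finset.Nat.mem_antidiagonalTuple] at h ⊢
      simp only [Fin.sum_univ_succ, Fin.cons_zero, Fin.cons_succ]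
      omega
    · intro n h
      simp only [mem_sigma, mem_antidiagonal, Finset.Nat.mem_antidiagonalTuple,
        Fin.sum_univ_succ] at h ⊢
      omega
    · rintro ⟨⟨i, j⟩, n⟩ h
      simp only [mem_sigma, mem_antidiagonal, Finset.Nat.mem_antidiagonalTuple] at h
      obtain ⟨rfl, -⟩ := h
      simp
    · intro n h
      exact Fin.cons_self_tail n
    · intro x h
      rfl

/-- The summand of the expansion of a matrix element with one vertex operator added on the left:
the new operator is contracted with each of the others. -/
lemma corrTerm_succ {M : ℕ} (V : Fin (M + 1) → VLabel N) (w : Fin (M + 1) → ℂ)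
    (hw : ∀ i, w i ≠ 0) (ab : Fin (M + 1) → ℕ × ℕ) :
    corrTerm q t k V w ab = if (ab 0).1 = 0 then
      ∑ n ∈ (Finset.Nat.antidiagonalTuple M (ab 0).2).filter (fun n => ∀ j, n j ≤ (ab j.succ).1),
        (∏ j, (V 0).contrCoeff q t k (V j.succ) (n j) * (w j.succ / w 0) ^ n j) *
          corrTerm q t k (fun i => V i.succ) (fun i => w i.succ)
            fun j => ((ab j.succ).1 - n j, (ab j.succ).2)
      else 0 := by
  have h : ∀ {M : ℕ} (V : Fin M → VLabel N) (w : Fin M → ℂ) (ab : Fin M → ℕ × ℕ),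
      corrTerm q t k V w ab = dualVacuum N (fockVec q t k V ab) *
        ∏ i, w i ^ (((ab i).1 : ℤ) - ((ab i).2 : ℤ)) := fun _ _ _ => rfl
  rw [h, fockVec_succ, dualVacuum_creation]
  split_ifs with h0
  · rw [annihilation_fockVec, map_sum, Finset.sum_mul]
    refine Finset.sum_congr rfl fun n hn => ?_
    simp only [Finset.mem_filter, Finset.Nat.mem_antidiagonalTuple] at hn
    rw [map_smul, h, Finset.prod_mul_distrib, Fin.prod_univ_succ, h0, ← hn.1, smul_eq_mul]
    have e : w 0 ^ (((0 : ℕ) : ℤ) - ((∑ i, n i : ℕ) : ℤ)) *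
        ∏ i : Fin M, w i.succ ^ (((ab i.succ).1 : ℤ) - ((ab i.succ).2 : ℤ)) =
        (∏ j : Fin M, (w j.succ / w 0) ^ n j) *
        ∏ i : Fin M, w i.succ ^ ((((ab i.succ).1 - n i : ℕ) : ℤ) - ((ab i.succ).2 : ℤ)) := by
      have e1 : w 0 ^ (((0 : ℕ) : ℤ) - ((∑ i, n i : ℕ) : ℤ)) =
          ∏ i : Fin M, (w 0 ^ n i)⁻¹ := by
        rw [Nat.cast_zero, zero_sub, zpow_neg, zpow_natCast, Finset.prod_inv_distrib,
          Finset.prod_pow_eq_pow_sum]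
      rw [e1, ← Finset.prod_mul_distrib, ← Finset.prod_mul_distrib]
      refine Finset.prod_congr rfl fun i _ => ?_
      rw [Nat.cast_sub (hn.2 i), div_pow, ← zpow_natCast (w i.succ) (n i), div_mul_eq_mul_div,
        ← zpow_add₀ (hw _), div_eq_inv_mul]
      congr 2
      ring
    rw [mul_assoc, e]
    ring
  · simp

/-! ### Summation of the expansion of a matrix element. -/

lemma hasSum_mul_of_hasSum {α β : Type*} {f : α → ℂ} {g : β → ℂ} {a b : ℂ} (hf : HasSum f a)
    (hg : HasSum g b) : HasSum (fun x : α × β => f x.1 * g x.2) (a * b) := by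
  have h1 : Summable fun x => ‖f x‖ := hf.summable.norm
  have h2 : Summable fun x => ‖g x‖ := hg.summable.norm
  exact hf.mul hg (summable_mul_of_summable_norm h1 h2)

/-- Products of convergent series, over a finite family of summation indices. -/
lemma hasSum_prod_pi {M : ℕ} {f : Fin M → ℕ → ℂ} {S : Fin M → ℂ} (h : ∀ j, HasSum (f j) (S j)) :
    HasSum (fun n : Fin M → ℕ => ∏ j, f j (n j)) (∏ j, S j) := by
  induction M with
  | zero => simp [hasSum_unique]
  | succ M ih =>
    rw [← (Fin.consEquiv fun _ : Fin (M + 1) => ℕ).hasSum_iff, Fin.prod_univ_succ]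
    have h2 := ih fun j => h j.succ
    have h3 := hasSum_mul_of_hasSum (h 0) h2
    convert h3 using 1
    funext x
    simp [Fin.consEquiv, Fin.prod_univ_succ]

/-- Induction on the number of operators. The contractions of the leftmost operator and the
correlator of the others form an absolutely convergent product series, and `corrTerm_succ` says that
each term of the full expansion collects one finite fibre of its index set. -/
lemma hasSum_corrTerm {M : ℕ} (V : Fin M → VLabel N) (w : Fin M → ℂ) (hw : ∀ i, w i ≠ 0)
    (S : Fin M → Fin M → ℂ) (hS : ∀ i j, i < j →
      HasSum (fun n => (V i).contrCoeff q t k (V j) n * (w j / w i) ^ n) (S i j)) :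
    HasSum (corrTerm q t k V w) (∏ i, ∏ j ∈ Finset.Ioi i, S i j) := by
  induction M with
  | zero =>
    simpa [corrTerm, dualVacuum] using
      hasSum_unique (corrTerm q t k V w)
  | succ M ih =>
    have h1 := ih (fun i => V i.succ) (fun i => w i.succ) (fun i => hw _)
      (fun i j => S i.succ j.succ) fun i j hij => hS _ _ (Fin.succ_lt_succ_iff.2 hij)
    have h2 := hasSum_prod_pi fun j : Fin M => hS 0 j.succ (Fin.succ_pos j)
    have h3 := hasSum_mul_of_hasSum h2 h1
    -- `Ψ` undoes the lowering of degrees: the leftmost operator has creation degree `0` and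
    -- annihilation degree `∑ n j`, and `n j` is added back to the creation degree of operator `j`.
    let Ψ : (Fin M → ℕ) × (Fin M → ℕ × ℕ) → (Fin (M + 1) → ℕ × ℕ) := fun x =>
      Fin.cons (0, ∑ j, x.1 j) fun j => ((x.2 j).1 + x.1 j, (x.2 j).2)
    have h4 := h3.tsum_fiberwise Ψ
    rw [Fin.prod_univ_succ, Fin.prod_Ioi_zero]
    simp only [Fin.prod_Ioi_succ]
    suffices key : ∀ ab, corrTerm q t k V w ab = ∑' x : (Ψ ⁻¹' {ab} : Set _),
        (∏ j, (V 0).contrCoeff q t k (V j.succ) (x.1.1 j) * (w j.succ / w 0) ^ x.1.1 j) *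
        corrTerm q t k (fun i => V i.succ) (fun i => w i.succ) x.1.2 by
      rw [funext key]; exact h4
    intro ab
    rw [corrTerm_succ q t k V w hw]
    let F : Finset (Fin M → ℕ) := if (ab 0).1 = 0 then
      (Finset.Nat.antidiagonalTuple M (ab 0).2).filter (fun n => ∀ j, n j ≤ (ab j.succ).1) else ∅
    let ι : (Fin M → ℕ) → (Fin M → ℕ) × (Fin M → ℕ × ℕ) := fun n =>
      (n, fun j => ((ab j.succ).1 - n j, (ab j.succ).2))
    have hset : Ψ ⁻¹' {ab} = ((F.image ι : Finset _) : Set ((Fin M → ℕ) × (Fin M → ℕ × ℕ))) := by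
      ext ⟨n, c⟩
      simp only [Set.mem_preimage, Set.mem_singleton_iff, Finset.coe_image, Set.mem_image,
        Finset.mem_coe, F, ι, Ψ]
      constructor
      · rintro rfl
        refine ⟨n, ?_, ?_⟩
        · simp [Finset.Nat.mem_antidiagonalTuple]
        · simp
      · rintro ⟨m, hm, hmn⟩
        obtain ⟨rfl, rfl⟩ := Prod.mk.inj hmn
        split_ifs at hm with h0
        · simp only [Finset.mem_filter, Finset.Nat.mem_antidiagonalTuple] at hm
          funext j
          refine Fin.cases ?_ (fun j => ?_) j
          · simp [hm.1, ← h0]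
          · simp [Nat.sub_add_cancel (hm.2 j)]
        · simp at hm
    rw [hset]
    refine Eq.trans ?_ (Finset.tsum_subtype' (F.image ι) (fun x : (Fin M → ℕ) × (Fin M → ℕ × ℕ) =>
      (∏ j, (V 0).contrCoeff q t k (V j.succ) (x.1 j) * (w j.succ / w 0) ^ x.1 j) *
        corrTerm q t k (fun i => V i.succ) (fun i => w i.succ) x.2)).symm
    rw [Finset.sum_image fun x _ y _ h => (Prod.mk.inj h).1]
    simp only [F, ι]
    split_ifs <;> simp

end Fock

end

end AffineScreening

namespace AffineScreening

noncomputable section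

open Finset hiding mem_antidiagonal
open Finset.HasAntidiagonal (mem_antidiagonal)
open Filter Topology

/-! ## Convergence of exponentials -/

/-- Iterated Cauchy products. The bound on the sum of norms is needed to dominate the double series
of the exponential. -/
lemma summable_coeff_pow {f : PowerSeries ℂ} {u : ℂ} {l : ℂ}
    (h : HasSum (fun n => PowerSeries.coeff n f * u ^ n) l) (r : ℕ) :
    HasSum (fun n => PowerSeries.coeff n (f ^ r) * u ^ n) (l ^ r) ∧
    ∑' n, ‖PowerSeries.coeff n (f ^ r) * u ^ n‖ ≤ (∑' n, ‖PowerSeries.coeff n f * u ^ n‖) ^ r := by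
  have hn : Summable fun n => ‖PowerSeries.coeff n f * u ^ n‖ := h.summable.norm
  induction r with
  | zero =>
    have h1 : ∀ n, n ≠ 0 → PowerSeries.coeff n (f ^ 0) * u ^ n = 0 := fun n hn => by
      simp [PowerSeries.coeff_one, hn]
    constructor
    · simpa using hasSum_single 0 h1
    · rw [tsum_eq_single 0 fun n hn => by rw [h1 n hn, norm_zero]]
      simp
  | succ r ih =>
    have hr : Summable fun n => ‖PowerSeries.coeff n (f ^ r) * u ^ n‖ := ih.1.summable.norm
    have hterm : ∀ n, PowerSeries.coeff n (f ^ (r + 1)) * u ^ n = ∑ p ∈ antidiagonal n,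
        (PowerSeries.coeff p.1 (f ^ r) * u ^ p.1) * (PowerSeries.coeff p.2 f * u ^ p.2) := by
      intro n
      rw [pow_succ, PowerSeries.coeff_mul, Finset.sum_mul]
      refine Finset.sum_congr rfl fun p hp => ?_
      rw [← mem_antidiagonal.1 hp, pow_add]
      ring
    have hs := summable_norm_sum_mul_antidiagonal_of_summable_norm hr hn
    have ht := tsum_mul_tsum_eq_tsum_sum_antidiagonal_of_summable_norm hr hn
    have ht' := tsum_mul_tsum_eq_tsum_sum_antidiagonal_of_summable_norm hr.norm hn.norm
    have hs' := summable_norm_sum_mul_antidiagonal_of_summable_norm hr.norm hn.norm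
    simp only [hterm]
    constructor
    · have := hs.of_norm.hasSum
      rwa [← ht, ih.1.tsum_eq, h.tsum_eq, ← pow_succ] at this
    · rw [pow_succ]
      calc _ ≤ ∑' n, ∑ p ∈ antidiagonal n, ‖PowerSeries.coeff p.1 (f ^ r) * u ^ p.1‖ *
              ‖PowerSeries.coeff p.2 f * u ^ p.2‖ := by
            refine hs.tsum_le_tsum (fun n => ?_) hs'.of_norm
            refine (norm_sum_le _ _).trans (Finset.sum_le_sum fun p _ => (norm_mul _ _).le)
        _ = _ := ht'.symm
        _ ≤ _ := mul_le_mul_of_nonneg_right ih.2 (tsum_nonneg fun _ => norm_nonneg _)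

/-- Fubini for the double series over the power `r` and the degree `n`, which is dominated by the
exponential series of `∑ ‖f_n u^n‖`. -/
lemma hasSum_expCoeff {f : PowerSeries ℂ} {u l : ℂ} (h0 : PowerSeries.coeff 0 f = 0)
    (h : HasSum (fun n => PowerSeries.coeff n f * u ^ n) l) :
    HasSum (fun n => expCoeff f n * u ^ n) (Complex.exp l) := by
  let F : ℕ × ℕ → ℂ := fun x => (x.1.factorial : ℂ)⁻¹ * (PowerSeries.coeff x.2 (f ^ x.1) * u ^ x.2)
  have hF1 : ∀ r, HasSum (fun n => F (r, n)) ((r.factorial : ℂ)⁻¹ * l ^ r) := fun r => by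
    have := (summable_coeff_pow h r).1.mul_left ((r.factorial : ℂ)⁻¹)
    exact this
  have hF : Summable fun x => ‖F x‖ := by
    rw [summable_prod_of_nonneg fun _ => norm_nonneg _]
    refine ⟨fun r => (hF1 r).summable.norm, ?_⟩
    refine Summable.of_nonneg_of_le (fun r => tsum_nonneg fun _ => norm_nonneg _) (fun r => ?_)
      (Real.summable_pow_div_factorial (∑' n, ‖PowerSeries.coeff n f * u ^ n‖))
    have e : ∀ n, ‖F (r, n)‖ = (r.factorial : ℝ)⁻¹ * ‖PowerSeries.coeff n (f ^ r) * u ^ n‖ := by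
      intro n
      rw [norm_mul, norm_inv, Complex.norm_natCast]
    rw [tsum_congr e, tsum_mul_left, div_eq_inv_mul]
    exact mul_le_mul_of_nonneg_left (summable_coeff_pow h r).2 (by positivity)
  have hS := hF.of_norm.hasSum
  have h1 := hS.prod_fiberwise hF1
  have h2 : HasSum (fun r : ℕ => (r.factorial : ℂ)⁻¹ * l ^ r) (Complex.exp l) := by
    have := NormedSpace.expSeries_div_hasSum_exp l
    rw [← Complex.exp_eq_exp_ℂ] at this
    simpa only [div_eq_inv_mul] using this
  rw [h1.unique h2] at hS
  have h3 : HasSum (fun x : ℕ × ℕ => F (x.2, x.1)) (Complex.exp l) :=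
    (Equiv.prodComm ℕ ℕ).hasSum_iff.2 hS
  refine h3.prod_fiberwise fun m => ?_
  have h4 : expCoeff f m * u ^ m = ∑ r ∈ range (m + 1), F (r, m) := by
    rw [expCoeff, Finset.sum_mul]
    exact Finset.sum_congr rfl fun r _ => by rw [smul_eq_mul, mul_assoc]
  rw [h4]
  refine hasSum_sum_of_ne_finset_zero fun r hr => ?_
  have hr' : m < r := by
    rw [Finset.mem_range] at hr; omega
  change (r.factorial : ℂ)⁻¹ * (PowerSeries.coeff m (f ^ r) * u ^ m) = 0
  rw [coeff_pow_eq_zero h0 hr', zero_mul, mul_zero]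

/-! ## Infinite products -/

section EulerProd

variable {ι : Type*} (c : ι → ℂ)

lemma multipliable_one_sub_mul (hc : Summable fun i => ‖c i‖) (x : ℂ) :
    Multipliable fun i => 1 - c i * x := by
  simp only [sub_eq_add_neg]
  refine multipliable_one_add_of_summable ?_
  simpa using hc.mul_right ‖x‖

lemma tprod_one_sub_mul_ne_zero (hc : Summable fun i => ‖c i‖) {x : ℂ}
    (h : ∀ i, c i * x ≠ 1) : ∏' i, (1 - c i * x) ≠ 0 := by
  simp only [sub_eq_add_neg]
  refine tprod_one_add_ne_zero_of_summable (fun i => ?_) (by simpa using hc.mul_right ‖x‖)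
  rw [← sub_eq_add_neg, sub_ne_zero]
  exact (h i).symm

/-- The product converges locally uniformly on each disc, since the factors are dominated there by a
summable sequence. -/
lemma differentiable_tprod_one_sub_mul (hc : Summable fun i => ‖c i‖) :
    Differentiable ℂ fun x => ∏' i, (1 - c i * x) := by
  intro x
  have hopen : IsOpen (Metric.ball (0 : ℂ) (‖x‖ + 1)) := Metric.isOpen_ball
  have hmul : Summable fun i => ‖c i‖ * (‖x‖ + 1) := hc.mul_right _
  have h := hmul.hasProdLocallyUniformlyOn_one_add
    (f := fun i y => -(c i * y)) hopen
    (Eventually.of_forall fun i y hy => by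
      rw [norm_neg, norm_mul]
      exact mul_le_mul_of_nonneg_left (by simpa using (Metric.mem_ball.1 hy).le) (norm_nonneg _))
    (fun i => by fun_prop)
  have h2 : DifferentiableOn ℂ (fun y => ∏' i, (1 + -(c i * y))) (Metric.ball (0 : ℂ) (‖x‖ + 1)) :=
    h.differentiableOn (.of_forall fun s => by
      simpa [Finset.prod_fn] using DifferentiableOn.finsetProd (fun _ _ => by fun_prop)) hopen
  simp only [← sub_eq_add_neg] at h2
  exact h2.differentiableAt (hopen.mem_nhds (by simp))

/-- Expanding each `log(1 - c_i x)` and exchanging the sums turns the product into the exponential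
of a series in the power sums of the `c_i`. For `c_i` running through a geometric progression,
simple or double, these power sums are explicit. -/
lemma hasSum_log_tprod (hc : Summable fun i => ‖c i‖) (hc1 : ∀ i, ‖c i‖ ≤ 1) {x : ℂ}
    (hx : ‖x‖ < 1) : ∃ l, HasSum (fun n : ℕ => -((∑' i, c i ^ n) / n) * x ^ n) l ∧
      ∏' i, (1 - c i * x) = Complex.exp l := by
  have hcx : ∀ i, ‖c i * x‖ < 1 := fun i => by
    rw [norm_mul]
    exact (mul_le_of_le_one_left (norm_nonneg _) (hc1 i)).trans_lt hx
  let F : ι × ℕ → ℂ := fun p => -((c p.1 * x) ^ p.2 / p.2)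
  have hF1 : ∀ i, HasSum (fun n => F (i, n)) (Complex.log (1 - c i * x)) := fun i => by
    simpa [F] using (Complex.hasSum_taylorSeries_neg_log (hcx i)).neg
  have hF : Summable fun p => ‖F p‖ := by
    have hg : Summable fun n : ℕ => ‖x‖ ^ n := summable_geometric_of_lt_one (norm_nonneg _) hx
    have hprod : Summable fun p : ι × ℕ => ‖c p.1‖ * ‖x‖ ^ p.2 :=
      hc.mul_of_nonneg hg (fun _ => norm_nonneg _) fun _ => by positivity
    refine Summable.of_nonneg_of_le (fun _ => norm_nonneg _) (fun p => ?_) hprod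
    rcases p with ⟨i, n⟩
    rcases n with _ | n
    · simp [F]
    · simp only [F, norm_neg, norm_div, norm_pow, norm_mul, mul_pow, Complex.norm_natCast]
      refine (div_le_self (by positivity) (by simp)).trans ?_
      exact mul_le_mul_of_nonneg_right (pow_le_of_le_one (norm_nonneg _) (hc1 i) n.succ_ne_zero)
        (by positivity)
  have hS := hF.of_norm.hasSum
  have h1 := hS.prod_fiberwise hF1
  have h3 : HasSum (fun p : ℕ × ι => F (p.2, p.1)) (∑' p, F p) :=
    (Equiv.prodComm ℕ ι).hasSum_iff.2 hS
  refine ⟨∑' p, F p, h3.prod_fiberwise fun n => ?_, ?_⟩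
  · rcases Nat.eq_zero_or_pos n with rfl | hn
    · simp [F, hasSum_zero]
    · have hsn : Summable fun i => c i ^ n := by
        refine Summable.of_norm_bounded hc fun i => ?_
        rw [norm_pow]
        exact pow_le_of_le_one (norm_nonneg _) (hc1 i) hn.ne'
      have := (hsn.hasSum.div_const (n : ℂ)).neg.mul_right (x ^ n)
      have e : (fun i => F (i, n)) = fun i => -(c i ^ n / n) * x ^ n := by
        funext i
        simp only [F, mul_pow]
        ring
      exact e ▸ this
  · rw [← h1.tsum_eq]
    refine (Complex.cexp_tsum_eq_tprod (fun i h => ?_) h1.summable).symm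
    have := hcx i
    rw [← sub_eq_zero.1 h, norm_one] at this
    exact lt_irrefl _ this

end EulerProd

/-! ### Infinite `q`-shifted factorials as entire functions. -/

section Pochhammer

variable {q κ : ℂ}

lemma summable_norm_pow (hq : ‖q‖ < 1) : Summable fun i : ℕ => ‖q ^ i‖ := by
  simpa using summable_geometric_of_lt_one (norm_nonneg _) hq

lemma summable_norm_pow_mul_pow (hq : ‖q‖ < 1) (hκ : ‖κ‖ < 1) :
    Summable fun i : ℕ × ℕ => ‖q ^ i.1 * κ ^ i.2‖ := by
  simpa using (summable_norm_pow hq).mul_of_nonneg (summable_norm_pow hκ)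
    (fun _ => norm_nonneg _) fun _ => norm_nonneg _

lemma qPochInf_ne_zero (hq : ‖q‖ < 1) {x : ℂ} (h : ∀ n : ℕ, q ^ n * x ≠ 1) :
    qPochInf x q ≠ 0 :=
  tprod_one_sub_mul_ne_zero _ (summable_norm_pow hq) h

lemma qPochInf₂_ne_zero (hq : ‖q‖ < 1) (hκ : ‖κ‖ < 1) {x : ℂ}
    (h : ∀ m n : ℕ, q ^ m * κ ^ n * x ≠ 1) : qPochInf₂ x q κ ≠ 0 :=
  tprod_one_sub_mul_ne_zero _ (summable_norm_pow_mul_pow hq hκ) fun i => h i.1 i.2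

lemma differentiable_qPochInf (hq : ‖q‖ < 1) : Differentiable ℂ fun x => qPochInf x q :=
  differentiable_tprod_one_sub_mul _ (summable_norm_pow hq)

lemma differentiable_qPochInf₂ (hq : ‖q‖ < 1) (hκ : ‖κ‖ < 1) :
    Differentiable ℂ fun x => qPochInf₂ x q κ :=
  differentiable_tprod_one_sub_mul _ (summable_norm_pow_mul_pow hq hκ)

lemma qPochInf_eq_mul (hq : ‖q‖ < 1) (x : ℂ) : qPochInf x q = (1 - x) * qPochInf (q * x) q := by
  have h := multipliable_one_sub_mul _ (summable_norm_pow hq) (q * x)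
  rw [qPochInf, tprod_eq_zero_mul' (by simpa [pow_succ, mul_assoc] using h)]
  simp [qPochInf, pow_succ, mul_assoc]

lemma qPochInf_eq_qPoch_mul (hq : ‖q‖ < 1) (x : ℂ) (n : ℕ) :
    qPochInf x q = qPoch x q n * qPochInf (q ^ n * x) q := by
  induction n with
  | zero => simp [qPoch]
  | succ n ih =>
    rw [ih, qPochInf_eq_mul hq (q ^ n * x), qPoch, qPoch, Finset.prod_range_succ, pow_succ]
    ring_nf

/-- Splits off the factors with second index `0`. This `κ`-difference equation is the analytic
source of fusion. -/
lemma qPochInf₂_eq_mul (hq : ‖q‖ < 1) (hκ : ‖κ‖ < 1) (x : ℂ) :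
    qPochInf₂ x q κ = qPochInf x q * qPochInf₂ (κ * x) q κ := by
  have h1 : ∀ x, Multipliable fun i : ℕ × ℕ => 1 - q ^ i.1 * κ ^ i.2 * x :=
    multipliable_one_sub_mul _ (summable_norm_pow_mul_pow hq hκ)
  have h2 : ∀ (x : ℂ) (i : ℕ), Multipliable fun j : ℕ => 1 - q ^ i * κ ^ j * x := fun x i => by
    simpa [mul_left_comm, mul_assoc] using
      multipliable_one_sub_mul _ (summable_norm_pow hκ) (q ^ i * x)
  have h3 : Multipliable fun i : ℕ => 1 - q ^ i * x := multipliable_one_sub_mul _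
    (summable_norm_pow hq) x
  have h4 : Multipliable fun i : ℕ => ∏' j : ℕ, (1 - q ^ i * κ ^ j * (κ * x)) :=
    ((h1 (κ * x)).hasProd.prod_fiberwise fun i => (h2 (κ * x) i).hasProd).multipliable
  rw [qPochInf₂, (h1 x).tprod_prod' (h2 x), qPochInf, qPochInf₂,
    (h1 (κ * x)).tprod_prod' (h2 (κ * x)), ← h3.tprod_mul h4]
  refine tprod_congr fun i => ?_
  have h5 := h2 (κ * x) i
  rw [tprod_eq_zero_mul' (by simpa [pow_succ, mul_assoc, mul_left_comm] using h5)]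
  simp [pow_succ, mul_assoc]

/-! ## Logarithmic expansions of quotients of entire functions -/

/-- `exp(∑ c_n u^n)` is the expansion at `0` of the quotient `num / den`. -/
def Expands (c : ℕ → ℂ) (num den : ℂ → ℂ) : Prop :=
  ∀ᶠ r in 𝓝[>] (0 : ℝ), ∀ u : ℂ, ‖u‖ < r →
    ∃ l, HasSum (fun n => c n * u ^ n) l ∧ num u = den u * Complex.exp l

/-- Requiring the property for all small radii makes a common radius for several expansions
automatic, and the cross-multiplied form avoids any condition on zeros of denominators. -/
lemma Expands.mul {c c' : ℕ → ℂ} {num den num' den' : ℂ → ℂ} (h : Expands c num den)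
    (h' : Expands c' num' den') :
    Expands (fun n => c n + c' n) (fun u => num u * num' u) (fun u => den u * den' u) := by
  filter_upwards [h, h'] with r hr hr' u hu
  obtain ⟨l, hl, e⟩ := hr u hu
  obtain ⟨l', hl', e'⟩ := hr' u hu
  refine ⟨l + l', ?_, ?_⟩
  · simpa [add_mul] using hl.add hl'
  · simp only [e, e', Complex.exp_add]; ring

lemma Expands.inv {c : ℕ → ℂ} {num den : ℂ → ℂ} (h : Expands c num den) :
    Expands (fun n => -c n) den num := by
  filter_upwards [h] with r hr u hu
  obtain ⟨l, hl, e⟩ := hr u hu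
  refine ⟨-l, ?_, ?_⟩
  · simpa using hl.neg
  · rw [e, mul_assoc, ← Complex.exp_add]; simp

lemma Expands.one : Expands (fun _ => 0) (fun _ => 1) (fun _ => 1) := by
  refine Eventually.of_forall fun r u hu => ⟨0, ?_, by simp⟩
  simp [hasSum_zero]

lemma Expands.ite {c : ℕ → ℂ} {num den : ℂ → ℂ} (p : Prop) [Decidable p] (h : Expands c num den) :
    Expands (fun n => if p then c n else 0) (fun u => if p then num u else 1)
      (fun u => if p then den u else 1) := by
  by_cases hp : p
  · simpa [hp] using h
  · simpa [hp] using Expands.one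

lemma Expands.scale {c : ℕ → ℂ} {num den : ℂ → ℂ} (h : Expands c num den) (a : ℂ) :
    Expands (fun n => a ^ n * c n) (fun u => num (a * u)) (fun u => den (a * u)) := by
  obtain ⟨r₀, hr₀, hr₀'⟩ := (h.and self_mem_nhdsWithin).exists
  have hpos : 0 < r₀ / (‖a‖ + 1) := div_pos hr₀' (by positivity)
  filter_upwards [Ioo_mem_nhdsGT hpos] with r hr u hu
  have hau : ‖a * u‖ < r₀ := by
    have : ‖u‖ < r₀ / (‖a‖ + 1) := hu.trans hr.2
    rw [lt_div_iff₀ (by positivity)] at this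
    rw [norm_mul]
    nlinarith [norm_nonneg u, norm_nonneg a]
  obtain ⟨l, hl, e⟩ := hr₀ _ hau
  exact ⟨l, by simpa [mul_pow, mul_left_comm, mul_assoc] using hl, e⟩

lemma Expands.congr {c c' : ℕ → ℂ} {num den : ℂ → ℂ} (h : Expands c num den)
    (hc : ∀ n, n ≠ 0 → c' n = c n) (hc0 : c 0 = 0) (hc0' : c' 0 = 0) : Expands c' num den := by
  have : c' = c := funext fun n => by
    rcases eq_or_ne n 0 with rfl | hn
    · rw [hc0, hc0']
    · exact hc n hn
  rwa [this]

lemma expands_qPochInf (hq : ‖q‖ < 1) :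
    Expands (fun n => -(1 / (1 - q ^ n) / n)) (fun x => qPochInf x q) fun _ => 1 := by
  filter_upwards [Ioo_mem_nhdsGT zero_lt_one] with r hr u hu
  obtain ⟨l, hl, e⟩ := hasSum_log_tprod (fun i : ℕ => q ^ i) (summable_norm_pow hq)
    (fun i => by rw [norm_pow]; exact pow_le_one₀ (norm_nonneg _) hq.le) (hu.trans hr.2)
  refine ⟨l, ?_, by simpa [qPochInf] using e⟩
  convert hl using 1
  funext n
  rcases Nat.eq_zero_or_pos n with rfl | hn
  · simp
  · have : ‖q ^ n‖ < 1 := by rw [norm_pow]; exact pow_lt_one₀ (norm_nonneg _) hq hn.ne'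
    simp_rw [← pow_mul, mul_comm _ n, pow_mul]
    rw [tsum_geometric_of_norm_lt_one this, one_div]

lemma expands_qPochInf₂ (hq : ‖q‖ < 1) (hκ : ‖κ‖ < 1) :
    Expands (fun n => -(1 / ((1 - q ^ n) * (1 - κ ^ n)) / n)) (fun x => qPochInf₂ x q κ)
      fun _ => 1 := by
  filter_upwards [Ioo_mem_nhdsGT zero_lt_one] with r hr u hu
  obtain ⟨l, hl, e⟩ := hasSum_log_tprod (fun i : ℕ × ℕ => q ^ i.1 * κ ^ i.2)
    (summable_norm_pow_mul_pow hq hκ)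
    (fun i => by
      rw [norm_mul, norm_pow, norm_pow]
      exact mul_le_one₀ (pow_le_one₀ (norm_nonneg _) hq.le) (by positivity)
        (pow_le_one₀ (norm_nonneg _) hκ.le)) (hu.trans hr.2)
  refine ⟨l, ?_, by simpa [qPochInf₂] using e⟩
  convert hl using 1
  funext n
  rcases Nat.eq_zero_or_pos n with rfl | hn
  · simp
  · have h1 : ‖q ^ n‖ < 1 := by rw [norm_pow]; exact pow_lt_one₀ (norm_nonneg _) hq hn.ne'
    have h2 : ‖κ ^ n‖ < 1 := by rw [norm_pow]; exact pow_lt_one₀ (norm_nonneg _) hκ hn.ne'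
    have e : ∀ i : ℕ × ℕ, (q ^ i.1 * κ ^ i.2) ^ n = (q ^ n) ^ i.1 * (κ ^ n) ^ i.2 := fun i => by
      rw [mul_pow, ← pow_mul, ← pow_mul, ← pow_mul, ← pow_mul, mul_comm n, mul_comm n]
    simp_rw [e]
    rw [← tsum_mul_tsum_of_summable_norm (summable_norm_pow h1) (summable_norm_pow h2),
      tsum_geometric_of_norm_lt_one h1, tsum_geometric_of_norm_lt_one h2, one_div, mul_inv]

end Pochhammer

end

end AffineScreening

namespace AffineScreening

noncomputable section

open Filter Topology

set_option linter.unusedSectionVars false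

/-! ## Contractions of elementary vertex operators -/

section Contraction

/-- The ratio `(t x;q)_∞ / (x;q)_∞`. -/
def ratioR (q t x : ℂ) : ℂ := qPochInf (t * x) q / qPochInf x q

/-- The ratio `(q x / t;q)_∞ / (q x;q)_∞`. -/
def ratioT (q t x : ℂ) : ℂ := qPochInf (q / t * x) q / qPochInf (q * x) q

variable {N : ℕ}

/-- The numerator of the contribution of a screening current to the left. -/
def leftNum (q t k : ℂ) (d : ZMod N) (u : ℂ) : ℂ :=
  (if d = 0 then qPochInf (q / t * u) q else 1) *
    (if d = -1 then qPochInf (t * (k⁻¹ * u)) q else 1)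

/-- The denominator of the contribution of a screening current to the left. -/
def leftDen (q k : ℂ) (d : ZMod N) (u : ℂ) : ℂ :=
  (if d = 0 then qPochInf (q * u) q else 1) * (if d = -1 then qPochInf (k⁻¹ * u) q else 1)

/-- The numerator of the contribution of a screening current to the right. -/
def rightNum (q k : ℂ) (d : ZMod N) (u : ℂ) : ℂ :=
  (if d = 0 then qPochInf u q else 1) * (if d = 1 then qPochInf (q * (k * u)) q else 1)

/-- The denominator of the contribution of a screening current to the right. -/
def rightDen (q t k : ℂ) (d : ZMod N) (u : ℂ) : ℂ :=
  (if d = 0 then qPochInf (t * u) q else 1) *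
    (if d = 1 then qPochInf (q / t * (k * u)) q else 1)

/-- The exponent shift `k^d` for `d` in `{1,…,N}` modulo `N`. -/
def shiftUp (k : ℂ) (d : ZMod N) : ℂ := if d = 0 then k ^ N else k ^ d.val

/-- The numerator of the contraction of two operators of type `φ`. -/
def phiNum (q k : ℂ) (d : ZMod N) (u : ℂ) : ℂ :=
  qPochInf₂ (k ^ d.val * u) q (k ^ N) * qPochInf₂ (shiftUp k d * q * u) q (k ^ N)

/-- The denominator of the contraction of two operators of type `φ`. -/
def phiDen (q t k : ℂ) (d : ZMod N) (u : ℂ) : ℂ :=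
  qPochInf₂ (t * k ^ d.val * u) q (k ^ N) * qPochInf₂ (shiftUp k d * (q / t) * u) q (k ^ N)

/-- Numerator of the contraction of `V(z)` and `V'(w)`, as a function of `u = w / z`. -/
def VLabel.contrNum (q t k : ℂ) : VLabel N → VLabel N → ℂ → ℂ
  | .phi i, .phi j, u => phiNum q k (j - i) u
  | .phi i, .scr j, u => rightNum q k (j - i) u
  | .scr i, .phi j, u => leftNum q t k (j - i) u
  | .scr i, .scr j, u => leftNum q t k (j - i) u * rightNum q k (j - i) u

/-- Denominator of the contraction of `V(z)` and `V'(w)`, as a function of `u = w / z`. -/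
def VLabel.contrDen (q t k : ℂ) : VLabel N → VLabel N → ℂ → ℂ
  | .phi i, .phi j, u => phiDen q t k (j - i) u
  | .phi i, .scr j, u => rightDen q t k (j - i) u
  | .scr i, .phi j, u => leftDen q k (j - i) u
  | .scr i, .scr j, u => leftDen q k (j - i) u * rightDen q t k (j - i) u

/-- The contraction of `V(z)` and `V'(w)`, as a function of `u = w / z`. -/
def VLabel.contr (q t k : ℂ) (V V' : VLabel N) (u : ℂ) : ℂ :=
  V.contrNum q t k V' u / V.contrDen q t k V' u

variable {q t k : ℂ}

lemma expands_ratioR (hq : ‖q‖ < 1) (t : ℂ) :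
    Expands (fun n => -((t ^ n - 1) / (1 - q ^ n) / n)) (fun x => qPochInf (t * x) q)
      fun x => qPochInf x q := by
  have h := ((expands_qPochInf hq).scale t).mul (expands_qPochInf hq).inv
  simp only [mul_one, one_mul] at h
  refine h.congr (fun n _ => by ring) (by simp) (by simp)

lemma expands_ratioT (hq : ‖q‖ < 1) (t : ℂ) :
    Expands (fun n => -(((q / t) ^ n - q ^ n) / (1 - q ^ n) / n))
      (fun x => qPochInf (q / t * x) q) fun x => qPochInf (q * x) q := by
  have h := ((expands_qPochInf hq).scale (q / t)).mul ((expands_qPochInf hq).scale q).inv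
  simp only [mul_one, one_mul] at h
  refine h.congr (fun n _ => by ring) (by simp) (by simp)

lemma expands_left (hq : ‖q‖ < 1) (t k : ℂ) (d : ZMod N) :
    Expands (fun n => -(((if d = 0 then (q / t) ^ n - q ^ n else 0) +
      if d = -1 then k⁻¹ ^ n * (t ^ n - 1) else 0) / (1 - q ^ n) / n))
      (leftNum q t k d) (leftDen q k d) := by
  have h := ((expands_ratioT hq t).ite (d = 0)).mul
    (((expands_ratioR hq t).scale k⁻¹).ite (d = -1))
  refine h.congr (fun n _ => ?_) (by simp) (by simp)
  split_ifs <;> ring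

lemma expands_right (hq : ‖q‖ < 1) (t k : ℂ) (d : ZMod N) :
    Expands (fun n => -(((if d = 0 then 1 - t ^ n else 0) +
      if d = 1 then k ^ n * (q ^ n - (q / t) ^ n) else 0) / (1 - q ^ n) / n))
      (rightNum q k d) (rightDen q t k d) := by
  have h := ((expands_ratioR hq t).inv.ite (d = 0)).mul
    (((expands_ratioT hq t).inv.scale k).ite (d = 1))
  refine h.congr (fun n _ => ?_) (by simp) (by simp)
  split_ifs <;> ring

lemma expands_phi (hq : ‖q‖ < 1) (hκ : ‖k ^ N‖ < 1) (t : ℂ) (d : ZMod N) :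
    Expands (fun n => -(((k ^ d.val) ^ n * (1 - t ^ n) +
      shiftUp k d ^ n * (q ^ n - (q / t) ^ n)) / ((1 - q ^ n) * (1 - (k ^ N) ^ n)) / n))
      (phiNum q k d) (phiDen q t k d) := by
  have e := expands_qPochInf₂ hq hκ
  have h := ((e.scale (k ^ d.val)).mul (e.scale (shiftUp k d * q))).mul
    ((e.scale (t * k ^ d.val)).mul (e.scale (shiftUp k d * (q / t)))).inv
  simp only [mul_one, one_mul] at h
  refine h.congr (fun n _ => ?_) (by simp) (by simp)
  simp only [mul_pow]
  ring

lemma one_sub_pow_ne_zero {q : ℂ} (hq : ‖q‖ < 1) {n : ℕ} (hn : n ≠ 0) : 1 - q ^ n ≠ 0 := by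
  intro h
  have : ‖q ^ n‖ < 1 := by rw [norm_pow]; exact pow_lt_one₀ (norm_nonneg _) hq hn
  rw [← sub_eq_zero.1 h, norm_one] at this
  exact lt_irrefl _ this

variable [NeZero N]

/-- The three cases depend only on `j - i` modulo `N`: a geometric term in its representative in
`{0,…,N-1}`, plus a diagonal correction from `(1 - κ^n Q)/(1 - κ^n) = (1 - Q)/(1 - κ^n) + Q` with `Q
= (q/t)^n`. -/
lemma heis_eq (hκ : ‖k ^ N‖ < 1) (i j : ZMod N) {n : ℕ} (hn : n ≠ 0) :
    heis N q t k i j n = n * ((1 - t ^ n) / (1 - q ^ n)) *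
      ((1 - (q / t) ^ n) / (1 - (k ^ N) ^ n) * (k ^ (j - i).val) ^ n +
        if j - i = 0 then (q / t) ^ n else 0) := by
  have h1 := one_sub_pow_ne_zero hκ hn
  rw [heis]
  simp only [Int.cast_natCast, zpow_natCast, zpow_neg]
  congr 1
  have hqt : q ^ n * (t ^ n)⁻¹ = (q / t) ^ n := by rw [div_pow, div_eq_mul_inv]
  by_cases hij : i = j
  · subst hij
    simp only [if_true, sub_self, ZMod.val_zero, pow_zero, one_pow, mul_one]
    rw [mul_assoc, hqt]
    field_simp
    ring
  · have hji : ¬ j - i = 0 := fun h => hij (sub_eq_zero.1 h).symm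
    rw [if_neg hij, if_neg hji, add_zero, hqt]
    have hsub : (i.val < j.val → ((j - i).val : ℤ) = -(i.val : ℤ) + j.val) ∧
        (¬ i.val < j.val → ((j - i).val : ℤ) = N - (i.val : ℤ) + j.val) := by
      have hne : i.val ≠ j.val := fun h => hij (ZMod.val_injective N h)
      have hi := i.val_lt
      have hj := j.val_lt
      constructor <;> intro h
      · rw [ZMod.val_sub h.le]; omega
      · have h2 : i - j = -(j - i) := by ring
        have h3 := ZMod.val_sub (a := i) (b := j) (by omega)
        rw [h2, ZMod.neg_val, if_neg hji] at h3
        have := (j - i).val_lt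
        omega
    split_ifs with h
    · rw [← hsub.1 h, ← Nat.cast_mul, zpow_natCast, mul_comm n, pow_mul]
    · rw [← hsub.2 h, ← Nat.cast_mul, zpow_natCast, mul_comm n, pow_mul]

/-- The constants `k^d` in the commutators jump only at `d = 0` modulo `N`. -/
lemma pow_val_sub (hN : 2 ≤ N) (d : ZMod N) :
    k ^ d.val - k * k ^ (d - 1).val = if d = 0 then 1 - k ^ N else 0 := by
  have : Fact (1 < N) := ⟨hN⟩
  split_ifs with h
  · subst h
    rw [zero_sub, ZMod.neg_val, if_neg one_ne_zero, ZMod.val_one, ZMod.val_zero, pow_zero,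
      ← pow_succ', Nat.sub_add_cancel (by omega)]
  · have h1 : 1 ≤ d.val := Nat.one_le_iff_ne_zero.2 fun h0 => h ((ZMod.val_eq_zero d).1 h0)
    rw [ZMod.val_sub (by rwa [ZMod.val_one]), ZMod.val_one, ← pow_succ',
      Nat.sub_add_cancel h1, sub_self]

/-- The geometric terms telescope. They survive only at the jump `j = i`, where the jump `1 - κ^n`
cancels the denominator, so no double product remains. The diagonal corrections contribute at `j - i
= 0` and `j - i = 1`. -/
lemma heis_right (hN : 2 ≤ N) (hκ : ‖k ^ N‖ < 1) (i j : ZMod N) {n : ℕ} (hn : n ≠ 0) :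
    heis N q t k i j n - k ^ n * heis N q t k i (j - 1) n = n * ((1 - t ^ n) / (1 - q ^ n)) *
      ((if j - i = 0 then 1 else 0) - if j - i = 1 then k ^ n * (q / t) ^ n else 0) := by
  have h1 := one_sub_pow_ne_zero hκ hn
  rw [heis_eq hκ i j hn, heis_eq hκ i (j - 1) hn]
  have hd : j - 1 - i = (j - i) - 1 := by ring
  rw [hd]
  set d := j - i
  have h2 := pow_val_sub (k := k ^ n) hN d
  rw [pow_right_comm k n, pow_right_comm k n, pow_right_comm k n] at h2
  have h3 : (if d - 1 = 0 then (q / t) ^ n else 0) = if d = 1 then (q / t) ^ n else 0 := by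
    simp only [sub_eq_zero]
  rw [h3]
  have h4 : (1 - (q / t) ^ n) / (1 - (k ^ N) ^ n) * ((k ^ d.val) ^ n -
      k ^ n * (k ^ (d - 1).val) ^ n) = if d = 0 then 1 - (q / t) ^ n else 0 := by
    rw [h2]
    split_ifs
    · field_simp
    · ring
  have h5 : (if d = 1 then k ^ n * (q / t) ^ n else 0) =
      k ^ n * if d = 1 then (q / t) ^ n else 0 := by split_ifs <;> ring
  have h6 : (if d = 0 then 1 - (q / t) ^ n else 0) =
      (if d = 0 then (1 : ℂ) else 0) - if d = 0 then (q / t) ^ n else 0 := by split_ifs <;> ring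
  rw [h6] at h4
  rw [h5]
  linear_combination (n * ((1 - t ^ n) / (1 - q ^ n))) * h4

/-- By invariance under a simultaneous shift of `i` and `j`, this is `heis_right` for the pair `(i -
1, j)`, multiplied by `-k^{-n}`. -/
lemma heis_left (hN : 2 ≤ N) (hk0 : k ≠ 0) (hκ : ‖k ^ N‖ < 1) (i j : ZMod N) {n : ℕ}
    (hn : n ≠ 0) :
    heis N q t k i j n - (k ^ n)⁻¹ * heis N q t k (i - 1) j n = n * ((1 - t ^ n) / (1 - q ^ n)) *
      ((if j - i = 0 then (q / t) ^ n else 0) - if j - i = -1 then (k ^ n)⁻¹ else 0) := by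
  have h := heis_right (q := q) (t := t) hN hκ (i - 1) j hn
  have h1 : heis N q t k (i - 1) (j - 1) n = heis N q t k i j n := by
    rw [heis_eq hκ _ _ hn, heis_eq hκ _ _ hn, sub_sub_sub_cancel_right]
  have hd : j - (i - 1) = (j - i) + 1 := by ring
  rw [h1, hd] at h
  simp only [add_eq_right, ← eq_neg_iff_add_eq_zero] at h
  have hkn : k ^ n ≠ 0 := pow_ne_zero _ hk0
  have e1 : (if j - i = 0 then k ^ n * (q / t) ^ n else 0) =
      k ^ n * if j - i = 0 then (q / t) ^ n else 0 := by split_ifs <;> ring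
  have e2 : (if j - i = -1 then (k ^ n)⁻¹ else 0) =
      (k ^ n)⁻¹ * if j - i = -1 then 1 else 0 := by split_ifs <;> ring
  rw [e1] at h
  rw [e2]
  have h2 := congrArg (fun z => -(k ^ n)⁻¹ * z) h
  field_simp at h2 ⊢
  linear_combination h2

/-- The contraction of two elementary vertex operators is the expansion of an explicit quotient
of products of infinite `q`-shifted factorials. -/
lemma expands_contr (hN : 2 ≤ N) (hk0 : k ≠ 0) (ht0 : t ≠ 0) (hq : ‖q‖ < 1) (hκ : ‖k ^ N‖ < 1)
    (V V' : VLabel N) : Expands (V.logCoeff q t k V') (V.contrNum q t k V')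
      (V.contrDen q t k V') := by
  have hlog0 : V.logCoeff q t k V' 0 = 0 := by simp [VLabel.logCoeff]
  have hQ : ∀ n : ℕ, (1 - t ^ n) * (q / t) ^ n = (q / t) ^ n - q ^ n := fun n => by
    rw [div_pow]; field_simp
  have hlog : ∀ (n : ℕ) (c : ℂ), n ≠ 0 → V.comm q t k V' n = n * ((1 - t ^ n) / (1 - q ^ n)) * c →
      V.logCoeff q t k V' n = -((1 - t ^ n) * c / (1 - q ^ n) / n) := by
    intro n c hn h
    have hn' : (n : ℂ) ≠ 0 := by exact_mod_cast hn
    rw [VLabel.logCoeff, h]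
    field_simp
  rcases V with i | i <;> rcases V' with j | j
  · refine (expands_phi hq hκ t (j - i)).congr (fun n hn => ?_) (by simp) hlog0
    rw [hlog n _ hn (heis_eq hκ i j hn)]
    have h1 := one_sub_pow_ne_zero hκ hn
    have h2 := one_sub_pow_ne_zero hq hn
    have hn' : (n : ℂ) ≠ 0 := by exact_mod_cast hn
    congr 1
    by_cases h : j - i = 0
    · simp only [shiftUp, h, if_true, ZMod.val_zero, pow_zero, one_pow]
      field_simp
      linear_combination (-(k ^ N) ^ n) * hQ n
    · simp only [shiftUp, h, if_false, add_zero]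
      field_simp
      linear_combination (-1) * hQ n
  · refine (expands_right hq t k (j - i)).congr (fun n hn => ?_) (by simp) hlog0
    rw [hlog n _ hn (heis_right hN hκ i j hn)]
    congr 3
    have hqn : q ^ n = (q / t) ^ n * t ^ n := by rw [div_pow]; field_simp
    rw [hqn]
    generalize (q / t) ^ n = Q
    split_ifs <;> ring
  · refine (expands_left hq t k (j - i)).congr (fun n hn => ?_) (by simp) hlog0
    rw [hlog n _ hn (by simpa [VLabel.comm] using heis_left hN hk0 hκ i j hn)]
    congr 3
    have hqn : q ^ n = (q / t) ^ n * t ^ n := by rw [div_pow]; field_simp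
    rw [hqn, inv_pow]
    generalize (q / t) ^ n = Q
    split_ifs <;> ring
  · refine ((expands_left hq t k (j - i)).mul (expands_right hq t k (j - i))).congr
      (fun n hn => ?_) (by simp) hlog0
    have hc : VLabel.comm q t k (.scr i) (.scr j) (n : ℤ) = n * ((1 - t ^ n) / (1 - q ^ n)) *
        (((if j - i = 0 then (q / t) ^ n else 0) - if j - i = -1 then (k ^ n)⁻¹ else 0) +
        ((if j - i = 0 then 1 else 0) - if j - i = 1 then k ^ n * (q / t) ^ n else 0)) := by
      have h1 := heis_left (q := q) (t := t) hN hk0 hκ i j hn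
      have h2 := heis_left (q := q) (t := t) hN hk0 hκ i (j - 1) hn
      have hd : j - 1 - i = (j - i) - 1 := by ring
      rw [hd] at h2
      -- Shifting `j` to `j - 1` moves the residues `-1, 0` of the left formula to `0, 1`; after
      -- multiplication by `-k^n` this is the right formula. Hence two screening currents contract
      -- to the product of a left and a right contribution.
      have h0 : (j - i - 1 = -1) = (j - i = 0) := by
        rw [sub_eq_neg_self]
      simp only [h0, sub_eq_zero (b := (1 : ZMod N))] at h2
      simp only [VLabel.comm, zpow_natCast, zpow_neg]
      rw [h1, h2]
      have hkn : k ^ n ≠ 0 := pow_ne_zero _ hk0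
      split_ifs <;> field_simp <;> ring
    rw [hlog n _ hn hc, ← neg_add, ← add_div, ← add_div]
    congr 3
    have hqn : q ^ n = (q / t) ^ n * t ^ n := by rw [div_pow]; field_simp
    rw [hqn, inv_pow]
    generalize (q / t) ^ n = Q
    split_ifs <;> ring

lemma differentiable_contr (hq : ‖q‖ < 1) (hκ : ‖k ^ N‖ < 1) (V V' : VLabel N) :
    Differentiable ℂ (V.contrNum q t k V') ∧ Differentiable ℂ (V.contrDen q t k V') := by
  have hg : ∀ a : ℂ, Differentiable ℂ fun u => qPochInf (a * u) q := fun a =>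
    (differentiable_qPochInf hq).comp (differentiable_id.const_mul a)
  have hP : ∀ a : ℂ, Differentiable ℂ fun u => qPochInf₂ (a * u) q (k ^ N) := fun a =>
    (differentiable_qPochInf₂ hq hκ).comp (differentiable_id.const_mul a)
  have hite : ∀ (p : Prop) [Decidable p] (f : ℂ → ℂ), Differentiable ℂ f →
      Differentiable ℂ fun u => if p then f u else 1 := fun p _ f hf => by
    by_cases h : p
    · simpa [h] using hf
    · simp [h]
  have h1 : ∀ d : ZMod N, Differentiable ℂ (leftNum q t k d) := fun d =>
    (hite _ _ (hg _)).mul (hite _ _ (by simpa [mul_assoc] using hg (t * k⁻¹)))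
  have h2 : ∀ d : ZMod N, Differentiable ℂ (leftDen q k d) := fun d =>
    (hite _ _ (hg _)).mul (hite _ _ (hg _))
  have h3 : ∀ d : ZMod N, Differentiable ℂ (rightNum q k d) := fun d =>
    (hite _ _ (differentiable_qPochInf hq)).mul
      (hite _ _ (by simpa [mul_assoc] using hg (q * k)))
  have h4 : ∀ d : ZMod N, Differentiable ℂ (rightDen q t k d) := fun d =>
    (hite _ _ (hg _)).mul (hite _ _ (by simpa [mul_assoc] using hg (q / t * k)))
  rcases V with i | i <;> rcases V' with j | j
  · exact ⟨(hP _).mul (hP _), (hP _).mul (hP _)⟩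
  · exact ⟨h3 _, h4 _⟩
  · exact ⟨h1 _, h2 _⟩
  · exact ⟨(h1 _).mul (h3 _), (h2 _).mul (h4 _)⟩

/-! ## Existence and uniqueness of matrix elements -/

lemma analyticOnNhd_prod_div {M : ℕ} {F : Fin M → Fin M → ℂ → ℂ}
    (hF : ∀ i j, Differentiable ℂ (F i j)) :
    AnalyticOnNhd ℂ (fun w : Fin M → ℂ => ∏ i, ∏ j ∈ Finset.Ioi i, F i j (w j / w i))
      {w | ∀ i, w i ≠ 0} := by
  refine Finset.analyticOnNhd_fun_prod _ fun i _ => Finset.analyticOnNhd_fun_prod _ fun j _ => ?_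
  intro w hw
  have h1 : ∀ i : Fin M, AnalyticAt ℂ (fun w : Fin M → ℂ => w i) w := fun i =>
    (ContinuousLinearMap.proj (R := ℂ) (φ := fun _ : Fin M => ℂ) i).analyticAt w
  have h2 : AnalyticAt ℂ (F i j) (w j / w i) := (hF i j).analyticAt _
  exact AnalyticAt.comp (g := F i j) (f := fun w : Fin M → ℂ => w j / w i) h2
    ((h1 j).div (h1 i) (hw i))

/-- The products of the numerators and of the denominators serve as `A` and `B`: they are entire in
the ratios `w_j/w_i`, hence analytic where no coordinate vanishes. One radius serves the finitely
many pairs. -/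
lemma isMatrixElement_prod_contr (hN : 2 ≤ N) (hk0 : k ≠ 0) (ht0 : t ≠ 0) (hq : ‖q‖ < 1)
    (hκ : ‖k ^ N‖ < 1) {M : ℕ} (V : Fin M → VLabel N) (z : Fin M → ℂ) (hz : ∀ i, z i ≠ 0)
    (hden : ∀ i j, i < j → (V i).contrDen q t k (V j) (z j / z i) ≠ 0) :
    IsMatrixElement q t k V z (∏ i, ∏ j ∈ Finset.Ioi i, (V i).contr q t k (V j) (z j / z i)) := by
  have hr : ∀ᶠ r in 𝓝[>] (0 : ℝ), ∀ i j : Fin M, ∀ u : ℂ, ‖u‖ < r →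
      ∃ l, HasSum (fun n => (V i).logCoeff q t k (V j) n * u ^ n) l ∧
        (V i).contrNum q t k (V j) u = (V i).contrDen q t k (V j) u * Complex.exp l :=
    eventually_all.2 fun i => eventually_all.2 fun j =>
      expands_contr hN hk0 ht0 hq hκ (V i) (V j)
  obtain ⟨r, hr, hr0⟩ := (hr.and self_mem_nhdsWithin).exists
  refine ⟨hz, r, hr0,
    fun w => ∏ i, ∏ j ∈ Finset.Ioi i, (V i).contrNum q t k (V j) (w j / w i),
    fun w => ∏ i, ∏ j ∈ Finset.Ioi i, (V i).contrDen q t k (V j) (w j / w i),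
    analyticOnNhd_prod_div fun i j => (differentiable_contr hq hκ _ _).1,
    analyticOnNhd_prod_div fun i j => (differentiable_contr hq hκ _ _).2, ?_, ?_, ?_⟩
  · intro w hw hwr
    have h1 : ∀ i j : Fin M, ∃ l : ℂ, i < j →
        HasSum (fun n => (V i).logCoeff q t k (V j) n * (w j / w i) ^ n) l ∧
        (V i).contrNum q t k (V j) (w j / w i) =
          (V i).contrDen q t k (V j) (w j / w i) * Complex.exp l := by
      intro i j
      by_cases hij : i < j
      · have : ‖w j / w i‖ < r := by
          rw [norm_div, div_lt_iff₀ (norm_pos_iff.2 (hw i))]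
          exact hwr i j hij
        obtain ⟨l, hl⟩ := hr i j _ this
        exact ⟨l, fun _ => hl⟩
      · exact ⟨0, fun h => absurd h hij⟩
    choose l hl using h1
    refine ⟨_, hasSum_corrTerm q t k V w hw (fun i j => Complex.exp (l i j)) fun i j hij => ?_, ?_⟩
    · refine hasSum_expCoeff (by simp [VLabel.logCoeff]) ?_
      simpa using (hl i j hij).1
    · simp only [← Finset.prod_mul_distrib]
      exact Finset.prod_congr rfl fun i _ => Finset.prod_congr rfl fun j hj =>
        (hl i j (Finset.mem_Ioi.1 hj)).2
  · exact Finset.prod_ne_zero_iff.2 fun i _ => Finset.prod_ne_zero_iff.2 fun j hj =>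
      hden i j (Finset.mem_Ioi.1 hj)
  · simp only [VLabel.contr, Finset.prod_div_distrib]

/-- The two expansions have the same sum on a nonempty open set, so the cross-multiplied identity `A
B' = A' B` holds there. It spreads to `(ℂ ∖ 0)^M` by the identity theorem, this set being connected.
-/
lemma IsMatrixElement.unique {M : ℕ} {V : Fin M → VLabel N} {z : Fin M → ℂ} {c c' : ℂ}
    (h : IsMatrixElement q t k V z c) (h' : IsMatrixElement q t k V z c') : c = c' := by
  obtain ⟨hz, r, hr, A, B, hA, hB, hS, hBz, rfl⟩ := h
  obtain ⟨-, r', hr', A', B', hA', hB', hS', hBz', rfl⟩ := h'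
  rw [div_eq_div_iff hBz hBz']
  set U : Set (Fin M → ℂ) := {w | ∀ i, w i ≠ 0} with hU
  have hUpre : IsPreconnected U := by
    have : U = Set.pi Set.univ fun _ => {0}ᶜ := by ext w; simp [hU]
    rw [this]
    exact isPreconnected_univ_pi fun _ =>
      (isConnected_compl_singleton_of_one_lt_rank (by simp) _).isPreconnected
  obtain ⟨ρ, hρ0, hρ1⟩ := exists_between (lt_min (lt_min hr hr') zero_lt_one)
  have hρr : ρ < r := hρ1.trans_le ((min_le_left _ _).trans (min_le_left _ _))
  have hρr' : ρ < r' := hρ1.trans_le ((min_le_left _ _).trans (min_le_right _ _))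
  have hρ1' : ρ < 1 := hρ1.trans_le (min_le_right _ _)
  -- The geometric point `(1, ρ, ρ², …)`, with `ρ` below both radii and below `1`, lies in both
  -- regions of convergence.
  let w₀ : Fin M → ℂ := fun i => ((ρ ^ (i : ℕ) : ℝ) : ℂ)
  have hw₀ : ∀ i, ‖w₀ i‖ = ρ ^ (i : ℕ) := fun i => by
    simp [w₀, abs_of_pos hρ0]
  have hw₀U : w₀ ∈ U := fun i => by
    rw [← norm_pos_iff, hw₀]; positivity
  have hlt : ∀ i j : Fin M, i < j → ‖w₀ j‖ < r * ‖w₀ i‖ ∧ ‖w₀ j‖ < r' * ‖w₀ i‖ := by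
    intro i j hij
    rw [hw₀, hw₀]
    have h1 : ρ ^ (j : ℕ) ≤ ρ * ρ ^ (i : ℕ) := by
      rw [← pow_succ']
      exact pow_le_pow_of_le_one hρ0.le hρ1'.le hij
    have h2 : 0 < ρ ^ (i : ℕ) := by positivity
    exact ⟨h1.trans_lt (by gcongr), h1.trans_lt (by gcongr)⟩
  have hev : ∀ᶠ w in 𝓝 w₀, (∀ i, w i ≠ 0) ∧
      ∀ i j, i < j → ‖w j‖ < r * ‖w i‖ ∧ ‖w j‖ < r' * ‖w i‖ := by
    refine (eventually_all.2 fun i => ?_).and (eventually_all.2 fun i => eventually_all.2 fun j => ?_)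
    · exact ((continuous_apply i).continuousAt).eventually_ne (hw₀U i)
    · by_cases hij : i < j
      · have h1 : ContinuousAt (fun w : Fin M → ℂ => ‖w j‖) w₀ :=
          (continuous_apply j).norm.continuousAt
        have h2 : ContinuousAt (fun w : Fin M → ℂ => r * ‖w i‖) w₀ :=
          ((continuous_apply i).norm.const_mul r).continuousAt
        have h3 : ContinuousAt (fun w : Fin M → ℂ => r' * ‖w i‖) w₀ :=
          ((continuous_apply i).norm.const_mul r').continuousAt
        filter_upwards [h1.eventually_lt h2 (hlt i j hij).1, h1.eventually_lt h3 (hlt i j hij).2]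
          with w e1 e2 _ using ⟨e1, e2⟩
      · exact Eventually.of_forall fun w h => absurd h hij
  have heq := (hA.mul hB').eqOn_of_preconnected_of_eventuallyEq (hA'.mul hB) hUpre hw₀U (by
    filter_upwards [hev] with w hw
    obtain ⟨S, hS1, hS2⟩ := hS w hw.1 fun i j hij => (hw.2 i j hij).1
    obtain ⟨S', hS1', hS2'⟩ := hS' w hw.1 fun i j hij => (hw.2 i j hij).2
    change A w * B' w = A' w * B w
    rw [hS2, hS2', hS1.unique hS1']
    ring)
  exact heq (show z ∈ U from hz)

/-! ## Correlators of words -/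

/-- The product of the contractions of all pairs of letters of a word. -/
def wordCorr (q t k : ℂ) : VWord N → ℂ
  | [] => 1
  | x :: W => (W.map fun y => x.1.contr q t k y.1 (y.2 / x.2)).prod * wordCorr q t k W

lemma prod_Ioi_get {α : Type*} (W : List α) (C : α → α → ℂ) (F : List α → ℂ) (h0 : F [] = 1)
    (hc : ∀ x W, F (x :: W) = (W.map (C x)).prod * F W) :
    ∏ i : Fin W.length, ∏ j ∈ Finset.Ioi i, C (W.get i) (W.get j) = F W := by
  induction W with
  | nil => simp [h0]
  | cons x W ih =>
    rw [hc, ← ih]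
    simp only [List.length_cons, Fin.prod_univ_succ (n := W.length)]
    congr 1
    · rw [Fin.prod_Ioi_zero, ← List.prod_ofFn]
      have : W.map (C x) = List.ofFn fun j => C x (W.get j) := by
        conv_lhs => rw [← List.ofFn_get W, List.map_ofFn]
        rfl
      rw [this]
      rfl
    · refine Finset.prod_congr rfl fun i _ => ?_
      rw [Fin.prod_Ioi_succ]
      rfl

lemma isVev_wordCorr (hN : 2 ≤ N) (hk0 : k ≠ 0) (ht0 : t ≠ 0) (hq : ‖q‖ < 1)
    (hκ : ‖k ^ N‖ < 1) (W : VWord N) (hz : ∀ x ∈ W, x.2 ≠ 0)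
    (hden : W.Pairwise fun x y => x.1.contrDen q t k y.1 (y.2 / x.2) ≠ 0) :
    W.IsVev q t k (wordCorr q t k W) := by
  have h := isMatrixElement_prod_contr hN hk0 ht0 hq hκ (fun i : Fin W.length => (W.get i).1)
    (fun i => (W.get i).2) (fun i => hz _ (List.get_mem _ _))
    (fun i j hij => List.pairwise_iff_get.1 hden i j hij)
  rw [prod_Ioi_get W (fun x y => x.1.contr q t k y.1 (y.2 / x.2)) (wordCorr q t k) rfl
    fun _ _ => rfl] at h
  exact h

lemma vev_eq_wordCorr (hN : 2 ≤ N) (hk0 : k ≠ 0) (ht0 : t ≠ 0) (hq : ‖q‖ < 1)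
    (hκ : ‖k ^ N‖ < 1) (W : VWord N) (hz : ∀ x ∈ W, x.2 ≠ 0)
    (hden : W.Pairwise fun x y => x.1.contrDen q t k y.1 (y.2 / x.2) ≠ 0) :
    (∃! c, W.IsVev q t k c) ∧ W.vev q t k = wordCorr q t k W := by
  have h := isVev_wordCorr hN hk0 ht0 hq hκ W hz hden
  refine ⟨⟨_, h, fun c hc => IsMatrixElement.unique hc h⟩, ?_⟩
  have hex : ∃ c, W.IsVev q t k c := ⟨_, h⟩
  rw [VWord.vev, dif_pos hex]
  exact IsMatrixElement.unique hex.choose_spec h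

/-- The product of the contractions of the letters of one word with those of another. -/
def wordCross (q t k : ℂ) (W W' : VWord N) : ℂ :=
  (W.map fun x => (W'.map fun y => x.1.contr q t k y.1 (y.2 / x.2)).prod).prod

lemma wordCorr_append (W W' : VWord N) : wordCorr q t k (W ++ W') =
    wordCorr q t k W * wordCross q t k W W' * wordCorr q t k W' := by
  induction W with
  | nil => simp [wordCorr, wordCross]
  | cons x W ih =>
    simp only [List.cons_append, wordCorr, ih, wordCross, List.map_append, List.prod_append,
      List.map_cons, List.prod_cons]
    ring

lemma wordCross_append_left (W W' W'' : VWord N) : wordCross q t k (W ++ W') W'' =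
    wordCross q t k W W'' * wordCross q t k W' W'' := by
  simp [wordCross]

lemma wordCorr_flatMap_range (B : ℕ → VWord N) (n : ℕ) :
    wordCorr q t k ((List.range n).flatMap B) = (∏ i ∈ Finset.range n, wordCorr q t k (B i)) *
      ∏ j ∈ Finset.range n, ∏ i ∈ Finset.range j, wordCross q t k (B i) (B j) := by
  have hcross : ∀ (n : ℕ) (W : VWord N), wordCross q t k ((List.range n).flatMap B) W =
      ∏ i ∈ Finset.range n, wordCross q t k (B i) W := by
    intro n W
    induction n with
    | zero => simp [wordCross]
    | succ n ih =>
      rw [List.range_succ, List.flatMap_append, wordCross_append_left, ih,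
        Finset.prod_range_succ, List.flatMap_singleton]
  induction n with
  | zero => simp [wordCorr]
  | succ n ih =>
    rw [List.range_succ, List.flatMap_append, List.flatMap_singleton, wordCorr_append, ih, hcross,
      Finset.prod_range_succ, Finset.prod_range_succ]
    ring

end Contraction

end

end AffineScreening

namespace AffineScreening

noncomputable section

set_option linter.unusedSectionVars false

/-! ## Contractions in terms of the two basic ratios -/

section Fusion

variable {N : ℕ} [NeZero N] {q t k : ℂ}

/-- The contribution to a contraction of a screening current to the left. -/
def leftFactor (q t k : ℂ) (d : ZMod N) (u : ℂ) : ℂ :=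
  (if d = 0 then ratioT q t u else 1) * (if d = -1 then ratioR q t (k⁻¹ * u) else 1)

/-- The contribution to a contraction of a screening current to the right. -/
def rightFactor (q t k : ℂ) (d : ZMod N) (u : ℂ) : ℂ :=
  (if d = 0 then (ratioR q t u)⁻¹ else 1) * (if d = 1 then (ratioT q t (k * u))⁻¹ else 1)

/-- The contraction of two operators of type `φ`. -/
def phiFactor (q t k : ℂ) (d : ZMod N) (u : ℂ) : ℂ := phiNum q k d u / phiDen q t k d u

lemma leftNum_div_leftDen (d : ZMod N) (u : ℂ) :
    leftNum q t k d u / leftDen q k d u = leftFactor q t k d u := by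
  simp only [leftNum, leftDen, leftFactor, ratioR, ratioT]
  split_ifs <;> simp [mul_div_mul_comm]

lemma rightNum_div_rightDen (d : ZMod N) (u : ℂ) :
    rightNum q k d u / rightDen q t k d u = rightFactor q t k d u := by
  simp only [rightNum, rightDen, rightFactor, ratioR, ratioT]
  split_ifs <;> simp [mul_div_mul_comm]

lemma contr_phi_phi (i j : ZMod N) (u : ℂ) :
    (VLabel.phi i).contr q t k (.phi j) u = phiFactor q t k (j - i) u := rfl

lemma contr_phi_scr (i j : ZMod N) (u : ℂ) :
    (VLabel.phi i).contr q t k (.scr j) u = rightFactor q t k (j - i) u :=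
  rightNum_div_rightDen _ _

lemma contr_scr_phi (i j : ZMod N) (u : ℂ) :
    (VLabel.scr i).contr q t k (.phi j) u = leftFactor q t k (j - i) u :=
  leftNum_div_leftDen _ _

lemma contr_scr_scr (i j : ZMod N) (u : ℂ) : (VLabel.scr i).contr q t k (.scr j) u =
    leftFactor q t k (j - i) u * rightFactor q t k (j - i) u := by
  rw [← leftNum_div_leftDen, ← rightNum_div_rightDen, div_mul_div_comm]
  rfl

/-- `x` does not lie in the group generated by `q` and `t`. -/
def Generic (q t x : ℂ) : Prop := ∀ a c : ℤ, q ^ a * t ^ c * x ≠ 1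

lemma Generic.mul (hq0 : q ≠ 0) (ht0 : t ≠ 0) {x : ℂ} (h : Generic q t x) (a c : ℤ) :
    Generic q t (q ^ a * t ^ c * x) := fun a' c' => by
  have := h (a' + a) (c' + c)
  rw [zpow_add₀ hq0, zpow_add₀ ht0] at this
  convert this using 1
  ring

lemma Generic.inv {x : ℂ} (h : Generic q t x) : Generic q t x⁻¹ := fun a c => by
  have := h (-a) (-c)
  contrapose! this
  rw [← inv_eq_one, ← this, zpow_neg, zpow_neg]
  simp [mul_comm]

lemma Generic.qPochInf_ne_zero (hq : ‖q‖ < 1) {x : ℂ} (h : Generic q t x) :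
    qPochInf x q ≠ 0 :=
  AffineScreening.qPochInf_ne_zero hq fun n => by simpa using h n 0

lemma Generic.mul_q (hq0 : q ≠ 0) (ht0 : t ≠ 0) {x : ℂ} (h : Generic q t x) :
    Generic q t (q * x) := by simpa using h.mul hq0 ht0 1 0

lemma Generic.mul_t (hq0 : q ≠ 0) (ht0 : t ≠ 0) {x : ℂ} (h : Generic q t x) :
    Generic q t (t * x) := by simpa using h.mul hq0 ht0 0 1

lemma Generic.mul_q_div_t (hq0 : q ≠ 0) (ht0 : t ≠ 0) {x : ℂ} (h : Generic q t x) :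
    Generic q t (q / t * x) := by simpa [div_eq_mul_inv] using h.mul hq0 ht0 1 (-1)

lemma Generic.ratioR_ne_zero (hq0 : q ≠ 0) (ht0 : t ≠ 0) (hq : ‖q‖ < 1) {x : ℂ}
    (h : Generic q t x) : ratioR q t x ≠ 0 :=
  div_ne_zero ((h.mul_t hq0 ht0).qPochInf_ne_zero hq) (h.qPochInf_ne_zero hq)

lemma Generic.ratioT_ne_zero (hq0 : q ≠ 0) (ht0 : t ≠ 0) (hq : ‖q‖ < 1) {x : ℂ}
    (h : Generic q t x) : ratioT q t x ≠ 0 :=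
  div_ne_zero ((h.mul_q_div_t hq0 ht0).qPochInf_ne_zero hq) ((h.mul_q hq0 ht0).qPochInf_ne_zero hq)

/-! ## Fusion of `φ_{p-1}(k ζ)` and `S_p(ζ)` into `φ_p(ζ)` -/

/-- Replacing `d` by `d - 1` and `u` by `k u` leaves the arguments of the double products unchanged
except where the representative of `d` wraps around. At `d = 0` the first pair jumps by `κ`, at `d =
1` the second, and `qPochInf₂_eq_mul` matches each jump with the contribution of the screening
current. -/
lemma phiFactor_mul_rightFactor (hN : 2 ≤ N) (hq : ‖q‖ < 1) (hκ : ‖k ^ N‖ < 1) (d : ZMod N)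
    (u : ℂ) : phiFactor q t k (d - 1) (k * u) * rightFactor q t k d u = phiFactor q t k d u := by
  have hf : Fact (1 < N) := ⟨hN⟩
  have h2 := qPochInf₂_eq_mul hq hκ
  rw [← rightNum_div_rightDen, phiFactor, phiFactor, div_mul_div_comm]
  have hs := pow_val_sub (k := k) hN d
  by_cases h0 : d = 0
  · subst h0
    rw [if_pos rfl] at hs
    have hv : k * k ^ ((0 : ZMod N) - 1).val = k ^ N := by
      rw [ZMod.val_zero, pow_zero] at hs; linear_combination -hs
    have h1 : ((0 : ZMod N) - 1 = 0) = False := by simp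
    have e1 : phiNum q k ((0 : ZMod N) - 1) (k * u) * rightNum q k (0 : ZMod N) u =
        phiNum q k (0 : ZMod N) u := by
      simp only [phiNum, rightNum, shiftUp, h1, if_true, if_false, zero_ne_one, ZMod.val_zero,
        pow_zero, one_mul, mul_one]
      rw [h2 u, ← hv]
      ring_nf
    have e2 : phiDen q t k ((0 : ZMod N) - 1) (k * u) * rightDen q t k (0 : ZMod N) u =
        phiDen q t k (0 : ZMod N) u := by
      simp only [phiDen, rightDen, shiftUp, h1, if_true, if_false, zero_ne_one, ZMod.val_zero,
        pow_zero, mul_one]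
      rw [h2 (t * u), ← hv]
      ring_nf
    rw [e1, e2]
  · rw [if_neg h0, sub_eq_zero] at hs
    by_cases h1 : d = 1
    · subst h1
      have e1 : phiNum q k ((1 : ZMod N) - 1) (k * u) * rightNum q k (1 : ZMod N) u =
          phiNum q k (1 : ZMod N) u := by
        simp only [phiNum, rightNum, shiftUp, if_true, if_false, one_ne_zero, ZMod.val_zero,
          sub_self, ZMod.val_one, pow_zero, pow_one, one_mul]
        rw [h2 (k * q * u)]
        ring_nf
      have e2 : phiDen q t k ((1 : ZMod N) - 1) (k * u) * rightDen q t k (1 : ZMod N) u =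
          phiDen q t k (1 : ZMod N) u := by
        simp only [phiDen, rightDen, shiftUp, if_true, if_false, one_ne_zero, ZMod.val_zero,
          sub_self, ZMod.val_one, pow_zero, pow_one, one_mul, mul_one]
        rw [h2 (k * (q / t) * u)]
        ring_nf
      rw [e1, e2]
    · have h3 : ¬ d - 1 = 0 := fun h => h1 (sub_eq_zero.1 h)
      simp only [phiNum, phiDen, rightNum, rightDen, shiftUp, h0, h1, h3, if_false, mul_one, hs]
      ring_nf

/-- Left and right contributions are mutually inverse up to a shift, so fusion from the left follows
formally from fusion from the right, as long as nothing vanishes. -/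
lemma leftFactor_eq_inv (hk0 : k ≠ 0) (d : ZMod N) (u : ℂ) :
    leftFactor q t k d u = (rightFactor q t k (d + 1) (k⁻¹ * u))⁻¹ := by
  simp only [leftFactor, rightFactor, ← eq_neg_iff_add_eq_zero, add_eq_right,
    mul_inv_cancel_left₀ hk0]
  split_ifs <;> simp [mul_comm]

lemma Generic.leftFactor_ne_zero (hq0 : q ≠ 0) (ht0 : t ≠ 0) (hq : ‖q‖ < 1) {u : ℂ}
    (h : Generic q t u) (h' : Generic q t (k⁻¹ * u)) (d : ZMod N) :
    leftFactor q t k d u ≠ 0 := by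
  have h1 := h.ratioT_ne_zero hq0 ht0 hq
  have h2 := h'.ratioR_ne_zero hq0 ht0 hq
  simp only [leftFactor]
  split_ifs <;> simp [h1, h2]

lemma phiFactor_mul_leftFactor (hN : 2 ≤ N) (hk0 : k ≠ 0) (hq0 : q ≠ 0) (ht0 : t ≠ 0)
    (hq : ‖q‖ < 1) (hκ : ‖k ^ N‖ < 1) (d : ZMod N) {u : ℂ} (h : Generic q t u)
    (h' : Generic q t (k⁻¹ * u)) :
    phiFactor q t k (d + 1) (k⁻¹ * u) * leftFactor q t k d u = phiFactor q t k d u := by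
  have h1 := phiFactor_mul_rightFactor (t := t) hN hq hκ (d + 1) (k⁻¹ * u)
  rw [mul_inv_cancel_left₀ hk0, add_sub_cancel_right] at h1
  have h2 := h.leftFactor_ne_zero hq0 ht0 hq h' d
  rw [leftFactor_eq_inv hk0] at h2
  rw [← h1, leftFactor_eq_inv hk0, mul_assoc, mul_inv_cancel₀ (inv_eq_zero.not.1 h2), mul_one]

/-- Against a `φ` this is `phiFactor_mul_rightFactor`. Against a screening current the contribution
of the current to the shifted `φ` cancels the right contribution of `S_p`, by `leftFactor_eq_inv`.
-/
lemma contr_fuse_right (hN : 2 ≤ N) (hk0 : k ≠ 0) (hq0 : q ≠ 0) (ht0 : t ≠ 0)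
    (hq : ‖q‖ < 1) (hκ : ‖k ^ N‖ < 1) (V : VLabel N) (p : ZMod N) {u : ℂ} (h : Generic q t u)
    (h' : Generic q t (k * u)) : V.contr q t k (.phi (p - 1)) (k * u) *
      V.contr q t k (.scr p) u = V.contr q t k (.phi p) u := by
  rcases V with i | i
  · rw [contr_phi_phi, contr_phi_scr, contr_phi_phi, ← phiFactor_mul_rightFactor hN hq hκ (p - i)]
    congr 2
    ring
  · rw [contr_scr_phi, contr_scr_scr, contr_scr_phi]
    have hd : p - 1 - i = (p - i) - 1 := by ring
    have h1 : leftFactor q t k (p - i - 1) (k * u) * rightFactor q t k (p - i) u = 1 := by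
      rw [leftFactor_eq_inv hk0, inv_mul_cancel_left₀ hk0, sub_add_cancel]
      refine inv_mul_cancel₀ ?_
      have := h'.leftFactor_ne_zero (k := k) hq0 ht0 hq (by rwa [inv_mul_cancel_left₀ hk0])
        (p - i - 1)
      rw [leftFactor_eq_inv hk0, inv_mul_cancel_left₀ hk0, sub_add_cancel] at this
      exact inv_eq_zero.not.1 this
    rw [hd]
    linear_combination leftFactor q t k (p - i) u * h1

lemma contr_fuse_left (hN : 2 ≤ N) (hk0 : k ≠ 0) (hq0 : q ≠ 0) (ht0 : t ≠ 0)
    (hq : ‖q‖ < 1) (hκ : ‖k ^ N‖ < 1) (V : VLabel N) (p : ZMod N) {u : ℂ} (h : Generic q t u)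
    (h' : Generic q t (k⁻¹ * u)) : (VLabel.phi (p - 1)).contr q t k V (k⁻¹ * u) *
      (VLabel.scr p).contr q t k V u = (VLabel.phi p).contr q t k V u := by
  rcases V with j | j
  · rw [contr_phi_phi, contr_scr_phi, contr_phi_phi,
      ← phiFactor_mul_leftFactor hN hk0 hq0 ht0 hq hκ (j - p) h h']
    congr 2
    ring
  · rw [contr_phi_scr, contr_scr_scr, contr_phi_scr]
    have hd : j - (p - 1) = (j - p) + 1 := by ring
    have h1 : rightFactor q t k (j - p + 1) (k⁻¹ * u) * leftFactor q t k (j - p) u = 1 := by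
      have := h.leftFactor_ne_zero hq0 ht0 hq h' (j - p)
      rw [leftFactor_eq_inv hk0] at this ⊢
      exact mul_inv_cancel₀ (inv_eq_zero.not.1 this)
    rw [hd, ← mul_assoc, h1, one_mul]

lemma wordCross_fuse_right (hN : 2 ≤ N) (hk0 : k ≠ 0) (hq0 : q ≠ 0) (ht0 : t ≠ 0)
    (hq : ‖q‖ < 1) (hκ : ‖k ^ N‖ < 1) (W W' : VWord N) (p : ZMod N) (ζ : ℂ)
    (h : ∀ x ∈ W, Generic q t (ζ / x.2) ∧ Generic q t (k * ζ / x.2)) :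
    wordCross q t k W ((.phi (p - 1), k * ζ) :: (.scr p, ζ) :: W') =
      wordCross q t k W ((.phi p, ζ) :: W') := by
  rw [wordCross, wordCross]
  congr 1
  refine List.map_congr_left fun x hx => ?_
  obtain ⟨h1, h2⟩ := h x hx
  simp only [List.map_cons, List.prod_cons]
  rw [mul_div_assoc] at h2 ⊢
  rw [← contr_fuse_right hN hk0 hq0 ht0 hq hκ x.1 p h1 h2, mul_assoc]

lemma wordCross_fuse_left (hN : 2 ≤ N) (hk0 : k ≠ 0) (hq0 : q ≠ 0) (ht0 : t ≠ 0)
    (hq : ‖q‖ < 1) (hκ : ‖k ^ N‖ < 1) (W W' : VWord N) (p : ZMod N) (ζ : ℂ)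
    (h : ∀ y ∈ W', Generic q t (y.2 / ζ) ∧ Generic q t (k⁻¹ * (y.2 / ζ))) :
    wordCross q t k ((.phi (p - 1), k * ζ) :: (.scr p, ζ) :: W) W' =
      wordCross q t k ((.phi p, ζ) :: W) W' := by
  simp only [wordCross, List.map_cons, List.prod_cons]
  rw [← mul_assoc, ← List.prod_map_mul]
  congr 2
  refine List.map_congr_left fun y hy => ?_
  obtain ⟨h1, h2⟩ := h y hy
  rw [← contr_fuse_left hN hk0 hq0 ht0 hq hκ y.1 p h1 h2]
  congr 2
  rw [div_mul_eq_div_div_swap, div_eq_inv_mul _ k]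

/-- Besides fusing in all outer contractions, the two letters contract with each other at argument
`k⁻¹` and residue `1`, which gives `T(k k⁻¹)⁻¹ = T(1)⁻¹`. This forces the normalising constant of
the screened operators. -/
lemma wordCorr_fuse (hN : 2 ≤ N) (hk0 : k ≠ 0) (hq0 : q ≠ 0) (ht0 : t ≠ 0)
    (hq : ‖q‖ < 1) (hκ : ‖k ^ N‖ < 1) (W : VWord N) (p : ZMod N) {ζ : ℂ} (hζ : ζ ≠ 0)
    (h : ∀ y ∈ W, Generic q t (y.2 / ζ) ∧ Generic q t (k⁻¹ * (y.2 / ζ)))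
    (hT : ratioT q t 1 ≠ 0) :
    ratioT q t 1 * wordCorr q t k ((.phi (p - 1), k * ζ) :: (.scr p, ζ) :: W) =
      wordCorr q t k ((.phi p, ζ) :: W) := by
  have hf : Fact (1 < N) := ⟨hN⟩
  have h1 := wordCross_fuse_left hN hk0 hq0 ht0 hq hκ [] W p ζ h
  simp only [wordCross, List.map_cons, List.prod_cons, List.map_nil, List.prod_nil, mul_one] at h1
  simp only [wordCorr, List.map_cons, List.prod_cons]
  rw [← h1, contr_phi_scr]
  have h2 : ζ / (k * ζ) = k⁻¹ := by field_simp
  have h3 : rightFactor q t k (p - (p - 1)) (ζ / (k * ζ)) = (ratioT q t 1)⁻¹ := by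
    rw [h2, sub_sub_cancel, rightFactor, if_neg one_ne_zero, if_pos rfl, mul_inv_cancel₀ hk0,
      one_mul]
  rw [h3]
  field_simp

end Fusion

end

end AffineScreening

namespace AffineScreening

noncomputable section

set_option linter.unusedSectionVars false

open Finset (range)

/-! ## Half products of Nekrasov type -/

section HalfProducts

variable {N : ℕ}

/-- The first half of a Nekrasov factor, in terms of a function `R` that stands for an infinite
product. -/
def halfOne (R : ℂ → ℂ) (q k : ℂ) (K : ℕ) (c : ZMod N) (l m : ℕ → ℕ) (u : ℂ) : ℂ :=
  ∏ b ∈ range K, ∏ a ∈ range (b + 1), if (b : ZMod N) - a = c then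
    R (u * q ^ ((l (b + 1) : ℤ) - m a) * k ^ ((b : ℤ) - a)) *
      (R (u * q ^ ((l b : ℤ) - m a) * k ^ ((b : ℤ) - a)))⁻¹ else 1

/-- The second half of a Nekrasov factor, in terms of a function `R` that stands for an infinite
product. -/
def halfTwo (R : ℂ → ℂ) (q k : ℂ) (K : ℕ) (c : ZMod N) (l m : ℕ → ℕ) (u : ℂ) : ℂ :=
  ∏ b ∈ range K, ∏ a ∈ range (b + 1), if (b : ZMod N) - a = -c - 1 then
    R (u * q ^ ((l a : ℤ) - m b) * k ^ ((a : ℤ) - b - 1)) *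
      (R (u * q ^ ((l a : ℤ) - m (b + 1)) * k ^ ((a : ℤ) - b - 1)))⁻¹ else 1

/-- Splits a `(K+1) × K` rectangle into `a ≤ b` and `a > b`, the latter with `a` lowered by one so
that both triangles have the same shape. -/
lemma prod_rectangle (D : ℕ → ℕ → ℂ) (K : ℕ) :
    ∏ a ∈ range (K + 1), ∏ b ∈ range K, D a b =
      (∏ b ∈ range K, ∏ a ∈ range (b + 1), D a b) *
        ∏ a ∈ range K, ∏ b ∈ range (a + 1), D (a + 1) b := by
  induction K with
  | zero => simp
  | succ K ih =>
    rw [Finset.prod_range_succ, Finset.prod_congr rfl fun a _ => Finset.prod_range_succ _ K,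
      Finset.prod_mul_distrib, ih, Finset.prod_range_succ (fun b => ∏ a ∈ range (b + 1), D a b),
      Finset.prod_range_succ (fun a => ∏ b ∈ range (a + 1), D (a + 1) b)]
    ring

/-- The argument of the contraction of the letters number `a` and `b` of two screened vertex
operators. -/
def ratioArg (q k : ℂ) (l m : ℕ → ℕ) (v : ℂ) (a b : ℕ) : ℂ :=
  v * q ^ ((m b : ℤ) - l a) * k ^ ((b : ℤ) - a)

lemma ratioArg_inv (q k : ℂ) (l m : ℕ → ℕ) (v : ℂ) (a b : ℕ) :
    ratioArg q k m l v⁻¹ b a = (ratioArg q k l m v a b)⁻¹ := by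
  simp only [ratioArg, mul_inv, ← zpow_neg, neg_sub]

variable {q k : ℂ}

lemma inv_mul_ratioArg (hk0 : k ≠ 0) (l m : ℕ → ℕ) (v : ℂ) (a b : ℕ) :
    k⁻¹ * ratioArg q k l m v a b = v * q ^ ((m b : ℤ) - l a) * k ^ ((b : ℤ) - a - 1) := by
  rw [ratioArg, zpow_sub_one₀ hk0]; ring

lemma mul_ratioArg (hk0 : k ≠ 0) (l m : ℕ → ℕ) (v : ℂ) (a b : ℕ) :
    k * ratioArg q k l m v a b = v * q ^ ((m b : ℤ) - l a) * k ^ ((b : ℤ) - a + 1) := by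
  rw [ratioArg, zpow_add_one₀ hk0]; ring

/-- The contractions of two blocks that involve one of the two basic ratios combine into a
Nekrasov factor. -/
lemma halfOne_mul_halfTwo (hk0 : k ≠ 0) (R : ℂ → ℂ) (K : ℕ) (d : ZMod N) (l m : ℕ → ℕ) (v : ℂ) :
    (∏ a ∈ range K, ∏ b ∈ range (K + 1), if d + a - b = -1 then
      R (k⁻¹ * ratioArg q k l m v a b) else 1) *
    (∏ a ∈ range (K + 1), ∏ b ∈ range K, if d + a - b = 0 then
      (R (ratioArg q k l m v a b))⁻¹ else 1) =
    halfOne R q k K d m l v * halfTwo R q k K d m l v := by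
  -- Above the diagonal the numerator at `(a, b+1)` is paired with the denominator at `(a, b)`;
  -- below it, in `e2`, the numerator at `(a, b)` with the denominator at `(a+1, b)`. In each pair
  -- the residue conditions coincide and the powers of `k` agree, so only powers of `q` differ.
  have e1 : halfOne R q k K d m l v =
      (∏ b ∈ range K, ∏ a ∈ range (b + 1), if d + a - (b + 1 : ℕ) = -1 then
        R (k⁻¹ * ratioArg q k l m v a (b + 1)) else 1) *
      ∏ b ∈ range K, ∏ a ∈ range (b + 1), if d + a - b = 0 then
        (R (ratioArg q k l m v a b))⁻¹ else 1 := by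
    simp only [halfOne, ← Finset.prod_mul_distrib]
    refine Finset.prod_congr rfl fun b _ => Finset.prod_congr rfl fun a _ => ?_
    have h1 : (d + a - (b + 1 : ℕ) = -1) ↔ ((b : ZMod N) - a = d) := by
      push_cast
      constructor <;> intro h <;> linear_combination -h
    have h2 : (d + a - b = 0) ↔ ((b : ZMod N) - a = d) := by
      constructor <;> intro h <;> linear_combination -h
    simp only [h1, h2]
    split_ifs
    · rw [inv_mul_ratioArg hk0, ratioArg]
      push_cast
      ring_nf
    · simp
  have e2 : halfTwo R q k K d m l v =
      (∏ a ∈ range K, ∏ b ∈ range (a + 1), if d + a - b = -1 then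
        R (k⁻¹ * ratioArg q k l m v a b) else 1) *
      ∏ a ∈ range K, ∏ b ∈ range (a + 1), if d + (a + 1 : ℕ) - b = 0 then
        (R (ratioArg q k l m v (a + 1) b))⁻¹ else 1 := by
    simp only [halfTwo, ← Finset.prod_mul_distrib]
    refine Finset.prod_congr rfl fun a _ => Finset.prod_congr rfl fun b _ => ?_
    have h1 : (d + a - b = -1) ↔ ((a : ZMod N) - b = -d - 1) := by
      constructor <;> intro h <;> linear_combination h
    have h2 : (d + (a + 1 : ℕ) - b = 0) ↔ ((a : ZMod N) - b = -d - 1) := by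
      push_cast
      constructor <;> intro h <;> linear_combination h
    simp only [h1, h2]
    split_ifs
    · rw [inv_mul_ratioArg hk0, ratioArg]
      push_cast
      ring_nf
    · simp
  rw [e1, e2, Finset.prod_comm, prod_rectangle (fun b a => if d + a - b = -1 then
      R (k⁻¹ * ratioArg q k l m v a b) else 1), prod_rectangle]
  ring

/-! ## Finite shifted products -/

/-- The ratio `(t x;q)_n / (x;q)_n`. -/
def qPochRatio (q t x : ℂ) (n : ℕ) : ℂ := qPoch (t * x) q n / qPoch x q n

variable {t : ℂ}

lemma ratioR_mul_inv (hq : ‖q‖ < 1) {x : ℂ} {n : ℕ} (h : ratioR q t (q ^ n * x) ≠ 0) :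
    ratioR q t x * (ratioR q t (q ^ n * x))⁻¹ = qPochRatio q t x n := by
  have e : ratioR q t x = qPochRatio q t x n * ratioR q t (q ^ n * x) := by
    rw [ratioR, qPochInf_eq_qPoch_mul hq (t * x) n, qPochInf_eq_qPoch_mul hq x n,
      mul_div_mul_comm, mul_left_comm (q ^ n)]
    rfl
  rw [e, mul_assoc, mul_inv_cancel₀ h, mul_one]

/-- Reversing the order of the factors turns their arguments into inverses of `q^i x`, and `1 - y⁻¹
= -y⁻¹(1 - y)` turns these back. Numerator and denominator differ in the monomial by one `t⁻¹` for
each factor. -/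
lemma qPoch_ratio_inv (hq0 : q ≠ 0) (ht0 : t ≠ 0) {x : ℂ} (hx : x ≠ 0) (n : ℕ) :
    qPoch (q / t * (q ^ n * x)⁻¹) q n / qPoch (q * (q ^ n * x)⁻¹) q n =
      (t⁻¹) ^ n * qPochRatio q t x n := by
  have h : ∀ y : ℂ, qPoch (q * (q ^ n * y)⁻¹) q n = ∏ i ∈ range n, (1 - (q ^ i * y)⁻¹) := by
    intro y
    rw [qPoch, ← Finset.prod_range_reflect]
    refine Finset.prod_congr rfl fun i hi => ?_
    have hi' : n = (n - 1 - i) + 1 + i := by have := Finset.mem_range.1 hi; omega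
    congr 1
    generalize n - 1 - i = r at *
    subst hi'
    rw [pow_add, pow_succ]
    field_simp
  have h1 : q / t * (q ^ n * x)⁻¹ = q * (q ^ n * (t * x))⁻¹ := by field_simp
  have h2 : ∀ y : ℂ, y ≠ 0 → 1 - y⁻¹ = -(y⁻¹ * (1 - y)) := fun y hy => by field_simp; ring
  rw [h1, h, h, qPochRatio, qPoch, qPoch, ← Finset.prod_div_distrib, ← Finset.prod_div_distrib]
  nth_rewrite 2 [← Finset.card_range n]
  rw [← Finset.prod_const, ← Finset.prod_mul_distrib]
  refine Finset.prod_congr rfl fun i _ => ?_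
  have hqi : q ^ i ≠ 0 := pow_ne_zero _ hq0
  rw [h2 _ (by positivity), h2 _ (by positivity), neg_div_neg_eq, mul_div_mul_comm]
  congr 1
  field_simp

/-- Quotients of the second basic ratio give the same finite products as those of the first, up to
`t^{-n}`. So both families of contractions produce Nekrasov factors, and only this one produces
powers of `t`. -/
lemma ratioT_inv_mul (hq : ‖q‖ < 1) (hq0 : q ≠ 0) (ht0 : t ≠ 0) {x : ℂ} (hx : x ≠ 0) {n : ℕ}
    (h : ratioT q t x⁻¹ ≠ 0) :
    (ratioT q t x⁻¹)⁻¹ * ((ratioT q t (q ^ n * x)⁻¹)⁻¹)⁻¹ = (t⁻¹) ^ n * qPochRatio q t x n := by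
  have hqn : q ^ n ≠ 0 := pow_ne_zero _ hq0
  rw [inv_inv, ← qPoch_ratio_inv hq0 ht0 hx, ratioT, ratioT,
    qPochInf_eq_qPoch_mul hq (q / t * (q ^ n * x)⁻¹) n,
    qPochInf_eq_qPoch_mul hq (q * (q ^ n * x)⁻¹) n]
  have e1 : q ^ n * (q / t * (q ^ n * x)⁻¹) = q / t * x⁻¹ := by field_simp
  have e2 : q ^ n * (q * (q ^ n * x)⁻¹) = q * x⁻¹ := by field_simp
  rw [e1, e2, mul_div_mul_comm, mul_comm, mul_assoc, ← ratioT, mul_inv_cancel₀ h, mul_one]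

/-- The first half of a quotient of two Nekrasov factors. -/
def nekHalfOne (q t k : ℂ) (K : ℕ) (c : ZMod N) (l m : ℕ → ℕ) (u : ℂ) : ℂ :=
  ∏ b ∈ range K, ∏ a ∈ range (b + 1), if (b : ZMod N) - a = c then
    qPochRatio q t (u * q ^ ((l (b + 1) : ℤ) - m a) * k ^ ((b : ℤ) - a)) (l b - l (b + 1)) else 1

/-- The second half of a quotient of two Nekrasov factors. -/
def nekHalfTwo (q t k : ℂ) (K : ℕ) (c : ZMod N) (l m : ℕ → ℕ) (u : ℂ) : ℂ :=
  ∏ b ∈ range K, ∏ a ∈ range (b + 1), if (b : ZMod N) - a = -c - 1 then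
    qPochRatio q t (u * q ^ ((l a : ℤ) - m b) * k ^ ((a : ℤ) - b - 1)) (m b - m (b + 1)) else 1

lemma Part.support_eq_range (l : Part) : l.1.support = range l.length := by
  have hsub : l.1.support ⊆ range l.length := by
    intro a ha
    rw [Finset.mem_range, Part.length]
    refine lt_of_lt_of_le a.lt_succ_self ?_
    rw [← Finset.card_range (a.succ)]
    refine Finset.card_le_card fun b hb => ?_
    have h1 := l.2 (Nat.lt_succ_iff.1 (Finset.mem_range.1 hb))
    rw [Finsupp.mem_support_iff] at ha ⊢
    omega
  exact Finset.eq_of_subset_of_card_le hsub (by simp [Part.length])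

lemma Part.apply_eq_zero (l : Part) {a : ℕ} (h : l.length ≤ a) : l.1 a = 0 := by
  have : a ∉ l.1.support := by rw [l.support_eq_range, Finset.mem_range]; omega
  simpa using this

/-- Beyond the length all differences of consecutive parts vanish, so the ranges may be extended to
any common bound `K`. -/
lemma nekrasov_div (c : ZMod N) (l m : Part) (u : ℂ) {K : ℕ} (hl : l.length ≤ K)
    (hm : m.length ≤ K) : nekrasov N c l m (t * u) q k / nekrasov N c l m u q k =
      nekHalfOne q t k K c l.1 m.1 u * nekHalfTwo q t k K c l.1 m.1 u := by
  have hzero : ∀ x : ℂ, qPochRatio q t x 0 = 1 := fun x => by simp [qPochRatio, qPoch]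
  rw [nekrasov, nekrasov, mul_div_mul_comm, nekHalfOne, nekHalfTwo]
  congr 1
  · rw [← Finset.prod_subset (Finset.range_subset_range.2 hl), ← Finset.prod_div_distrib]
    · refine Finset.prod_congr rfl fun b _ => ?_
      rw [← Finset.prod_div_distrib, Finset.prod_filter]
      refine Finset.prod_congr rfl fun a _ => ?_
      split_ifs
      · rw [qPochRatio]
        ring_nf
      · rfl
    · intro b _ hb
      have hb' : l.length ≤ b := by simpa using hb
      rw [l.apply_eq_zero hb', l.apply_eq_zero (hb'.trans b.le_succ)]
      simp [hzero]
  · rw [← Finset.prod_subset (Finset.range_subset_range.2 hm), ← Finset.prod_div_distrib]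
    · refine Finset.prod_congr rfl fun b _ => ?_
      rw [← Finset.prod_div_distrib, Finset.prod_filter]
      refine Finset.prod_congr rfl fun a _ => ?_
      split_ifs
      · rw [qPochRatio]
        ring_nf
      · rfl
    · intro b _ hb
      have hb' : m.length ≤ b := by simpa using hb
      rw [m.apply_eq_zero hb', m.apply_eq_zero (hb'.trans b.le_succ)]
      simp [hzero]

/-- The power of `t⁻¹` carried by the parts of `l` in the residue class `c`. -/
def residueWeight (τ : ℂ) (K : ℕ) (c : ZMod N) (l : ℕ → ℕ) : ℂ :=
  ∏ a ∈ range K, if (a : ZMod N) = c then τ ^ l a else 1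

/-- Summation by parts: `λ_a` is the sum of the differences `λ_b - λ_{b+1}` over `b ≥ a`. For fixed
`b`, the reflection `a ↦ b - a` first turns the condition on `b - a` into one on `a`. -/
lemma prod_residue (τ : ℂ) (K : ℕ) (c : ZMod N) {l : ℕ → ℕ} (hl : Antitone l) (hK : l K = 0) :
    ∏ b ∈ range K, ∏ a ∈ range (b + 1), (if (b : ZMod N) - a = c then τ ^ (l b - l (b + 1)) else 1) =
      residueWeight τ K c l := by
  have h1 : ∀ b, ∏ a ∈ range (b + 1),
      (if (b : ZMod N) - a = c then τ ^ (l b - l (b + 1)) else 1) =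
      ∏ a ∈ range (b + 1), if (a : ZMod N) = c then τ ^ (l b - l (b + 1)) else 1 := by
    intro b
    rw [← Finset.prod_range_reflect]
    refine Finset.prod_congr rfl fun a ha => ?_
    have : a ≤ b := by have := Finset.mem_range.1 ha; omega
    rw [Nat.add_sub_cancel, Nat.cast_sub this, sub_sub_cancel]
  -- The extra factor carries the part `l K` not yet consumed in each row; it becomes trivial at the
  -- given `K` because `l K = 0`.
  have h2 : ∀ K, (∏ b ∈ range K, ∏ a ∈ range (b + 1),
      if (a : ZMod N) = c then τ ^ (l b - l (b + 1)) else 1) *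
      (∏ a ∈ range K, if (a : ZMod N) = c then τ ^ l K else 1) = residueWeight τ K c l := by
    intro K
    induction K with
    | zero => simp [residueWeight]
    | succ K ih =>
      have e : (∏ a ∈ range (K + 1), if (a : ZMod N) = c then τ ^ (l K - l (K + 1)) else 1) *
          (∏ a ∈ range (K + 1), if (a : ZMod N) = c then τ ^ l (K + 1) else 1) =
          ∏ a ∈ range (K + 1), if (a : ZMod N) = c then τ ^ l K else 1 := by
        rw [← Finset.prod_mul_distrib]
        refine Finset.prod_congr rfl fun a _ => ?_
        split_ifs
        · rw [← pow_add, Nat.sub_add_cancel (hl K.le_succ)]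
        · simp
      rw [Finset.prod_range_succ, mul_assoc, e, Finset.prod_range_succ _ K, ← mul_assoc, ih,
        residueWeight, residueWeight, Finset.prod_range_succ _ K]
  rw [Finset.prod_congr rfl fun b _ => h1 b, ← h2 K, hK]
  simp

end HalfProducts

end

end AffineScreening

namespace AffineScreening

noncomputable section

set_option linter.unusedSectionVars false

open Finset (range)

/-! ## Blocks: screened vertex operators with a prescribed number of screening currents -/

section Blocks

variable {N : ℕ} [NeZero N] {q t k : ℂ}

/-- The screening currents of a screened vertex operator. -/
def screens (q k : ℂ) (K : ℕ) (i : ZMod N) (l : ℕ → ℕ) (z : ℂ) : VWord N :=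
  (List.range K).reverse.map fun a : ℕ => (.scr (i - a), k ^ (a + 1) * q ^ l a * z)

/-- A screened vertex operator with `K` screening currents. -/
def block (q k : ℂ) (K : ℕ) (i : ZMod N) (l : ℕ → ℕ) (z : ℂ) : VWord N :=
  (.phi (i - K), k ^ (K + 1) * z) :: screens q k K i l z

lemma phiWord_eq_block (i : ZMod N) (l : Part) (z : ℂ) :
    phiWord q k i l z = block q k l.length i l.1 z := rfl

lemma screens_succ (K : ℕ) (i : ZMod N) (l : ℕ → ℕ) (z : ℂ) : screens q k (K + 1) i l z =
    (.scr (i - K), k ^ (K + 1) * q ^ l K * z) :: screens q k K i l z := by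
  simp [screens, List.range_succ]

lemma mem_screens {K : ℕ} {i : ZMod N} {l : ℕ → ℕ} {z : ℂ} {x : VLabel N × ℂ} :
    x ∈ screens q k K i l z ↔
      ∃ a < K, (.scr (i - a), k ^ (a + 1) * q ^ l a * z) = x := by
  simp [screens]

lemma prod_map_screens (f : VLabel N × ℂ → ℂ) (K : ℕ) (i : ZMod N) (l : ℕ → ℕ) (z : ℂ) :
    ((screens q k K i l z).map f).prod =
      ∏ a ∈ range K, f (.scr (i - a), k ^ (a + 1) * q ^ l a * z) := by
  induction K with
  | zero => simp [screens]
  | succ K ih => rw [screens_succ, List.map_cons, List.prod_cons, ih, Finset.prod_range_succ_comm]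

lemma letter_ratio (hq0 : q ≠ 0) (hk0 : k ≠ 0) (l m : ℕ → ℕ) (z w : ℂ) (a b : ℕ) :
    k ^ (b + 1) * q ^ m b * w / (k ^ (a + 1) * q ^ l a * z) =
      ratioArg q k l m (w / z) a b := by
  rw [ratioArg, zpow_sub₀ hq0, zpow_sub₀ hk0]
  simp only [zpow_natCast, pow_succ]
  field_simp

lemma label_sub (i j : ZMod N) (a b : ℕ) : j - b - (i - a) = j - i + a - b := by ring

/-- The function of the second basic ratio that plays the part of the first one. -/
def ratioT' (q t x : ℂ) : ℂ := (ratioT q t x⁻¹)⁻¹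

/-- The contractions between two blocks, in terms of half products. -/
lemma wordCross_block_eq (hq0 : q ≠ 0) (hk0 : k ≠ 0) (K : ℕ) (i j : ZMod N) (l m : ℕ → ℕ)
    (hl : l K = 0) (hm : m K = 0) (z w : ℂ) :
    wordCross q t k (block q k K i l z) (block q k K j m w) =
      phiFactor q t k (j - i) (w / z) *
        (halfOne (ratioR q t) q k K (j - i) m l (w / z) *
          halfTwo (ratioR q t) q k K (j - i) m l (w / z)) *
        (halfOne (ratioT' q t) q k K (-(j - i)) l m (w / z)⁻¹ *
          halfTwo (ratioT' q t) q k K (-(j - i)) l m (w / z)⁻¹) := by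
  -- Since `l K = 0`, the point of the `φ` has the form of letter number `K`. A `φ` thus behaves
  -- like a screening current whose own left or right contribution is absent, and only the corner
  -- `(K, K)` needs the contraction of two operators `φ`.
  have hz : k ^ (K + 1) * z = k ^ (K + 1) * q ^ l K * z := by rw [hl]; ring
  have hw : k ^ (K + 1) * w = k ^ (K + 1) * q ^ m K * w := by rw [hm]; ring
  have hX : ratioArg q k l m (w / z) K K = w / z := by simp [ratioArg, hl, hm]
  have e1 : wordCross q t k (block q k K i l z) (block q k K j m w) =
      phiFactor q t k (j - i) (w / z) *
        (∏ a ∈ range K, ∏ b ∈ range (K + 1),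
          leftFactor q t k (j - i + (a : ZMod N) - (b : ZMod N)) (ratioArg q k l m (w / z) a b)) *
        ∏ a ∈ range (K + 1), ∏ b ∈ range K,
          rightFactor q t k (j - i + (a : ZMod N) - (b : ZMod N)) (ratioArg q k l m (w / z) a b) := by
    rw [wordCross, block, block, hz, hw]
    simp only [List.map_cons, List.prod_cons, prod_map_screens, contr_phi_phi, contr_phi_scr,
      contr_scr_phi, contr_scr_scr, letter_ratio hq0 hk0, label_sub, hX,
      Finset.prod_mul_distrib]
    rw [Finset.prod_range_succ, Finset.prod_congr rfl fun a _ => Finset.prod_range_succ _ K,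
      Finset.prod_mul_distrib, add_sub_cancel_right]
    ring
  -- Since `T'(k⁻¹ x⁻¹) = T(k x)⁻¹` and `T'(x⁻¹)⁻¹ = T(x)`, the same regrouping covers the factors
  -- `T` once the two blocks are exchanged and the argument is inverted.
  have e2 := halfOne_mul_halfTwo (q := q) hk0 (ratioT' q t) K (-(j - i)) m l (w / z)⁻¹
  have h1 : ∀ a b : ℕ, (-(j - i) + (b : ZMod N) - a = -1) = (j - i + a - b = 1) := fun a b =>
    propext ⟨fun h => by linear_combination -h, fun h => by linear_combination -h⟩
  have h2 : ∀ a b : ℕ, (-(j - i) + (b : ZMod N) - a = 0) = (j - i + a - b = 0) := fun a b =>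
    propext ⟨fun h => by linear_combination -h, fun h => by linear_combination -h⟩
  conv at e2 =>
    lhs
    congr
    · rw [Finset.prod_comm]
    · rw [Finset.prod_comm]
  simp only [ratioArg_inv, h1, h2, ratioT', ← mul_inv, inv_inv] at e2
  rw [e1, ← halfOne_mul_halfTwo hk0, ← e2]
  simp only [leftFactor, rightFactor, Finset.prod_mul_distrib]
  ring

/-- The contractions within a block, in terms of half products. -/
lemma wordCorr_block_eq (hN : 2 ≤ N) (hq0 : q ≠ 0) (hk0 : k ≠ 0) (K : ℕ) (i : ZMod N)
    (l : ℕ → ℕ) (hl : l K = 0) {z : ℂ} (hz0 : z ≠ 0) :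
    ratioT q t 1 ^ K * wordCorr q t k (block q k K i l z) =
      halfOne (ratioT' q t) q k K (0 : ZMod N) l l 1 * halfTwo (ratioR q t) q k K (0 : ZMod N) l l 1 := by
  have hf : Fact (1 < N) := ⟨hN⟩
  have hz : k ^ (K + 1) * z = k ^ (K + 1) * q ^ l K * z := by rw [hl]; ring
  have hs : ∀ K, wordCorr q t k (screens q k K i l z) = ∏ a ∈ range K, ∏ b ∈ range a,
      leftFactor q t k ((a : ZMod N) - (b : ZMod N)) (ratioArg q k l l 1 a b) *
        rightFactor q t k ((a : ZMod N) - (b : ZMod N)) (ratioArg q k l l 1 a b) := by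
    intro K
    induction K with
    | zero => simp [screens, wordCorr]
    | succ K ih =>
      rw [screens_succ, wordCorr, prod_map_screens, ih, Finset.prod_range_succ_comm]
      simp only [contr_scr_scr, letter_ratio hq0 hk0, label_sub, sub_self, zero_add, div_self hz0]
  have e1 : wordCorr q t k (block q k K i l z) =
      (∏ a ∈ range K, ∏ b ∈ range a, leftFactor q t k ((a : ZMod N) - (b : ZMod N)) (ratioArg q k l l 1 a b)) *
        ∏ a ∈ range K, ∏ b ∈ range (a + 1),
          rightFactor q t k (((a + 1 : ℕ) : ZMod N) - (b : ZMod N)) (ratioArg q k l l 1 (a + 1) b) := by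
    rw [block, wordCorr, prod_map_screens, hs, hz]
    simp only [contr_phi_scr, letter_ratio hq0 hk0, label_sub, sub_self, zero_add, div_self hz0,
      Finset.prod_mul_distrib]
    have := Finset.prod_range_succ' (fun a : ℕ => ∏ b ∈ range a,
      rightFactor q t k ((a : ZMod N) - (b : ZMod N)) (ratioArg q k l l 1 a b)) K
    rw [Finset.range_zero, Finset.prod_empty, mul_one] at this
    rw [← this, Finset.prod_range_succ]
    ring
  have e2 : halfTwo (ratioR q t) q k K (0 : ZMod N) l l 1 =
      (∏ a ∈ range K, ∏ b ∈ range a,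
        if (a : ZMod N) - b = -1 then ratioR q t (k⁻¹ * ratioArg q k l l 1 a b) else 1) *
      ∏ a ∈ range K, ∏ b ∈ range (a + 1), if ((a + 1 : ℕ) : ZMod N) - b = 0 then
        (ratioR q t (ratioArg q k l l 1 (a + 1) b))⁻¹ else 1 := by
    rw [halfTwo, ← Finset.prod_mul_distrib]
    refine Finset.prod_congr rfl fun a _ => ?_
    have h0 : (∏ b ∈ range a,
        if (a : ZMod N) - b = -1 then ratioR q t (k⁻¹ * ratioArg q k l l 1 a b) else 1) =
        ∏ b ∈ range (a + 1),
          if (a : ZMod N) - b = -1 then ratioR q t (k⁻¹ * ratioArg q k l l 1 a b) else 1 := by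
      rw [Finset.prod_range_succ, sub_self, if_neg, mul_one]
      exact fun h => one_ne_zero (neg_eq_zero.1 h.symm)
    rw [h0, ← Finset.prod_mul_distrib]
    refine Finset.prod_congr rfl fun b _ => ?_
    have h1 : ((a : ZMod N) - b = -0 - 1) = ((a : ZMod N) - b = -1) := by simp
    have h2 : ((((a + 1 : ℕ) : ZMod N)) - b = 0) = ((a : ZMod N) - b = -1) := by
      push_cast
      exact propext ⟨fun h => by linear_combination h, fun h => by linear_combination h⟩
    simp only [h1, h2]
    split_ifs
    · rw [inv_mul_ratioArg hk0, ratioArg]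
      push_cast
      ring_nf
    · simp
  -- A letter does not contract with itself, so the diagonal factors `T(1)` of the half product are
  -- missing from the correlator; the normalisation `T(1)^K` supplies exactly these `K` factors. In
  -- `e2` the diagonal is empty because `0 ≠ -1` modulo `N`.
  have e3 : halfOne (ratioT' q t) q k K (0 : ZMod N) l l 1 = ratioT q t 1 ^ K *
      ((∏ a ∈ range K, ∏ b ∈ range a,
        if (a : ZMod N) - b = 0 then ratioT q t (ratioArg q k l l 1 a b) else 1) *
      ∏ a ∈ range K, ∏ b ∈ range (a + 1), if ((a + 1 : ℕ) : ZMod N) - b = 1 then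
        (ratioT q t (k * ratioArg q k l l 1 (a + 1) b))⁻¹ else 1) := by
    have hc : ratioT q t 1 ^ K = ∏ _a ∈ range K, ratioT q t 1 := by simp
    rw [halfOne, hc, ← mul_assoc, ← Finset.prod_mul_distrib, ← Finset.prod_mul_distrib]
    refine Finset.prod_congr rfl fun a _ => ?_
    have h0 : (ratioT q t 1 * ∏ b ∈ range a,
        if (a : ZMod N) - b = 0 then ratioT q t (ratioArg q k l l 1 a b) else 1) =
        ∏ b ∈ range (a + 1),
          if (a : ZMod N) - b = 0 then ratioT q t (ratioArg q k l l 1 a b) else 1 := by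
      rw [Finset.prod_range_succ, sub_self, if_pos rfl, mul_comm]
      simp [ratioArg]
    rw [h0, ← Finset.prod_mul_distrib]
    refine Finset.prod_congr rfl fun b _ => ?_
    have h2 : ((((a + 1 : ℕ) : ZMod N)) - b = 1) = ((a : ZMod N) - b = 0) := by
      push_cast
      exact propext ⟨fun h => by linear_combination h, fun h => by linear_combination h⟩
    simp only [h2]
    split_ifs
    · rw [mul_ratioArg hk0, ratioArg, ratioT', ratioT', inv_inv, mul_comm]
      simp only [mul_inv, ← zpow_neg, inv_one]
      push_cast
      ring_nf
    · simp
  rw [e1, e2, e3]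
  simp only [leftFactor, rightFactor, Finset.prod_mul_distrib]
  ring

/-! ## Half products as Nekrasov factors -/

lemma halfOne_ratioR (hq0 : q ≠ 0) (hq : ‖q‖ < 1) (K : ℕ) (c : ZMod N) {l : ℕ → ℕ}
    (hl : Antitone l) (m : ℕ → ℕ) (u : ℂ)
    (h : ∀ (n : ℤ) (a b : ℕ), ratioR q t (u * q ^ n * k ^ ((b : ℤ) - a)) ≠ 0) :
    halfOne (ratioR q t) q k K c l m u = nekHalfOne q t k K c l m u := by
  refine Finset.prod_congr rfl fun b _ => Finset.prod_congr rfl fun a _ => ?_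
  split_ifs
  · have e : u * q ^ ((l b : ℤ) - m a) * k ^ ((b : ℤ) - a) =
        q ^ (l b - l (b + 1)) * (u * q ^ ((l (b + 1) : ℤ) - m a) * k ^ ((b : ℤ) - a)) := by
      have : (l b : ℤ) - m a = ((l b - l (b + 1) : ℕ) : ℤ) + (l (b + 1) - m a) := by
        have := hl b.le_succ; push_cast [Nat.cast_sub this]; ring
      rw [this, zpow_add₀ hq0, zpow_natCast]
      ring
    have h1 := h ((l b : ℤ) - m a) a b
    rw [e] at h1 ⊢
    exact ratioR_mul_inv hq h1
  · rfl

lemma halfTwo_ratioR (hq0 : q ≠ 0) (hq : ‖q‖ < 1) (K : ℕ) (c : ZMod N) (l : ℕ → ℕ) {m : ℕ → ℕ}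
    (hm : Antitone m) (u : ℂ)
    (h : ∀ (n : ℤ) (a b : ℕ), a ≤ b → ratioR q t (u * q ^ n * k ^ ((a : ℤ) - b - 1)) ≠ 0) :
    halfTwo (ratioR q t) q k K c l m u = nekHalfTwo q t k K c l m u := by
  refine Finset.prod_congr rfl fun b _ => Finset.prod_congr rfl fun a ha => ?_
  split_ifs
  · have e : u * q ^ ((l a : ℤ) - m (b + 1)) * k ^ ((a : ℤ) - b - 1) =
        q ^ (m b - m (b + 1)) * (u * q ^ ((l a : ℤ) - m b) * k ^ ((a : ℤ) - b - 1)) := by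
      have : (l a : ℤ) - m (b + 1) = ((m b - m (b + 1) : ℕ) : ℤ) + (l a - m b) := by
        have := hm b.le_succ; push_cast [Nat.cast_sub this]; ring
      rw [this, zpow_add₀ hq0, zpow_natCast]
      ring
    have h1 := h ((l a : ℤ) - m (b + 1)) a b (Nat.lt_succ_iff.1 (Finset.mem_range.1 ha))
    rw [e] at h1 ⊢
    exact ratioR_mul_inv hq h1
  · rfl

lemma prod_ite_mul {α : Type*} (s : Finset α) (p : α → Prop) [DecidablePred p] (f g : α → ℂ) :
    (∏ a ∈ s, if p a then f a * g a else 1) =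
      (∏ a ∈ s, if p a then f a else 1) * ∏ a ∈ s, if p a then g a else 1 := by
  rw [← Finset.prod_mul_distrib]
  refine Finset.prod_congr rfl fun a _ => ?_
  split_ifs <;> simp

lemma halfOne_ratioT (hq0 : q ≠ 0) (hk0 : k ≠ 0) (ht0 : t ≠ 0) (hq : ‖q‖ < 1) (K : ℕ)
    (c : ZMod N) {l : ℕ → ℕ} (hl : Antitone l) (hK : l K = 0) (m : ℕ → ℕ) {u : ℂ} (hu : u ≠ 0)
    (h : ∀ a b : ℕ, a ≤ b →
      ratioT q t (u * q ^ ((l (b + 1) : ℤ) - m a) * k ^ ((b : ℤ) - a))⁻¹ ≠ 0) :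
    halfOne (ratioT' q t) q k K c l m u =
      nekHalfOne q t k K c l m u * residueWeight t⁻¹ K c l := by
  rw [← prod_residue t⁻¹ K c hl hK, nekHalfOne, ← Finset.prod_mul_distrib]
  refine Finset.prod_congr rfl fun b _ => ?_
  rw [mul_comm, ← prod_ite_mul]
  refine Finset.prod_congr rfl fun a ha => ?_
  split_ifs
  · have e : u * q ^ ((l b : ℤ) - m a) * k ^ ((b : ℤ) - a) =
        q ^ (l b - l (b + 1)) * (u * q ^ ((l (b + 1) : ℤ) - m a) * k ^ ((b : ℤ) - a)) := by
      have : (l b : ℤ) - m a = ((l b - l (b + 1) : ℕ) : ℤ) + (l (b + 1) - m a) := by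
        have := hl b.le_succ; push_cast [Nat.cast_sub this]; ring
      rw [this, zpow_add₀ hq0, zpow_natCast]
      ring
    rw [e]
    exact ratioT_inv_mul hq hq0 ht0 (mul_ne_zero (mul_ne_zero hu (zpow_ne_zero _ hq0))
      (zpow_ne_zero _ hk0)) (h a b (Nat.lt_succ_iff.1 (Finset.mem_range.1 ha)))
  · rfl

lemma halfTwo_ratioT (hq0 : q ≠ 0) (hk0 : k ≠ 0) (ht0 : t ≠ 0) (hq : ‖q‖ < 1) (K : ℕ)
    (c : ZMod N) (l : ℕ → ℕ) {m : ℕ → ℕ} (hm : Antitone m) (hK : m K = 0) {u : ℂ} (hu : u ≠ 0)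
    (h : ∀ (n : ℤ) (a b : ℕ), ratioT q t (u * q ^ n * k ^ ((a : ℤ) - b - 1))⁻¹ ≠ 0) :
    halfTwo (ratioT' q t) q k K c l m u =
      nekHalfTwo q t k K c l m u * residueWeight t⁻¹ K (-c - 1) m := by
  rw [← prod_residue t⁻¹ K (-c - 1) hm hK, nekHalfTwo, ← Finset.prod_mul_distrib]
  refine Finset.prod_congr rfl fun b _ => ?_
  rw [mul_comm, ← prod_ite_mul]
  refine Finset.prod_congr rfl fun a ha => ?_
  split_ifs
  · have e : u * q ^ ((l a : ℤ) - m (b + 1)) * k ^ ((a : ℤ) - b - 1) =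
        q ^ (m b - m (b + 1)) * (u * q ^ ((l a : ℤ) - m b) * k ^ ((a : ℤ) - b - 1)) := by
      have : (l a : ℤ) - m (b + 1) = ((m b - m (b + 1) : ℕ) : ℤ) + (l a - m b) := by
        have := hm b.le_succ; push_cast [Nat.cast_sub this]; ring
      rw [this, zpow_add₀ hq0, zpow_natCast]
      ring
    rw [e]
    exact ratioT_inv_mul hq hq0 ht0 (mul_ne_zero (mul_ne_zero hu (zpow_ne_zero _ hq0))
      (zpow_ne_zero _ hk0)) (h _ a b)
  · rfl

/-- `v` does not lie in the group generated by `q`, `k` and `t`. -/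
def Generic₃ (q t k v : ℂ) : Prop := ∀ a b : ℤ, Generic q t (v * q ^ a * k ^ b)

/-- `q`, `k` and `t` are multiplicatively independent. -/
def MulIndep (q t k : ℂ) : Prop :=
  ∀ a b c : ℤ, q ^ a * k ^ b * t ^ c = 1 → a = 0 ∧ b = 0 ∧ c = 0

lemma MulIndep.generic (hq0 : q ≠ 0) (h : MulIndep q t k) (a : ℤ) {b : ℤ} (hb : b ≠ 0) :
    Generic q t (q ^ a * k ^ b) := fun a' c he =>
  hb (h (a' + a) b c (by rw [← he, zpow_add₀ hq0]; ring)).2.1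

/-- These arguments lie in the group generated by the parameters, so genericity does not apply. A
zero of the numerator would involve `t⁻¹`, and one of the denominator a strictly positive power of
`q`. -/
lemma MulIndep.ratioT_pow_ne_zero (hq0 : q ≠ 0) (hq : ‖q‖ < 1) (h : MulIndep q t k) (n : ℕ) :
    ratioT q t (q ^ n) ≠ 0 := by
  refine div_ne_zero (qPochInf_ne_zero hq fun m he => ?_) (qPochInf_ne_zero hq fun m he => ?_)
  · have := (h (m + 1 + n) 0 (-1) (by
      rw [← he, zpow_add₀ hq0, zpow_add₀ hq0]; simp [div_eq_mul_inv]; ring)).2.2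
    omega
  · have := (h (m + 1 + n) 0 0 (by
      rw [← he, zpow_add₀ hq0, zpow_add₀ hq0]; simp; ring)).1
    omega

/-- The contractions between two blocks. -/
lemma wordCross_block (hq0 : q ≠ 0) (hk0 : k ≠ 0) (ht0 : t ≠ 0) (hq : ‖q‖ < 1) (K : ℕ)
    (i j : ZMod N) {l m : ℕ → ℕ} (hla : Antitone l) (hma : Antitone m) (hl : l K = 0)
    (hm : m K = 0) {z w : ℂ} (hz : z ≠ 0) (hw : w ≠ 0) (h : Generic₃ q t k (w / z)) :
    wordCross q t k (block q k K i l z) (block q k K j m w) =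
      phiFactor q t k (j - i) (w / z) *
        (nekHalfOne q t k K (j - i) m l (w / z) * nekHalfTwo q t k K (j - i) m l (w / z)) *
        (nekHalfOne q t k K (i - j) l m (z / w) * nekHalfTwo q t k K (i - j) l m (z / w)) *
        (residueWeight t⁻¹ K (i - j) l * residueWeight t⁻¹ K (j - i - 1) m) := by
  have hu : z / w ≠ 0 := div_ne_zero hz hw
  have hT : ∀ a b : ℤ, ratioT q t (z / w * q ^ a * k ^ b)⁻¹ ≠ 0 := fun a b => by
    have := (h (-a) (-b)).ratioT_ne_zero hq0 ht0 hq
    rw [zpow_neg, zpow_neg, ← inv_div, ← mul_inv, ← mul_inv] at this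
    exact this
  rw [wordCross_block_eq hq0 hk0 K i j l m hl hm,
    halfOne_ratioR hq0 hq K _ hma l _ fun n a b => (h _ _).ratioR_ne_zero hq0 ht0 hq,
    halfTwo_ratioR hq0 hq K _ m hla _ fun n a b _ => (h _ _).ratioR_ne_zero hq0 ht0 hq,
    inv_div, halfOne_ratioT hq0 hk0 ht0 hq K _ hla hl m hu fun a b _ => hT _ _,
    halfTwo_ratioT hq0 hk0 ht0 hq K _ l hma hm hu fun n a b => hT _ _, neg_sub, neg_sub]
  ring

/-- The contractions within a block. -/
lemma wordCorr_block (hN : 2 ≤ N) (hq0 : q ≠ 0) (hk0 : k ≠ 0) (ht0 : t ≠ 0) (hq : ‖q‖ < 1)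
    (h : MulIndep q t k) (K : ℕ) (i : ZMod N) {l : ℕ → ℕ} (hla : Antitone l) (hl : l K = 0)
    {z : ℂ} (hz : z ≠ 0) :
    ratioT q t 1 ^ K * wordCorr q t k (block q k K i l z) =
      nekHalfOne q t k K (0 : ZMod N) l l 1 * nekHalfTwo q t k K (0 : ZMod N) l l 1 *
        residueWeight t⁻¹ K (0 : ZMod N) l := by
  rw [wordCorr_block_eq hN hq0 hk0 K i l hl hz,
    halfOne_ratioT hq0 hk0 ht0 hq K _ hla hl l one_ne_zero fun a b hab => ?_,
    halfTwo_ratioR hq0 hq K _ l hla 1 fun n a b hab => ?_]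
  · ring
  · rw [one_mul]
    exact (h.generic hq0 _ (by omega)).ratioR_ne_zero hq0 ht0 hq
  · rw [one_mul]
    -- On the diagonal the power of `k` disappears and the inverted argument is a nonnegative power
    -- of `q`; off the diagonal a nonzero power of `k` gives genericity.
    rcases hab.eq_or_lt with rfl | hab
    · have h1 := h.ratioT_pow_ne_zero hq0 hq (l a - l (a + 1))
      have e : ((q : ℂ) ^ ((l (a + 1) : ℤ) - l a) * k ^ ((a : ℤ) - a))⁻¹ =
          q ^ (l a - l (a + 1)) := by
        rw [sub_self, zpow_zero, mul_one, ← zpow_neg, ← zpow_natCast,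
          Nat.cast_sub (hla a.le_succ), neg_sub]
      rwa [e]
    · exact (h.generic hq0 _ (by omega)).inv.ratioT_ne_zero hq0 ht0 hq

end Blocks

end

end AffineScreening

namespace AffineScreening

noncomputable section

set_option linter.unusedSectionVars false

open Finset (range)

section Truncation

variable {N : ℕ} [NeZero N] {q t k : ℂ}

/-! ## Independence of the number of screening currents -/

/-- A zero part places its screening current next to the `φ` in exactly the position where the two
letters fuse. -/
lemma block_succ {K : ℕ} (i : ZMod N) {l : ℕ → ℕ} (hl : l K = 0) (z : ℂ) :
    block q k (K + 1) i l z = (.phi (i - K - 1), k * (k ^ (K + 1) * z)) ::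
      (.scr (i - K), k ^ (K + 1) * z) :: screens q k K i l z := by
  have e1 : i - ((K + 1 : ℕ) : ZMod N) = i - K - 1 := by push_cast; ring
  have e2 : k ^ (K + 1 + 1) * z = k * (k ^ (K + 1) * z) := by ring
  rw [block, screens_succ, hl, e1, e2, pow_zero, mul_one]

lemma div_pow_mul (y z : ℂ) (n : ℕ) :
    y / (k ^ n * z) = y / z * k ^ (-(n : ℤ)) := by
  rw [zpow_neg, zpow_natCast, mul_comm, div_mul_eq_div_div, div_eq_mul_inv]

lemma inv_mul_div_pow_mul (hk0 : k ≠ 0) (y z : ℂ) (n : ℕ) :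
    k⁻¹ * (y / (k ^ n * z)) = y / z * k ^ (-(n : ℤ) - 1) := by
  rw [div_pow_mul, zpow_sub_one₀ hk0]; ring

lemma wordCross_block_left (hN : 2 ≤ N) (hk0 : k ≠ 0) (hq0 : q ≠ 0) (ht0 : t ≠ 0)
    (hq : ‖q‖ < 1) (hκ : ‖k ^ N‖ < 1) (W : VWord N) {L K : ℕ} (hLK : L ≤ K) (i : ZMod N)
    {l : ℕ → ℕ} (hl : ∀ a, L ≤ a → l a = 0) (z : ℂ)
    (h : ∀ y ∈ W, ∀ b : ℤ, Generic q t (y.2 / z * k ^ b)) :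
    wordCross q t k (block q k L i l z) W = wordCross q t k (block q k K i l z) W := by
  induction K, hLK using Nat.le_induction with
  | base => rfl
  | succ K hK ih =>
    rw [ih, block_succ i (hl K hK), wordCross_fuse_left hN hk0 hq0 ht0 hq hκ]
    · rfl
    · intro y hy
      rw [inv_mul_div_pow_mul hk0, div_pow_mul]
      exact ⟨h y hy _, h y hy _⟩

lemma wordCross_block_right (hN : 2 ≤ N) (hk0 : k ≠ 0) (hq0 : q ≠ 0) (ht0 : t ≠ 0)
    (hq : ‖q‖ < 1) (hκ : ‖k ^ N‖ < 1) (W : VWord N) {L K : ℕ} (hLK : L ≤ K) (i : ZMod N)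
    {l : ℕ → ℕ} (hl : ∀ a, L ≤ a → l a = 0) (z : ℂ)
    (h : ∀ x ∈ W, ∀ b : ℤ, Generic q t (z / x.2 * k ^ b)) :
    wordCross q t k W (block q k L i l z) = wordCross q t k W (block q k K i l z) := by
  induction K, hLK using Nat.le_induction with
  | base => rfl
  | succ K hK ih =>
    rw [ih, block_succ i (hl K hK), wordCross_fuse_right hN hk0 hq0 ht0 hq hκ]
    · rfl
    · intro x hx
      have e1 : k ^ (K + 1) * z / x.2 = z / x.2 * k ^ ((K + 1 : ℕ) : ℤ) := by
        rw [zpow_natCast]; ring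
      have e2 : k * (k ^ (K + 1) * z) / x.2 = z / x.2 * k ^ ((K + 2 : ℕ) : ℤ) := by
        rw [zpow_natCast]; ring
      rw [e1, e2]
      exact ⟨h x hx _, h x hx _⟩

/-- Each zero part costs one factor `T(1)⁻¹`, which the additional power of `T(1)` restores; so the
normalised correlator does not depend on the padding. -/
lemma wordCorr_block_truncate (hN : 2 ≤ N) (hk0 : k ≠ 0) (hq0 : q ≠ 0) (ht0 : t ≠ 0)
    (hq : ‖q‖ < 1) (hκ : ‖k ^ N‖ < 1) (hind : MulIndep q t k) {L K : ℕ} (hLK : L ≤ K)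
    (i : ZMod N) {l : ℕ → ℕ} (hl : ∀ a, L ≤ a → l a = 0) {z : ℂ} (hz : z ≠ 0) :
    ratioT q t 1 ^ L * wordCorr q t k (block q k L i l z) =
      ratioT q t 1 ^ K * wordCorr q t k (block q k K i l z) := by
  induction K, hLK using Nat.le_induction with
  | base => rfl
  | succ K hK ih =>
    have hT : ratioT q t 1 ≠ 0 := by simpa using hind.ratioT_pow_ne_zero hq0 hq 0
    rw [ih, block_succ i (hl K hK), pow_succ, mul_assoc, wordCorr_fuse hN hk0 hq0 ht0 hq hκ _ _
      (mul_ne_zero (pow_ne_zero _ hk0) hz) _ hT]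
    · rfl
    · intro y hy
      obtain ⟨a, ha, rfl⟩ := mem_screens.1 hy
      have e : k ^ (a + 1) * q ^ l a * z / z = q ^ (l a : ℤ) * k ^ ((a + 1 : ℕ) : ℤ) := by
        rw [mul_div_cancel_right₀ _ hz, zpow_natCast, zpow_natCast, mul_comm]
      rw [inv_mul_div_pow_mul hk0, div_pow_mul, e, mul_assoc, mul_assoc, ← zpow_add₀ hk0,
        ← zpow_add₀ hk0]
      exact ⟨hind.generic hq0 _ (by push_cast; omega), hind.generic hq0 _ (by push_cast; omega)⟩

/-! ## Letters at generic points -/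

lemma mem_block {K : ℕ} {i : ZMod N} {l : ℕ → ℕ} {z : ℂ} {x : VLabel N × ℂ}
    (hx : x ∈ block q k K i l z) : ∃ a b : ℤ, x.2 = q ^ a * k ^ b * z := by
  rw [block, List.mem_cons, mem_screens] at hx
  rcases hx with rfl | ⟨a, _, rfl⟩
  · exact ⟨0, (K + 1 : ℕ), by rw [zpow_zero, zpow_natCast, one_mul]⟩
  · exact ⟨l a, (a + 1 : ℕ), by rw [zpow_natCast, zpow_natCast]; ring⟩

lemma Generic₃.div_right (hk0 : k ≠ 0) {z w : ℂ} (h : Generic₃ q t k (w / z)) {K : ℕ}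
    {i : ZMod N} {m : ℕ → ℕ} {y : VLabel N × ℂ} (hy : y ∈ block q k K i m w) (b : ℤ) :
    Generic q t (y.2 / z * k ^ b) := by
  obtain ⟨c, d, hcd⟩ := mem_block hy
  convert h c (d + b) using 1
  rw [hcd, zpow_add₀ hk0]
  ring

lemma Generic₃.div_left (hk0 : k ≠ 0) {z w : ℂ} (h : Generic₃ q t k (w / z)) {K : ℕ}
    {i : ZMod N} {l : ℕ → ℕ} {x : VLabel N × ℂ} (hx : x ∈ block q k K i l z) (b : ℤ) :
    Generic q t (w / x.2 * k ^ b) := by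
  obtain ⟨c, d, hcd⟩ := mem_block hx
  convert h (-c) (-d + b) using 1
  rw [hcd, zpow_add₀ hk0, zpow_neg, zpow_neg, div_mul_eq_div_div_swap]
  simp only [div_eq_mul_inv, mul_inv]
  ring

lemma Generic₃.div_letters (hq0 : q ≠ 0) (hk0 : k ≠ 0) {z w : ℂ} (h : Generic₃ q t k (w / z))
    {K K' : ℕ} {i j : ZMod N} {l m : ℕ → ℕ} {x y : VLabel N × ℂ} (hx : x ∈ block q k K i l z)
    (hy : y ∈ block q k K' j m w) : Generic₃ q t k (y.2 / x.2) := by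
  obtain ⟨c, d, hcd⟩ := mem_block hx
  obtain ⟨c', d', hcd'⟩ := mem_block hy
  intro a b
  convert h (c' - c + a) (d' - d + b) using 1
  rw [hcd, hcd', zpow_add₀ hk0, zpow_add₀ hq0, zpow_sub₀ hk0, zpow_sub₀ hq0]
  simp only [div_eq_mul_inv, mul_inv]
  ring

lemma Generic₃.contrDen_ne_zero (hq0 : q ≠ 0) (ht0 : t ≠ 0) (hq : ‖q‖ < 1)
    (hκ : ‖k ^ N‖ < 1) {u : ℂ} (h : Generic₃ q t k u) (V V' : VLabel N) :
    V.contrDen q t k V' u ≠ 0 := by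
  have h0 : Generic q t u := by simpa using h 0 0
  have h1 : Generic q t (k * u) := by simpa [mul_comm] using h 0 1
  have h2 : Generic q t (k⁻¹ * u) := by simpa [mul_comm] using h 0 (-1)
  have hP : ∀ (n : ℕ) (c d : ℤ), qPochInf₂ (q ^ c * t ^ d * (k ^ n * u)) q (k ^ N) ≠ 0 := by
    intro n c d
    refine qPochInf₂_ne_zero hq hκ fun a b he => h 0 ((N * b + n : ℕ) : ℤ) (a + c) d ?_
    rw [← he, zpow_add₀ hq0, zpow_natCast, zpow_natCast, zpow_zero, pow_add, pow_mul]
    ring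
  have hl : ∀ d : ZMod N, leftDen q k d u ≠ 0 := fun d => by
    have e1 := (h0.mul_q hq0 ht0).qPochInf_ne_zero hq
    have e2 := h2.qPochInf_ne_zero hq
    rw [leftDen]
    split_ifs <;> simp [e1, e2]
  have hr : ∀ d : ZMod N, rightDen q t k d u ≠ 0 := fun d => by
    have e1 := (h0.mul_t hq0 ht0).qPochInf_ne_zero hq
    have e2 := (h1.mul_q_div_t hq0 ht0).qPochInf_ne_zero hq
    rw [rightDen]
    split_ifs <;> simp [e1, e2]
  have hp : ∀ d : ZMod N, phiDen q t k d u ≠ 0 := fun d => by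
    have e1 : t * k ^ d.val * u = q ^ (0 : ℤ) * t ^ (1 : ℤ) * (k ^ d.val * u) := by simp; ring
    have e2 : shiftUp k d * (q / t) * u =
        q ^ (1 : ℤ) * t ^ (-1 : ℤ) * (k ^ (if d = 0 then N else d.val) * u) := by
      rw [shiftUp]
      split_ifs <;> simp [div_eq_mul_inv] <;> ring
    rw [phiDen, e1, e2]
    exact mul_ne_zero (hP _ _ _) (hP _ _ _)
  rcases V with i | i <;> rcases V' with j | j
  exacts [hp _, hr _, hl _, mul_ne_zero (hl _) (hr _)]

lemma MulIndep.block_pairwise (hq0 : q ≠ 0) (hk0 : k ≠ 0) (ht0 : t ≠ 0) (hq : ‖q‖ < 1)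
    (h : MulIndep q t k) (K : ℕ) (i : ZMod N) {l : ℕ → ℕ} (hl : l K = 0) {z : ℂ} (hz : z ≠ 0) :
    (block q k K i l z).Pairwise fun x y => x.1.contrDen q t k y.1 (y.2 / x.2) ≠ 0 := by
  have hu : ∀ a b : ℕ, k ^ (b + 1) * q ^ l b * z / (k ^ (a + 1) * q ^ l a * z) =
      q ^ ((l b : ℤ) - l a) * k ^ ((b : ℤ) - a) := fun a b => by
    rw [letter_ratio hq0 hk0, div_self hz, ratioArg, one_mul]
  have hL : ∀ (d : ZMod N) (c b : ℤ), b < 0 → leftDen q k d (q ^ c * k ^ b) ≠ 0 := by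
    intro d c b hb
    have e1 := ((h.generic hq0 c hb.ne).mul_q hq0 ht0).qPochInf_ne_zero hq
    have e2 := (h.generic (b := b - 1) hq0 c (by omega)).qPochInf_ne_zero hq
    have e3 : k⁻¹ * (q ^ c * k ^ b) = q ^ c * k ^ (b - 1) := by rw [zpow_sub_one₀ hk0]; ring
    rw [leftDen, e3]
    split_ifs <;> simp [e1, e2]
  have hR : ∀ (d : ZMod N) (c b : ℤ), b < 0 → rightDen q t k d (q ^ c * k ^ b) ≠ 0 := by
    intro d c b hb
    have e1 := ((h.generic hq0 c hb.ne).mul_t hq0 ht0).qPochInf_ne_zero hq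
    -- For neighbouring letters the power of `k` cancels here, so independence of `k` does not help;
    -- the factor `t⁻¹` is what excludes a zero.
    have e2 : qPochInf (q / t * (k * (q ^ c * k ^ b))) q ≠ 0 := by
      refine qPochInf_ne_zero hq fun n he => ?_
      have := (h (n + 1 + c) (b + 1) (-1) (by
        rw [← he, zpow_add₀ hq0, zpow_add₀ hq0, zpow_add₀ hk0]
        simp [div_eq_mul_inv]
        ring)).2.2
      omega
    rw [rightDen]
    split_ifs <;> simp [e1, e2]
  rw [block, List.pairwise_cons]
  refine ⟨fun y hy => ?_, ?_⟩
  · obtain ⟨b, hb, rfl⟩ := mem_screens.1 hy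
    have e : k ^ (K + 1) * z = k ^ (K + 1) * q ^ l K * z := by rw [hl]; ring
    simp only [e, hu]
    exact hR _ _ _ (by omega)
  · rw [screens, List.pairwise_map, List.pairwise_reverse]
    refine List.pairwise_lt_range.imp fun {b a} hab => ?_
    simp only [hu]
    exact mul_ne_zero (hL _ _ _ (by omega)) (hR _ _ _ (by omega))

end Truncation

end

end AffineScreening

namespace AffineScreening

noncomputable section

set_option linter.unusedSectionVars false

open Finset (range)

section Evaluation

variable {N : ℕ} [NeZero N] {q t k : ℂ}

/-! ## Powers of `t` -/

lemma prod_ite_cast_eq (s : Finset ℕ) (hs : s ⊆ range N) (c : ZMod N) (x : ℂ) :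
    (∏ j ∈ s, if (j : ZMod N) = c then x else 1) = if c.val ∈ s then x else 1 := by
  rw [← Finset.prod_ite_eq' s c.val fun _ => x]
  refine Finset.prod_congr rfl fun j hj => ?_
  have hj' := Finset.mem_range.1 (hs hj)
  have : ((j : ZMod N) = c) = (j = c.val) := propext
    ⟨fun h => by rw [← h, ZMod.val_cast_of_lt hj'], fun h => by rw [h, ZMod.natCast_zmod_val]⟩
  simp only [this]

/-- The representative of `-e` in `{1,…,N}` is `N - e.val`, also for `e = 0`. -/
lemma omegaVec_neg {i : ℕ} (hi : i < N) (e : ZMod N) :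
    omegaVec N (N - i) (-e) = if e.val < i then 1 else 0 := by
  have h1 : (if (-e).val = 0 then N else (-e).val) = N - e.val := by
    rw [ZMod.neg_val]
    have := e.val_lt
    by_cases h : e = 0
    · simp [h]
    · have : e.val ≠ 0 := fun h0 => h ((ZMod.val_eq_zero e).1 h0)
      rw [if_neg h, if_neg (by omega)]
  have := e.val_lt
  rw [omegaVec, h1]
  split_ifs <;> omega

/-- The powers of `t` from all contractions combine with the shifts of the variables. -/
lemma prod_weights_mul_shiftFactor (hN : 2 ≤ N) (ht0 : t ≠ 0) {i : ℕ} (hi : i < N)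
    (r : ZMod N) :
    (if r = 0 then t⁻¹ else 1) * (∏ j ∈ Finset.Ioo i N, if r = i - j then t⁻¹ else 1) *
      (∏ j ∈ range i, if r = i - j - 1 then t⁻¹ else 1) * shiftFactor N t (N - i) (-i + r) =
      t⁻¹ := by
  have hf : Fact (1 < N) := ⟨hN⟩
  obtain ⟨e, rfl⟩ : ∃ e : ZMod N, r = i - e := ⟨i - r, by ring⟩
  have h0 : ((i : ZMod N) - e = 0) = (e.val = i) := propext
    ⟨fun h => by rw [← sub_eq_zero.1 h, ZMod.val_cast_of_lt hi],
      fun h => by rw [← h, ZMod.natCast_zmod_val, sub_self]⟩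
  have h1 : ∀ j : ℕ, ((i : ZMod N) - e = i - j) = ((j : ZMod N) = e) := fun j => propext
    ⟨fun h => by linear_combination h, fun h => by linear_combination h⟩
  have h2 : ∀ j : ℕ, ((i : ZMod N) - e = i - j - 1) = ((j : ZMod N) = e - 1) := fun j => propext
    ⟨fun h => by linear_combination h, fun h => by linear_combination h⟩
  have h3 : -(i : ZMod N) + (i - e) = -e := by ring
  have h4 : -e + 1 = -(e - 1) := by ring
  simp only [h0, h1, h2]
  rw [prod_ite_cast_eq (Finset.Ioo i N) (fun j hj => by simp at hj ⊢; omega),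
    prod_ite_cast_eq (range i) (fun j hj => by simp at hj ⊢; omega), shiftFactor, h3, h4,
    omegaVec_neg hi, omegaVec_neg hi]
  have h5 := e.val_lt
  simp only [Finset.mem_Ioo, Finset.mem_range, h5, and_true]
  -- With `r = i - e`, and representatives in `{0,…,N-1}`, the exponent of `t` is `-[e = i] - [e >
  -- i] - [e-1 < i] + [e-1 < i] - [e < i]`. The middle terms cancel, and exactly one of the other
  -- three conditions holds.
  by_cases ha : (e - 1).val < i <;> rcases lt_trichotomy e.val i with hb | hb | hb <;>
    simp [ha, hb, not_lt_of_gt, ne_of_lt, ne_of_gt, ht0]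

lemma residueWeight_eq (τ : ℂ) (K : ℕ) (c : ZMod N) (l : ℕ → ℕ) :
    residueWeight τ K c l = ∏ a ∈ range K, (if (a : ZMod N) = c then τ else 1) ^ l a := by
  refine Finset.prod_congr rfl fun a _ => ?_
  split_ifs <;> simp

lemma Part.prod_eq_prod_range (l : Part) {K : ℕ} (hK : l.length ≤ K) (f : ℕ → ℂ) :
    (l.1.prod fun a r => f a ^ r) = ∏ a ∈ range K, f a ^ l.1 a := by
  rw [Finsupp.prod, l.support_eq_range]
  refine Finset.prod_subset (Finset.range_subset_range.2 hK) fun a _ ha => ?_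
  rw [l.apply_eq_zero (by simpa using ha), pow_zero]

lemma residueWeights_mul_shift (hN : 2 ≤ N) (ht0 : t ≠ 0) {i : ℕ} (hi : i < N) (l : Part)
    {K : ℕ} (hK : l.length ≤ K) :
    residueWeight t⁻¹ K (0 : ZMod N) l.1 *
      (∏ j ∈ Finset.Ioo i N, residueWeight t⁻¹ K ((i : ZMod N) - (j : ZMod N)) l.1) *
      (∏ j ∈ range i, residueWeight t⁻¹ K ((i : ZMod N) - (j : ZMod N) - 1) l.1) *
      (l.1.prod fun a r => shiftFactor N t (N - i) (-(i : ZMod N) + a) ^ r) =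
      l.1.prod fun _ r => (1 / t) ^ r := by
  rw [l.prod_eq_prod_range hK, l.prod_eq_prod_range hK]
  simp only [residueWeight_eq]
  rw [Finset.prod_comm, Finset.prod_comm (s := range i), ← Finset.prod_mul_distrib,
    ← Finset.prod_mul_distrib, ← Finset.prod_mul_distrib]
  refine Finset.prod_congr rfl fun a _ => ?_
  rw [Finset.prod_pow, Finset.prod_pow, ← mul_pow, ← mul_pow, ← mul_pow,
    prod_weights_mul_shiftFactor hN ht0 hi, one_div]

/-! ## Rearranging products over pairs -/

lemma prod_square {M : Type*} [CommMonoid M] (G : ℕ → ℕ → M) (n : ℕ) :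
    (∏ i ∈ range n, G i i) * ∏ j ∈ range n, ∏ i ∈ range j, G j i * G i j =
      ∏ i ∈ range n, ∏ j ∈ range n, G i j := by
  induction n with
  | zero => simp
  | succ n ih =>
    simp only [Finset.prod_range_succ, Finset.prod_mul_distrib] at ih ⊢
    rw [← ih]
    simp only [mul_assoc, mul_comm, mul_left_comm]

lemma prod_triangle {M : Type*} [CommMonoid M] (A : ℕ → ℕ → M) (n : ℕ) :
    ∏ j ∈ range n, ∏ i ∈ range j, A i j = ∏ i ∈ range n, ∏ j ∈ Finset.Ioo i n, A i j := by
  refine Finset.prod_comm' fun j i => ?_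
  simp only [Finset.mem_range, Finset.mem_Ioo]
  omega

lemma prod_zmod {M : Type*} [CommMonoid M] (f : ZMod N → M) :
    ∏ i : ZMod N, f i = ∏ i ∈ range N, f (i : ZMod N) := by
  refine (Finset.prod_bij' (fun i _ => ((i : ℕ) : ZMod N)) (fun i _ => i.val) ?_ ?_ ?_ ?_ ?_).symm
  · simp
  · intro i _; simpa using i.val_lt
  · intro i hi; exact ZMod.val_cast_of_lt (Finset.mem_range.1 hi)
  · intro i _; exact ZMod.natCast_zmod_val i
  · intro i _; rfl

lemma prod_zmod_prod_zmod {M : Type*} [CommMonoid M] (f : ZMod N → ZMod N → M) :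
    ∏ i : ZMod N, ∏ j : ZMod N, f i j = ∏ i ∈ range N, ∏ j ∈ range N, f i j := by
  rw [prod_zmod]
  exact Finset.prod_congr rfl fun i _ => prod_zmod _

/-! ## Vacuum matrix elements of products of screened vertex operators -/

/-- The assumptions on the spectral parameters. -/
def GenericPoints (q t k : ℂ) (s : ZMod N → ℂ) : Prop :=
  ∀ i j : ZMod N, i ≠ j → Generic₃ q t k (s j / s i)

lemma natCast_ne_natCast {i j : ℕ} (hi : i < N) (hj : j < N) (h : i ≠ j) :
    (i : ZMod N) ≠ j := fun he => h (by
  rw [← ZMod.val_cast_of_lt hi, he, ZMod.val_cast_of_lt hj])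

lemma GenericPoints.succ {s : ZMod N → ℂ} (h : GenericPoints q t k s) {i j : ℕ} (hi : i < N)
    (hj : j < N) (hij : i ≠ j) : Generic₃ q t k (s (j + 1) / s (i + 1)) :=
  h _ _ fun he => natCast_ne_natCast hi hj hij (add_right_cancel he)

/-- No contraction has a vanishing denominator: within a block by independence of the parameters and
the ordering of the letters, between blocks by genericity of the `s_j / s_i`. -/
lemma vev_screenedWord (hN : 2 ≤ N) (hq0 : q ≠ 0) (hk0 : k ≠ 0) (ht0 : t ≠ 0) (hq : ‖q‖ < 1)
    (hκ : ‖k ^ N‖ < 1) (hind : MulIndep q t k) {s : ZMod N → ℂ} (hs0 : ∀ i, s i ≠ 0)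
    (hs : GenericPoints q t k s) (L : ZMod N → Part) :
    (∃! c, (screenedWord N q k s L).IsVev q t k c) ∧ (screenedWord N q k s L).vev q t k =
      wordCorr q t k (screenedWord N q k s L) := by
  refine vev_eq_wordCorr hN hk0 ht0 hq hκ _ (fun x hx => ?_) ?_
  · obtain ⟨i, _, hx⟩ := List.mem_flatMap.1 hx
    rw [phiWord_eq_block] at hx
    obtain ⟨a, b, h⟩ := mem_block hx
    rw [h]
    exact mul_ne_zero (mul_ne_zero (zpow_ne_zero _ hq0) (zpow_ne_zero _ hk0)) (hs0 _)
  · rw [screenedWord, List.pairwise_flatMap]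
    refine ⟨fun i _ => ?_, ?_⟩
    · rw [phiWord_eq_block]
      exact hind.block_pairwise hq0 hk0 ht0 hq _ _ ((L i).apply_eq_zero le_rfl) (hs0 _)
    · refine List.pairwise_iff_getElem.2 fun i j hi hj hij x hx y hy => ?_
      rw [List.getElem_range, phiWord_eq_block] at hx hy
      rw [List.length_range] at hi hj
      exact ((hs.succ hi hj hij.ne).div_letters hq0 hk0 hx hy).contrDen_ne_zero hq0 ht0 hq hκ _ _

/-- A quotient of Nekrasov factors. -/
def nekrasovQuot (q t k : ℂ) (c : ZMod N) (l m : Part) (u : ℂ) : ℂ :=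
  nekrasov N c l m (t * u) q k / nekrasov N c l m u q k

/-- All blocks are padded to the common number `K`. Contractions between blocks are insensitive to
this, those within blocks absorb it into powers of `T(1)`, and the evaluation for padded blocks
applies. -/
lemma norm_wordCorr_screenedWord (hN : 2 ≤ N) (hq0 : q ≠ 0) (hk0 : k ≠ 0) (ht0 : t ≠ 0)
    (hq : ‖q‖ < 1) (hκ : ‖k ^ N‖ < 1) (hind : MulIndep q t k) {s : ZMod N → ℂ}
    (hs0 : ∀ i, s i ≠ 0) (hs : GenericPoints q t k s) (L : ZMod N → Part) {K : ℕ}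
    (hK : ∀ i, (L i).length ≤ K) :
    (∏ i : ZMod N, ratioT q t 1 ^ (L i).length) * wordCorr q t k (screenedWord N q k s L) =
      (∏ i ∈ range N, nekrasovQuot q t k (0 : ZMod N) (L i) (L i) 1 *
        residueWeight t⁻¹ K (0 : ZMod N) (L i).1) *
      ∏ j ∈ range N, ∏ i ∈ range j,
        phiFactor q t k ((j : ZMod N) - (i : ZMod N)) (s (j + 1) / s (i + 1)) *
        nekrasovQuot q t k ((j : ZMod N) - (i : ZMod N)) (L j) (L i) (s (j + 1) / s (i + 1)) *
        nekrasovQuot q t k ((i : ZMod N) - (j : ZMod N)) (L i) (L j) (s (i + 1) / s (j + 1)) *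
        (residueWeight t⁻¹ K ((i : ZMod N) - (j : ZMod N)) (L i).1 *
          residueWeight t⁻¹ K ((j : ZMod N) - (i : ZMod N) - 1) (L j).1) := by
  have hzero : ∀ (i : ZMod N) (a : ℕ), (L i).length ≤ a → (L i).1 a = 0 := fun i a =>
    (L i).apply_eq_zero
  rw [screenedWord, wordCorr_flatMap_range, prod_zmod, ← mul_assoc, ← Finset.prod_mul_distrib]
  congr 1
  · refine Finset.prod_congr rfl fun i _ => ?_
    rw [phiWord_eq_block, wordCorr_block_truncate hN hk0 hq0 ht0 hq hκ hind (hK i) _ (hzero i)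
      (hs0 _), wordCorr_block hN hq0 hk0 ht0 hq hind K _ (L i).2 (hzero i K (hK i)) (hs0 _),
      nekrasovQuot, nekrasov_div _ _ _ _ (hK i) (hK i)]
  · refine Finset.prod_congr rfl fun j hj => Finset.prod_congr rfl fun i hi => ?_
    have hj' := Finset.mem_range.1 hj
    have hi' := Finset.mem_range.1 hi
    have hg := hs.succ (hi'.trans hj') hj' hi'.ne
    rw [phiWord_eq_block, phiWord_eq_block,
      wordCross_block_left hN hk0 hq0 ht0 hq hκ _ (hK i) _ (hzero i) _
        fun y hy b => hg.div_right hk0 hy b,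
      wordCross_block_right hN hk0 hq0 ht0 hq hκ _ (hK j) _ (hzero j) _
        fun x hx b => hg.div_left hk0 hx b,
      wordCross_block hq0 hk0 ht0 hq K _ _ (L i).2 (L j).2 (hzero i K (hK i))
        (hzero j K (hK j)) (hs0 _) (hs0 _) hg,
      nekrasovQuot, nekrasovQuot, nekrasov_div _ _ _ _ (hK i) (hK j),
      nekrasov_div _ _ _ _ (hK j) (hK i)]

/-- The contribution of a tuple of partitions to the matrix element. -/
lemma screened_summand (hN : 2 ≤ N) (hq0 : q ≠ 0) (hk0 : k ≠ 0) (ht0 : t ≠ 0)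
    (hq : ‖q‖ < 1) (hκ : ‖k ^ N‖ < 1) (hind : MulIndep q t k) {s : ZMod N → ℂ}
    (hs0 : ∀ i, s i ≠ 0) (hs : GenericPoints q t k s) (L : ZMod N → Part) :
    (∏ i : ZMod N, ratioT q t 1 ^ (L i).length) * wordCorr q t k (screenedWord N q k s L) *
      (∏ i : ZMod N, (L i).1.prod fun a r =>
        shiftFactor N t (N - i.val) (-i + (a : ZMod N)) ^ r) =
    (∏ j ∈ range N, ∏ i ∈ range j,
      phiFactor q t k ((j : ZMod N) - (i : ZMod N)) (s (j + 1) / s (i + 1))) *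
    ((∏ i : ZMod N, ∏ j : ZMod N,
      nekrasovQuot q t k (i - j) (L i) (L j) (s (i + 1) / s (j + 1))) *
      ∏ i : ZMod N, (L i).1.prod fun _ r => (1 / t) ^ r) := by
  obtain ⟨K, hK⟩ : ∃ K, ∀ i, (L i).length ≤ K :=
    ⟨Finset.univ.sup fun i => (L i).length, fun i => Finset.le_sup (f := fun i => (L i).length) (Finset.mem_univ i)⟩
  -- The weights are sorted by the partition they belong to: partition `i` receives one from its own
  -- block, one from each later block and one from each earlier block.
  have hw : (∏ i ∈ range N, residueWeight t⁻¹ K (0 : ZMod N) (L i).1) *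
      (∏ j ∈ range N, ∏ i ∈ range j, residueWeight t⁻¹ K ((i : ZMod N) - (j : ZMod N)) (L i).1) *
      (∏ j ∈ range N, ∏ i ∈ range j, residueWeight t⁻¹ K ((j : ZMod N) - (i : ZMod N) - 1) (L j).1) *
      ∏ i : ZMod N, (L i).1.prod (fun a r =>
        shiftFactor N t (N - i.val) (-i + (a : ZMod N)) ^ r) =
      ∏ i : ZMod N, (L i).1.prod fun _ r => (1 / t) ^ r := by
    rw [prod_triangle fun i j => residueWeight t⁻¹ K ((i : ZMod N) - (j : ZMod N)) (L i).1, prod_zmod,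
      prod_zmod, ← Finset.prod_mul_distrib, ← Finset.prod_mul_distrib,
      ← Finset.prod_mul_distrib]
    refine Finset.prod_congr rfl fun i hi => ?_
    have hi' := Finset.mem_range.1 hi
    rw [ZMod.val_cast_of_lt hi', residueWeights_mul_shift hN ht0 hi' _ (hK i)]
  have hn := prod_square (fun i j : ℕ => nekrasovQuot q t k ((i : ZMod N) - (j : ZMod N)) (L i) (L j)
    (s (i + 1) / s (j + 1))) N
  simp only [sub_self, div_self (hs0 _)] at hn
  rw [norm_wordCorr_screenedWord hN hq0 hk0 ht0 hq hκ hind hs0 hs L hK, ← hw,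
    prod_zmod_prod_zmod fun i j => nekrasovQuot q t k (i - j) (L i) (L j)
      (s (i + 1) / s (j + 1)), ← hn]
  simp only [Finset.prod_mul_distrib]
  ring

/-- The prefactor. -/
lemma prod_phiFactor (s : ZMod N → ℂ) :
    ∏ j ∈ range N, ∏ i ∈ range j,
      phiFactor q t k ((j : ZMod N) - (i : ZMod N)) (s (j + 1) / s (i + 1)) =
    ∏ j ∈ Finset.Icc (1 : ℕ) N, ∏ i ∈ Finset.Ico (1 : ℕ) j,
      qPochInf₂ (k ^ (j - i) * s j / s i) q (k ^ N) /
        qPochInf₂ (k ^ (j - i) * t * s j / s i) q (k ^ N) *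
      (qPochInf₂ (k ^ (j - i) * q * s j / s i) q (k ^ N) /
        qPochInf₂ (k ^ (j - i) * q * s j / (t * s i)) q (k ^ N)) := by
  have hI : Finset.Icc 1 N = Finset.Ico (0 + 1) (N + 1) := by ext; simp
  rw [hI, ← Finset.prod_Ico_add', ← Finset.range_eq_Ico]
  refine Finset.prod_congr rfl fun j hj => ?_
  rw [show Finset.Ico 1 (j + 1) = Finset.Ico (0 + 1) (j + 1) from rfl, ← Finset.prod_Ico_add',
    ← Finset.range_eq_Ico]
  refine Finset.prod_congr rfl fun i hi => ?_
  have hj' := Finset.mem_range.1 hj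
  have hi' := Finset.mem_range.1 hi
  have hval : ((j : ZMod N) - i).val = j - i := by
    rw [← Nat.cast_sub hi'.le, ZMod.val_cast_of_lt (by omega)]
  have hne : (j : ZMod N) - i ≠ 0 :=
    sub_ne_zero.2 (natCast_ne_natCast hj' (hi'.trans hj') hi'.ne')
  rw [phiFactor, phiNum, phiDen, shiftUp, if_neg hne, hval, mul_div_mul_comm,
    Nat.add_sub_add_right]
  push_cast
  congr 3 <;> ring

end Evaluation

/-! ## Reindexing of the series -/

section Series

variable {N : ℕ} [NeZero N]

lemma exponent_comp_neg (L : ZMod N → Part) :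
    exponent (fun b => b) (fun b => L (-b)) = exponent (fun i => -i) L := by
  rw [exponent, exponent, ← Equiv.sum_comp (Equiv.neg (ZMod N))]
  simp

/-- Relabelling the partitions by `b ↦ -b` accounts for the reversed and inverted spectral
parameters, and for the descending indices of the variables in the operators. -/
lemma ruijsenaars_apply (s : ZMod N → ℂ) (k q t : ℂ) (d : ZMod N →₀ ℕ) :
    ruijsenaars N (fun j => (s (1 - j))⁻¹) k q t d =
      ∑ᶠ (L : ZMod N → Part) (_ : exponent (fun i => -i) L = d),
        (∏ i : ZMod N, ∏ j : ZMod N,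
          nekrasovQuot q t k (i - j) (L i) (L j) (s (i + 1) / s (j + 1))) *
        ∏ i : ZMod N, (L i).1.prod fun _ r => (1 / t) ^ r := by
  obtain ⟨e, he⟩ : ∃ e : (ZMod N → Part) ≃ (ZMod N → Part), ∀ L, e L = fun b => L (-b) :=
    ⟨⟨fun L b => L (-b), fun L b => L (-b), fun L => by simp, fun L => by simp⟩, fun L => rfl⟩
  rw [ruijsenaars]
  refine (finsum_comp_equiv e).symm.trans (finsum_congr fun L => ?_)
  rw [he, exponent_comp_neg L]
  refine congrArg finsum (funext fun _ => congrArg₂ (· * ·) ?_ ?_)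
  · rw [← Equiv.prod_comp (Equiv.neg (ZMod N))]
    refine Finset.prod_congr rfl fun i _ => ?_
    rw [← Equiv.prod_comp (Equiv.neg (ZMod N))]
    refine Finset.prod_congr rfl fun j _ => ?_
    have h1 : -j - -i = i - j := by ring
    have h2 : (s (1 - -j))⁻¹ / (s (1 - -i))⁻¹ = s (i + 1) / s (j + 1) := by
      rw [inv_div_inv, sub_neg_eq_add, sub_neg_eq_add, add_comm 1, add_comm 1]
    simp only [Equiv.neg_apply, neg_neg, h1, h2, nekrasovQuot]
  · rw [← Equiv.prod_comp (Equiv.neg (ZMod N))]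
    simp

end Series

end

end AffineScreening

/-! ### Comparison of coefficients. -/

open AffineScreening in
theorem theorem2 (N : ℕ) [NeZero N] (hN : 2 ≤ N) (q t κ k : ℂ) (s : ZMod N → ℂ)
    (hk : k ^ N = κ)
    (hq0 : q ≠ 0) (ht0 : t ≠ 0) (hκ0 : κ ≠ 0) (hs0 : ∀ i, s i ≠ 0)
    (hq1 : ‖q‖ < 1) (hκ1 : ‖κ‖ < 1)
    (hgen : ∀ a b c : ℤ, q ^ a * k ^ b * t ^ c = 1 → a = 0 ∧ b = 0 ∧ c = 0)
    (hsgen : ∀ i j : ZMod N, i ≠ j → ∀ a b c : ℤ, s i / s j ≠ q ^ a * k ^ b * t ^ c) :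
    (∀ L : ZMod N → Part, ∃! c : ℂ, (screenedWord N q k s L).IsVev q t k c) ∧
    screenedMatrixElement N q t k s =
      MvPowerSeries.C (σ := ZMod N)
        (∏ j ∈ Finset.Icc (1 : ℕ) N, ∏ i ∈ Finset.Ico (1 : ℕ) j,
          qPochInf₂ (k ^ (j - i) * s j / s i) q κ / qPochInf₂ (k ^ (j - i) * t * s j / s i) q κ *
          (qPochInf₂ (k ^ (j - i) * q * s j / s i) q κ /
            qPochInf₂ (k ^ (j - i) * q * s j / (t * s i)) q κ)) *
      ruijsenaars N (fun j => (s (1 - j))⁻¹) k q t := by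
  subst hk
  have hk0 : k ≠ 0 := fun h => hκ0 (by rw [h, zero_pow (NeZero.ne N)])
  have hs : GenericPoints q t k s := by
    intro i j hij a b a' c he
    refine hsgen j i hij.symm (-(a' + a)) (-b) (-c) ?_
    have h1 : q ^ (-(a' + a)) * k ^ (-b) * t ^ (-c) = (q ^ a' * t ^ c * (q ^ a * k ^ b))⁻¹ := by
      rw [zpow_neg, zpow_neg, zpow_neg, zpow_add₀ hq0]
      simp only [mul_inv]
      ring
    rw [h1]
    refine eq_inv_of_mul_eq_one_left ?_
    rw [← he]
    ring
  have hvev := vev_screenedWord hN hq0 hk0 ht0 hq1 hκ1 hgen hs0 hs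
  refine ⟨fun L => (hvev L).1, ?_⟩
  have hT : qPochInf (q / t) q / qPochInf q q = ratioT q t 1 := by
    rw [ratioT, mul_one, mul_one]
  ext d
  rw [MvPowerSeries.coeff_C_mul]
  change screenedMatrixElement N q t k s d = _ * ruijsenaars N (fun j => (s (1 - j))⁻¹) k q t d
  -- The prefactor passes through both finite sums without a finiteness argument, since `ℂ` has no
  -- zero divisors; this leaves an identity for each tuple of partitions.
  rw [ruijsenaars_apply, ← smul_eq_mul, smul_finsum, screenedMatrixElement]
  refine finsum_congr fun L => ?_
  rw [smul_finsum]
  refine finsum_congr fun _ => ?_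
  rw [hT, (hvev L).2, screened_summand hN hq0 hk0 ht0 hq1 hκ1 hgen hs0 hs L, prod_phiFactor,
    smul_eq_mul]
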